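/- **Setting.** Let $m,n\ge 1$ be integers and let $\Omega\subset\mathbb R^m$ be a bounded domain with $C^1$ boundary $\Gamma$. Consider the system, for $i=1,\dots,n$, $$-\sum_{j=1}^n\sum_{p,q=1}^m\bigl(a^{ij}_{pq}\,y^j_{x_p}\bigr)_{x_q}+\sum_{j=1}^n C^{ij}\cdot\nabla y^j+D^i\cdot y=f^i\ \text{ in }\Omega,\qquad y^i=g^i\ \text{ on }\Gamma, \tag{S}$$ where, for all $i,j,p,q$, $a^{ij}_{pq}\in L^\infty(\Omega)$, $a^{ij}_{pq}=a^{ij}_{qp}$, $C^{ij}\in L^\infty(\Omega;\mathbb R^m)$, $D^i\in L^\infty(\Omega;\mathbb R^n)$, $f\in L^\infty(\Omega;\mathbb R^n)$, $g\in H^1(\Omega;\mathbb R^n)$, and where, for some $\rho>0$, $$\sum_{i,j=1}^n\sum_{p,q=1}^m a^{ij}_{pq}(x)\,\xi^i_p\xi^j_q\ \ge\ \rho|\xi|^2\qquad\text{for a.e. }x\in\Omega\text{ and all }\xi\in\mathbb R^{nm}. \tag{1}$$ A weak solution is a $y\in H^1(\Omega;\mathbb R^n)$ with $y^i-g^i\in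 H^1_0(\Omega)$ for all $i$ and $$\sum_{i,j,p,q}\int_\Omega a^{ij}_{pq}y^j_{x_p}\varphi^i_{x_q}\,dx+\int_\Omega\sum_i\Bigl[\sum_j C^{ij}\cdot\nabla y^j\,\varphi^i+D^i\cdot y\,\varphi^i\Bigr]dx=\int_\Omega f\cdot\varphi\,dx\qquad\forall\,\varphi\in H^1_0(\Omega;\mathbb R^n).$$ For real numbers $\theta,\nu$ with $\theta>m$, $\theta\ge2$, consider the condition $$\sum_{i=1}^n\bigl(D^i(x)\cdot\mu\bigr)\mu^i\ \ge\ \nu\,\rho^{\frac{m+\theta}{m-\theta}}\Bigl[\sum_{i,j=1}^n|C^{ij}|_{L^\theta(\Omega;\mathbb R^m)}\Bigr]^{\frac{2\theta}{\theta-m}}|\mu|^2\qquad\text{for a.e. }x\in\Omega\text{ and all }\mu\in\mathbb R^n. \tag{2}$$ Let $M_{pq}$ be the $n\times n$ matrix whose entry in row $r$, column $c$ is $a^{cr}_{pq}$, let $L_{pq}=\det M_{pq}$, and let $v^{ij}_{pq}$ be the (signed) cofactor of $M_{pq}$ at row $i$ and column $j$. **Hypothesis (H)** (with constants $\rho_1,\rho_2,\rho_3>0$).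 There are functions $f_{pq},h^{ij}\in W^{1,\infty}(\Omega)$ such that, a.e. in $\Omega$: 1. $h^{11}=1$, $h^{ij}=h^{ji}$, and the matrix $V=(h^{ij})_{i,j=1}^n$ satisfies $V\ge\rho_1 I_{n\times n}$; 2. the functions $E^{ij}:=\dfrac{f_{pq}}{L_{pq}}\sum_{l=1}^n h^{lj}v^{li}_{pq}$ do not depend on $p,q$, and $E^{ij}\in W^{1,\infty}(\Omega)$; 3. the matrix $F=(F_{pq})_{p,q=1}^m$, $F_{pq}:=\sum_{l=1}^n a^{l1}_{pq}E^{l1}$, satisfies $F\ge\rho_2 I_{m\times m}$; 4. the $nm\times nm$ block matrix $M=(h^{ij}F)_{i,j=1}^n$ satisfies $M\ge\rho_3 I_{nm\times nm}$. The boundary supremum is understood in the sense of $H^1(\Omega)$: $\operatorname{ess\,sup}_\Gamma|y|$ is the infimum of all $k\ge0$ with $(|y|-k)_+\in H^1_0(\Omega)$ ($+\infty$ if there is none). **Theorem.** For every $\theta>m$ with $\theta\ge 2$ there is a constant $\nu_0=\nu_0(n,m,\theta)>0$ with the following two properties, for every $\Omega$ as above. (a) If (2) holds for some $\nu\ge\nu_0$,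 then (S) has a unique weak solution $y\in H^1(\Omega;\mathbb R^n)$. (b) If (2) holds for some $\nu\ge\nu_0$, if $L_{pq}\ne0$ a.e. in $\Omega$ for all $p,q$, and if (H) holds, then the weak solution $y$ of (S) satisfies $$\operatorname*{ess\,sup}_\Omega|y|\ \le\ C,$$ where $C$ is finite whenever $\operatorname{ess\,sup}_\Gamma|y|<\infty$ and depends only on $m$, $n$, $\Omega$, $\rho,\rho_1,\rho_2,\rho_3$ and on upper bounds for $|a^{ij}_{pq}|_{L^\infty(\Omega)}$, $|C^{ij}|_{L^\infty(\Omega;\mathbb R^m)}$, $|D^i|_{L^\infty(\Omega;\mathbb R^n)}$, $|E^{ij}|_{W^{1,\infty}(\Omega)}$, $|h^{ij}|_{W^{1,\infty}(\Omega)}$, $|g|_{H^1(\Omega;\mathbb R^n)}$, $|f|_{L^\infty(\Omega;\mathbb R^n)}$ and $\operatorname{ess\,sup}_\Gamma|y|$ (in particular not on $\theta$, $\nu$ or the $f_{pq}$). -/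

import Mathlib

open MeasureTheory Set
open scoped ENNReal NNReal ContDiff

noncomputable section

/-- The Euclidean space `ℝᵏ`. -/
abbrev Euc (k : ℕ) : Type := EuclideanSpace ℝ (Fin k)

/-! ### Domains -/

/-- `Ω` is a bounded domain (nonempty, open, connected) with boundary of class `C¹`: near every
boundary point there are a unit direction `e` and a `C¹` function `γ` not depending on the
coordinate along `e` (that is, a `C¹` function of the remaining coordinates), such that `Ω` is
locally the set of points lying above the graph of `γ` in the direction `e`. -/
structure IsBoundedC1Domain {m : ℕ} (Ω : Set (Euc m)) : Prop where
  isOpen : IsOpen Ω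
  isConnected : IsConnected Ω
  isBounded : Bornology.IsBounded Ω
  boundary : ∀ x₀ ∈ frontier Ω, ∃ (e : Euc m) (γ : Euc m → ℝ) (r : ℝ),
    ‖e‖ = 1 ∧ ContDiff ℝ 1 γ ∧ (∀ (x : Euc m) (t : ℝ), γ (x + t • e) = γ x) ∧ 0 < r ∧
    Ω ∩ Metric.ball x₀ r = {x ∈ Metric.ball x₀ r | γ x < inner ℝ e x}

/-! ### Sobolev spaces -/

/-- `φ` belongs to `C_c^∞(Ω)`. -/
def IsTestFun {m : ℕ} (Ω : Set (Euc m)) (φ : Euc m → ℝ) : Prop :=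
  ContDiff ℝ ∞ φ ∧ HasCompactSupport φ ∧ tsupport φ ⊆ Ω

/-- `G` is a weak gradient of `u` in `Ω`: `∫_Ω u φ_{x_p} = - ∫_Ω G_p φ` for every coordinate `p` and
every `φ ∈ C_c^∞(Ω)`. -/
structure IsWeakGrad {m : ℕ} (Ω : Set (Euc m)) (u : Euc m → ℝ) (G : Euc m → Euc m) : Prop where
  locInt : LocallyIntegrableOn u Ω volume
  locInt_grad : LocallyIntegrableOn G Ω volume
  integral_eq : ∀ φ : Euc m → ℝ, IsTestFun Ω φ → ∀ p : Fin m,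
    ∫ x in Ω, u x * gradient φ x p = - ∫ x in Ω, G x p * φ x

open Classical in
/-- The weak gradient of `u` in `Ω` (unique up to a null set of `Ω` if it exists; `0` if there is
none). -/
def weakGrad {m : ℕ} (Ω : Set (Euc m)) (u : Euc m → ℝ) : Euc m → Euc m :=
  if h : ∃ G, IsWeakGrad Ω u G then h.choose else 0

/-- `u ∈ W^{1,p}(Ω)`. -/
def MemW1 {m : ℕ} (Ω : Set (Euc m)) (p : ℝ≥0∞) (u : Euc m → ℝ) : Prop :=
  ∃ G, IsWeakGrad Ω u G ∧ MemLp u p (volume.restrict Ω) ∧ MemLp G p (volume.restrict Ω)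

/-- `u ∈ H^1_0(Ω)`, the closure of `C_c^∞(Ω)` in `H^1(Ω) = W^{1,2}(Ω)`. -/
def MemH10 {m : ℕ} (Ω : Set (Euc m)) (u : Euc m → ℝ) : Prop :=
  MemW1 Ω 2 u ∧ ∀ ε : ℝ≥0∞, 0 < ε → ∃ φ : Euc m → ℝ, IsTestFun Ω φ ∧
    eLpNorm (fun x => u x - φ x) 2 (volume.restrict Ω) ≤ ε ∧
    eLpNorm (fun x => weakGrad Ω u x - gradient φ x) 2 (volume.restrict Ω) ≤ ε

/-- The `W^{1,∞}(Ω)` norm `|u|_{L^∞} + |∇u|_{L^∞}`. -/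
def w1InfNorm {m : ℕ} (Ω : Set (Euc m)) (u : Euc m → ℝ) : ℝ≥0∞ :=
  eLpNorm u ∞ (volume.restrict Ω) + eLpNorm (weakGrad Ω u) ∞ (volume.restrict Ω)

/-- The `H^1(Ω; ℝⁿ)` norm `(∑_i |u^i|²_{L²} + |∇u^i|²_{L²})^{1/2}`. -/
def h1Norm {m n : ℕ} (Ω : Set (Euc m)) (u : Euc m → Euc n) : ℝ≥0∞ :=
  (∑ i : Fin n, (eLpNorm (fun x => u x i) 2 (volume.restrict Ω) ^ 2
    + eLpNorm (weakGrad Ω (fun x => u x i)) 2 (volume.restrict Ω) ^ 2)) ^ (1 / 2 : ℝ)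

/-- The essential supremum over `Γ = ∂Ω` of `|u|`, `u ∈ H^1(Ω; ℝⁿ)`, with boundary values understood,
as usual in `H^1(Ω)`, through `H^1_0(Ω)`: `|u| ≤ k` on `Γ` means `(|u| - k)_+ ∈ H^1_0(Ω)`, and
the essential supremum is the infimum of all such `k` (`∞` if there is none). -/
def boundaryEssSup {m n : ℕ} (Ω : Set (Euc m)) (u : Euc m → Euc n) : ℝ≥0∞ :=
  ⨅ (k : ℝ≥0) (_ : MemH10 Ω (fun x => max (‖u x‖ - k) 0)), (k : ℝ≥0∞)

/-! ### The system -/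

/-- The data of the system
`- ∑_{j,p,q} (a^{ij}_{pq} y^j_{x_p})_{x_q} + ∑_j C^{ij}·∇y^j + D^i·y = f^i` in `Ω`,
`y^i = g^i` on `∂Ω`, for `i = 1, …, n`. -/
structure EllipticSystem (m n : ℕ) where
  /-- `a i j p q` is `a^{ij}_{pq}` -/
  a : Fin n → Fin n → Fin m → Fin m → Euc m → ℝ
  C : Fin n → Fin n → Euc m → Euc m
  D : Fin n → Euc m → Euc n
  f : Euc m → Euc n
  g : Euc m → Euc n

namespace EllipticSystem

variable {m n : ℕ}

/-- `y ∈ H^1(Ω; ℝⁿ)` is a weak solution of the system (with `f ∈ L²(Ω; ℝⁿ) ⊆ H^{-1}(Ω; ℝⁿ)`). -/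
structure IsWeakSolution (S : EllipticSystem m n) (Ω : Set (Euc m)) (y : Euc m → Euc n) :
    Prop where
  memH1 : ∀ i, MemW1 Ω 2 (fun x => y x i)
  boundary : ∀ i, MemH10 Ω (fun x => y x i - S.g x i)
  weak_eq : ∀ φ : Euc m → Euc n, (∀ i, MemH10 Ω (fun x => φ x i)) →
    (∑ i, ∑ j, ∑ p, ∑ q, ∫ x in Ω,
        S.a i j p q x * weakGrad Ω (fun z => y z j) x p * weakGrad Ω (fun z => φ z i) x q)
      + (∫ x in Ω, ∑ i, ((∑ j, inner ℝ (S.C i j x) (weakGrad Ω (fun z => y z j) x) * φ x i)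
          + inner ℝ (S.D i x) (y x) * φ x i))
      = ∫ x in Ω, ∑ i, S.f x i * φ x i

/-- The standing assumptions on the data, with ellipticity constant `ρ`. -/
structure StandingAssumptions (S : EllipticSystem m n) (Ω : Set (Euc m)) (ρ : ℝ) : Prop where
  a_mem : ∀ i j p q, MemLp (S.a i j p q) ∞ (volume.restrict Ω)
  a_symm : ∀ i j p q, ∀ᵐ x ∂(volume.restrict Ω), S.a i j p q x = S.a i j q p x
  elliptic : ∀ᵐ x ∂(volume.restrict Ω), ∀ ξ : Fin n → Fin m → ℝ,
    ρ * ∑ i, ∑ p, ξ i p ^ 2 ≤ ∑ i, ∑ j, ∑ p, ∑ q, S.a i j p q x * ξ i p * ξ j q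
  C_mem : ∀ i j, MemLp (S.C i j) ∞ (volume.restrict Ω)
  D_mem : ∀ i, MemLp (S.D i) ∞ (volume.restrict Ω)
  f_mem : MemLp S.f ∞ (volume.restrict Ω)
  g_mem : ∀ i, MemW1 Ω 2 (fun x => S.g x i)

/-- The lower bound on the zero-order coefficients: for almost every `x ∈ Ω` and all `μ ∈ ℝⁿ`,
`∑_i (D^i(x)·μ) μ^i ≥ ν ρ^{(m+θ)/(m-θ)} [∑_{i,j} |C^{ij}|_{L^θ(Ω)}]^{2θ/(θ-m)} |μ|²`. -/
def ZeroOrderCoercive (S : EllipticSystem m n) (Ω : Set (Euc m)) (ρ θ ν : ℝ) : Prop :=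
  ∀ᵐ x ∂(volume.restrict Ω), ∀ μ : Euc n,
    ν * ρ ^ ((m + θ) / (m - θ))
      * (∑ i, ∑ j, (eLpNorm (S.C i j) (ENNReal.ofReal θ) (volume.restrict Ω)).toReal)
          ^ (2 * θ / (θ - m)) * ‖μ‖ ^ 2
      ≤ ∑ i, inner ℝ (S.D i x) μ * μ i

/-- The matrix `M_{pq}(x)`, whose entry in row `r` and column `c` is `a^{cr}_{pq}(x)`. -/
def Mpq (S : EllipticSystem m n) (p q : Fin m) (x : Euc m) : Matrix (Fin n) (Fin n) ℝ :=
  Matrix.of fun r c => S.a c r p q x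

/-- `L_{pq} = det M_{pq}`. -/
def Lpq (S : EllipticSystem m n) (p q : Fin m) (x : Euc m) : ℝ := (S.Mpq p q x).det

/-- `v^{ij}_{pq}`, the (signed) cofactor of `M_{pq}` at row `i` and column `j`; the adjugate is
the transpose of the matrix of cofactors. -/
def cof (S : EllipticSystem m n) (i j : Fin n) (p q : Fin m) (x : Euc m) : ℝ :=
  (S.Mpq p q x).adjugate j i

/-- `F_{pq} = ∑_l a^{l1}_{pq} E^{l1}`. The index `1` of the text is `0 : Fin n`. -/
def Fpq [NeZero n] (S : EllipticSystem m n) (E : Fin n → Fin n → Euc m → ℝ) (p q : Fin m)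
    (x : Euc m) : ℝ :=
  ∑ l, S.a l 0 p q x * E l 0 x

/-- The functions `h^{ij}`, `f_{pq}` and `E^{ij}` satisfy the structural hypothesis (H) with constants
`ρ₁`, `ρ₂`, `ρ₃`. -/
structure HypothesisH [NeZero n] (S : EllipticSystem m n) (Ω : Set (Euc m)) (ρ₁ ρ₂ ρ₃ : ℝ)
    (h : Fin n → Fin n → Euc m → ℝ) (w : Fin m → Fin m → Euc m → ℝ)
    (E : Fin n → Fin n → Euc m → ℝ) : Prop where
  h_mem : ∀ i j, MemW1 Ω ∞ (h i j)
  w_mem : ∀ p q, MemW1 Ω ∞ (w p q)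
  h_one : ∀ᵐ x ∂(volume.restrict Ω), h 0 0 x = 1
  h_symm : ∀ i j, ∀ᵐ x ∂(volume.restrict Ω), h i j x = h j i x
  V_pos : ∀ᵐ x ∂(volume.restrict Ω), ∀ ξ : Fin n → ℝ,
    ρ₁ * ∑ i, ξ i ^ 2 ≤ ∑ i, ∑ j, h i j x * ξ i * ξ j
  E_eq : ∀ i j p q, ∀ᵐ x ∂(volume.restrict Ω),
    E i j x = w p q x / S.Lpq p q x * ∑ l, h l j x * S.cof l i p q x
  E_mem : ∀ i j, MemW1 Ω ∞ (E i j)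
  F_pos : ∀ᵐ x ∂(volume.restrict Ω), ∀ ξ : Fin m → ℝ,
    ρ₂ * ∑ p, ξ p ^ 2 ≤ ∑ p, ∑ q, S.Fpq E p q x * ξ p * ξ q
  M_pos : ∀ᵐ x ∂(volume.restrict Ω), ∀ ξ : Fin n → Fin m → ℝ,
    ρ₃ * ∑ i, ∑ p, ξ i p ^ 2
      ≤ ∑ i, ∑ j, ∑ p, ∑ q, h i j x * S.Fpq E p q x * ξ i p * ξ j q

end EllipticSystem

end

noncomputable section

section
open Filter Topology

/-! ### Convergence in `L²` -/

/-! Solvability. Put l = m/θ. A weighted Gagliardo–Nirenberg inequality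
(`exists_gagliardoNirenberg`) bounds ‖|C|u‖ in L² by κ |C|_{L^θ} ‖u‖^{1-l} ‖∇u‖^l for u in H¹₀. The
first-order terms are therefore at most κ Σ|C^{ij}| X^{1+l} Y^{1-l}, where X and Y are the L² norms
of the gradient and of the function. Young's inequality (`young_rpow`) splits this into (ρ/2)X² and
a multiple of Y² whose dependence on ρ and on Σ|C^{ij}| is exactly that of condition (2). Hence, for
ν large, the quadratic form dominates (ρ/2)X² (`EllipticSystem.exists_coercive`), and Lax–Milgram
for y - g, with the Poincaré inequality, gives existence; the difference of two solutions is an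
admissible test function, which gives uniqueness.

Boundedness. An elliptic system has no maximum principle in general; hypothesis (H) supplies a
substitute. Since a matrix times its adjugate is its determinant times the identity, the E^{ik}
satisfy Σ_i a^{ij}_{pq} E^{ik} = h^{jk} F_{pq} (`EllipticSystem.HypothesisH.sum_a_mul_E`):
multiplied by E, the system acquires the principal part h^{jk}F, one scalar operator weighted by the
symmetric matrix V. Let W = Σ h^{ij} y^i y^j, which is comparable to |y|², and let ψ be a C¹ cut-off
vanishing for W ≤ s. Testing with φ^i = Σ_k E^{ik} y^k ψ(W) turns the principal part into ψ Σ h^{jk}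
F(∇y^j,∇y^k) + (ψ'/2) F(∇W - Z,∇W), with Z = Σ y^i y^j ∇h^{ij}. The two positivity assumptions, on M
and on F, make this coercive, and everything else is bounded by |y|² on {W > s}. This yields Σ_k
∫|∇(y^k ψ)|² ≤ C ∫_{W>s} |y|² (`EllipticSystem.exists_energy_bound`).

A De Giorgi iteration over levels increasing from S to 2S then shows W ≤ 2S almost everywhere
(`exists_ae_le_of_energy_bound`), provided that S is large in terms of a bound for ‖y‖ in L², which
the coercivity gives (`EllipticSystem.exists_integral_norm_sq_le`). All constants are fixed before
the system is; θ and ν act only through the coercivity, whose constant ρ/2 does not see them.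

The test functions must belong to H¹₀. This follows without traces from two facts about Sobolev
functions: a chain rule for C¹ functions of linear growth (`HasH1Grad.comp`), and the principle that
an H¹ function dominated by an H¹₀ function is in H¹₀ (`HasH10Grad.of_abs_le`), applied with (|y| -
k)_+ as the dominating function. -/

theorem ENNReal.tendsto_zero_of_le {ι : Type*} {l : Filter ι} {f g : ι → ℝ≥0∞}
    (hg : Tendsto g l (𝓝 0)) (hfg : ∀ n, f n ≤ g n) : Tendsto f l (𝓝 0) := by
  rw [ENNReal.tendsto_nhds_zero] at hg ⊢
  intro ε hε
  filter_upwards [hg ε hε] with n hn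
  exact (hfg n).trans hn

section LTwo

variable {α : Type*} [MeasurableSpace α] {μ : Measure α}
  {E : Type*} [NormedAddCommGroup E]

theorem tendsto_eLpNorm_two_of_dominated {f : ℕ → α → E} {g : α → E} {b : α → ℝ}
    (hf : ∀ n, AEStronglyMeasurable (f n) μ) (hg : AEStronglyMeasurable g μ)
    (hb : MemLp b 2 μ) (hfb : ∀ n, ∀ᵐ x ∂μ, ‖f n x - g x‖ ≤ b x)
    (hlim : ∀ᵐ x ∂μ, Tendsto (fun n => f n x) atTop (𝓝 (g x))) :
    Tendsto (fun n => eLpNorm (fun x => f n x - g x) 2 μ) atTop (𝓝 0) := by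
  have key : Tendsto (fun n => ∫⁻ x, ‖f n x - g x‖ₑ ^ (2 : ℝ) ∂μ) atTop (𝓝 (∫⁻ _, 0 ∂μ)) := by
    refine tendsto_lintegral_of_dominated_convergence' (fun x => ‖b x‖ₑ ^ (2 : ℝ))
      (fun n => ((hf n).sub hg).enorm.pow_const _) (fun n => ?_) ?_ ?_
    · filter_upwards [hfb n] with x hx
      refine ENNReal.rpow_le_rpow ?_ (by norm_num)
      rw [← ofReal_norm, ← ofReal_norm]
      exact ENNReal.ofReal_le_ofReal (hx.trans (le_abs_self _))
    · have := hb.2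
      rw [eLpNorm_lt_top_iff_lintegral_rpow_enorm_lt_top (by norm_num) (by norm_num)] at this
      simpa using this.ne
    · filter_upwards [hlim] with x hx
      have h1 : Tendsto (fun n => ‖f n x - g x‖ₑ) atTop (𝓝 0) := by
        have := (hx.sub_const (g x)).enorm
        simpa using this
      have := h1.ennrpow_const (2 : ℝ)
      simpa using this
  have := key.ennrpow_const (1 / 2 : ℝ)
  simp only [lintegral_zero] at this
  rw [ENNReal.zero_rpow_of_pos (by norm_num)] at this
  refine this.congr fun n => ?_
  rw [eLpNorm_eq_lintegral_rpow_enorm_toReal (by norm_num) (by norm_num)]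
  simp

theorem tendsto_integral_mul_of_eLpNorm_two {f : ℕ → α → ℝ} {g b : α → ℝ}
    (hf : ∀ n, MemLp (f n) 2 μ) (hg : MemLp g 2 μ) (hb : MemLp b 2 μ)
    (hlim : Tendsto (fun n => eLpNorm (fun x => f n x - g x) 2 μ) atTop (𝓝 0)) :
    Tendsto (fun n => ∫ x, f n x * b x ∂μ) atTop (𝓝 (∫ x, g x * b x ∂μ)) := by
  refine tendsto_integral_of_L1' _ (hg.1.mul hb.1)
    (Eventually.of_forall fun n => (hf n).integrable_mul hb) ?_
  have h0 : Tendsto (fun n => eLpNorm (fun x => f n x - g x) 2 μ * eLpNorm b 2 μ) atTop (𝓝 0) := by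
    have := ENNReal.Tendsto.mul_const hlim (b := eLpNorm b 2 μ) (Or.inr hb.2.ne)
    simpa using this
  refine ENNReal.tendsto_zero_of_le h0 ?_
  intro n
  have h1 := eLpNorm_smul_le_mul_eLpNorm (p := 2) (q := 2) (r := 1) hb.1 ((hf n).1.sub hg.1)
  refine le_trans (le_of_eq ?_) h1
  congr 1
  ext x
  simp [sub_mul]

/-- The difference is a_n (G_n - G') + (a_n - a') G': the uniform bound on a_n handles the first
term, dominated convergence with majorant 2c|G'| the second. This is the limit passage for products
in which the coefficient converges only almost everywhere and the gradient in L². -/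
theorem tendsto_eLpNorm_two_smul [NormedSpace ℝ E] {a : ℕ → α → ℝ} {a' : α → ℝ} {G : ℕ → α → E}
    {G' : α → E} {c : ℝ} (ha : ∀ n, AEStronglyMeasurable (a n) μ)
    (ha' : AEStronglyMeasurable a' μ)
    (hac : ∀ n, ∀ᵐ x ∂μ, |a n x| ≤ c) (hlim : ∀ᵐ x ∂μ, Tendsto (fun n => a n x) atTop (𝓝 (a' x)))
    (hG : ∀ n, AEStronglyMeasurable (G n) μ) (hG' : MemLp G' 2 μ)
    (hGlim : Tendsto (fun n => eLpNorm (fun x => G n x - G' x) 2 μ) atTop (𝓝 0)) :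
    Tendsto (fun n => eLpNorm (fun x => a n x • G n x - a' x • G' x) 2 μ) atTop (𝓝 0) := by
  have hac' : ∀ᵐ x ∂μ, |a' x| ≤ c := by
    filter_upwards [hlim, ae_all_iff.2 hac] with x hx hc
    exact le_of_tendsto hx.abs (Eventually.of_forall hc)
  have h1 : Tendsto (fun n => eLpNorm (fun x => a n x • G' x - a' x • G' x) 2 μ) atTop (𝓝 0) := by
    refine tendsto_eLpNorm_two_of_dominated (b := fun x => 2 * c * ‖G' x‖)
      (fun n => (ha n).smul hG'.1) (ha'.smul hG'.1) (hG'.norm.const_mul _) (fun n => ?_) ?_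
    · filter_upwards [hac n, hac'] with x hx hx'
      rw [← sub_smul, norm_smul, Real.norm_eq_abs]
      gcongr
      calc |a n x - a' x| ≤ |a n x| + |a' x| := abs_sub _ _
        _ ≤ 2 * c := by linarith
    · filter_upwards [hlim] with x hx
      exact hx.smul_const _
  have h2 : Tendsto (fun n => eLpNorm (fun x => a n x • (G n x - G' x)) 2 μ) atTop (𝓝 0) := by
    have h0 : Tendsto (fun n => ENNReal.ofReal c * eLpNorm (fun x => G n x - G' x) 2 μ)
        atTop (𝓝 0) := by
      have := ENNReal.Tendsto.const_mul hGlim (a := ENNReal.ofReal c) (Or.inr ENNReal.ofReal_ne_top)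
      simpa using this
    refine ENNReal.tendsto_zero_of_le h0 ?_
    intro n
    refine eLpNorm_le_mul_eLpNorm_of_ae_le_mul ?_ 2
    filter_upwards [hac n] with x hx
    rw [norm_smul, Real.norm_eq_abs]
    gcongr
  have h12 := h2.add h1
  rw [add_zero] at h12
  refine ENNReal.tendsto_zero_of_le h12 ?_
  intro n
  refine le_trans (le_of_eq ?_) (eLpNorm_add_le
    ((ha n).smul ((hG n).sub hG'.1)) (((ha n).smul hG'.1).sub (ha'.smul hG'.1)) (by norm_num))
  congr 1
  ext x
  simp [smul_sub]

theorem exists_subseq_tendsto_ae_of_eLpNorm_two {f : ℕ → α → E} {g : α → E}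
    (hf : ∀ n, AEStronglyMeasurable (f n) μ) (hg : AEStronglyMeasurable g μ)
    (hlim : Tendsto (fun n => eLpNorm (fun x => f n x - g x) 2 μ) atTop (𝓝 0)) :
    ∃ ns : ℕ → ℕ, StrictMono ns ∧ ∀ᵐ x ∂μ, Tendsto (fun i => f (ns i) x) atTop (𝓝 (g x)) :=
  (tendstoInMeasure_of_tendsto_eLpNorm (by norm_num) hf hg hlim).exists_seq_tendsto_ae

theorem tendsto_eLpNorm_two_add {f₁ f₂ : ℕ → α → E} {g₁ g₂ : α → E}
    (hf₁ : ∀ n, AEStronglyMeasurable (f₁ n) μ) (hg₁ : AEStronglyMeasurable g₁ μ)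
    (hf₂ : ∀ n, AEStronglyMeasurable (f₂ n) μ) (hg₂ : AEStronglyMeasurable g₂ μ)
    (h₁ : Tendsto (fun n => eLpNorm (fun x => f₁ n x - g₁ x) 2 μ) atTop (𝓝 0))
    (h₂ : Tendsto (fun n => eLpNorm (fun x => f₂ n x - g₂ x) 2 μ) atTop (𝓝 0)) :
    Tendsto (fun n => eLpNorm (fun x => (f₁ n x + f₂ n x) - (g₁ x + g₂ x)) 2 μ) atTop (𝓝 0) := by
  have h12 := h₁.add h₂
  rw [add_zero] at h12
  refine ENNReal.tendsto_zero_of_le h12 ?_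
  intro n
  refine le_trans (le_of_eq ?_) (eLpNorm_add_le ((hf₁ n).sub hg₁) ((hf₂ n).sub hg₂) (by norm_num))
  congr 1
  ext x
  simp only [Pi.add_apply]
  abel

end LTwo

/-! ### Sobolev functions with a chosen weak gradient -/

theorem eLpNorm_fun_sub_comm {α E : Type*} [MeasurableSpace α] [NormedAddCommGroup E]
    {μ : Measure α} {f g : α → E} {p : ℝ≥0∞} :
    eLpNorm (fun x => f x - g x) p μ = eLpNorm (fun x => g x - f x) p μ :=
  eLpNorm_sub_comm f g p μ

theorem MeasureTheory.MemLp.integrable_fun_mul {α : Type*} [MeasurableSpace α] {μ : Measure α}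
    {f g : α → ℝ} (hf : MemLp f 2 μ) (hg : MemLp g 2 μ) : Integrable (fun x => f x * g x) μ :=
  hf.integrable_mul (q := 2) hg

theorem gradient_apply_eq_fderiv {m : ℕ} (φ : Euc m → ℝ) (x : Euc m) (p : Fin m) :
    gradient φ x p = fderiv ℝ φ x (EuclideanSpace.single p 1) := by
  rw [← inner_gradient_left, EuclideanSpace.inner_single_right]
  simp

theorem continuous_gradient {m : ℕ} {φ : Euc m → ℝ} (h : ContDiff ℝ 1 φ) :
    Continuous (gradient φ) :=
  (InnerProductSpace.toDual ℝ (Euc m)).symm.continuous.comp (h.continuous_fderiv one_ne_zero)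

theorem HasCompactSupport.gradient {m : ℕ} {φ : Euc m → ℝ} (h : HasCompactSupport φ) :
    HasCompactSupport (gradient φ) :=
  (h.fderiv ℝ).comp_left (g := (InnerProductSpace.toDual ℝ (Euc m)).symm) (map_zero _)

theorem gradient_eq_zero_of_notMem_tsupport {m : ℕ} {φ : Euc m → ℝ} {x : Euc m}
    (hx : x ∉ tsupport φ) : gradient φ x = 0 := by
  have : fderiv ℝ φ x = 0 := by
    by_contra h
    exact hx (support_fderiv_subset ℝ h)
  simp [_root_.gradient, this]

namespace IsTestFun

variable {m : ℕ} {Ω : Set (Euc m)} {φ ψ : Euc m → ℝ}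

theorem contDiff_one (h : IsTestFun Ω φ) : ContDiff ℝ 1 φ := h.1.of_le (by exact_mod_cast le_top)

theorem memLp (h : IsTestFun Ω φ) (μ : Measure (Euc m)) [IsFiniteMeasureOnCompacts μ] (p : ℝ≥0∞) :
    MemLp φ p μ :=
  h.1.continuous.memLp_of_hasCompactSupport h.2.1

theorem memLp_gradient (h : IsTestFun Ω φ) (μ : Measure (Euc m)) [IsFiniteMeasureOnCompacts μ]
    (p : ℝ≥0∞) : MemLp (gradient φ) p μ :=
  (continuous_gradient h.contDiff_one).memLp_of_hasCompactSupport h.2.1.gradient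

theorem zero : IsTestFun Ω (fun _ => (0 : ℝ)) :=
  ⟨contDiff_const, HasCompactSupport.zero, by
    rw [show (fun _ : Euc m => (0 : ℝ)) = 0 from rfl, tsupport_zero]; exact empty_subset _⟩

theorem differentiable (h : IsTestFun Ω φ) : Differentiable ℝ φ :=
  h.1.differentiable (by simp)

theorem add (h : IsTestFun Ω φ) (h' : IsTestFun Ω ψ) : IsTestFun Ω (fun x => φ x + ψ x) :=
  ⟨h.1.add h'.1, h.2.1.add h'.2.1, (tsupport_add φ ψ).trans (union_subset h.2.2 h'.2.2)⟩

theorem const_mul (h : IsTestFun Ω φ) (c : ℝ) : IsTestFun Ω (fun x => c * φ x) :=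
  ⟨contDiff_const.mul h.1, h.2.1.mul_left, (tsupport_mul_subset_right).trans h.2.2⟩

theorem gradient_add (h : IsTestFun Ω φ) (h' : IsTestFun Ω ψ) (x : Euc m) :
    gradient (fun x => φ x + ψ x) x = gradient φ x + gradient ψ x := by
  ext p
  rw [gradient_apply_eq_fderiv, fderiv_fun_add (h.differentiable x) (h'.differentiable x)]
  simp [gradient_apply_eq_fderiv]

theorem gradient_const_mul (h : IsTestFun Ω φ) (c : ℝ) (x : Euc m) :
    gradient (fun x => c * φ x) x = c • gradient φ x := by
  ext p
  rw [gradient_apply_eq_fderiv, fderiv_const_mul (h.differentiable x)]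
  simp [gradient_apply_eq_fderiv]

end IsTestFun

/-- `u ∈ H¹(Ω)` with weak gradient `G`. -/
structure HasH1Grad {m : ℕ} (Ω : Set (Euc m)) (u : Euc m → ℝ) (G : Euc m → Euc m) : Prop where
  memLp : MemLp u 2 (volume.restrict Ω)
  memLp_grad : MemLp G 2 (volume.restrict Ω)
  integral_eq : ∀ φ : Euc m → ℝ, IsTestFun Ω φ → ∀ p : Fin m,
    ∫ x in Ω, u x * gradient φ x p = - ∫ x in Ω, G x p * φ x

/-- `u ∈ H¹₀(Ω)` with weak gradient `G`. -/
structure HasH10Grad {m : ℕ} (Ω : Set (Euc m)) (u : Euc m → ℝ) (G : Euc m → Euc m) : Prop where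
  memLp : MemLp u 2 (volume.restrict Ω)
  memLp_grad : MemLp G 2 (volume.restrict Ω)
  approx : ∀ ε : ℝ≥0∞, 0 < ε → ∃ φ : Euc m → ℝ, IsTestFun Ω φ ∧
    eLpNorm (fun x => u x - φ x) 2 (volume.restrict Ω) ≤ ε ∧
    eLpNorm (fun x => G x - gradient φ x) 2 (volume.restrict Ω) ≤ ε

section Basic

variable {m : ℕ} {Ω : Set (Euc m)} {u v : Euc m → ℝ} {G H : Euc m → Euc m}

theorem HasH1Grad.isWeakGrad (h : HasH1Grad Ω u G) : IsWeakGrad Ω u G where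
  locInt := locallyIntegrableOn_of_locallyIntegrable_restrict
    (h.memLp.locallyIntegrable (by norm_num))
  locInt_grad := locallyIntegrableOn_of_locallyIntegrable_restrict
    (h.memLp_grad.locallyIntegrable (by norm_num))
  integral_eq := h.integral_eq

theorem IsWeakGrad.hasH1Grad (h : IsWeakGrad Ω u G) (hu : MemLp u 2 (volume.restrict Ω))
    (hG : MemLp G 2 (volume.restrict Ω)) : HasH1Grad Ω u G := ⟨hu, hG, h.integral_eq⟩

/-- The fundamental lemma of the calculus of variations, applied to each coordinate of the
difference. It permits trading the arbitrary choice made in `weakGrad` for whichever explicit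
gradient a computation produces. -/
theorem IsWeakGrad.ae_eq (hΩ : IsOpen Ω) (h : IsWeakGrad Ω u G) (h' : IsWeakGrad Ω u H) :
    G =ᵐ[volume.restrict Ω] H := by
  have key : ∀ p : Fin m, ∀ᵐ x ∂volume, x ∈ Ω → G x p - H x p = 0 := by
    intro p
    have hloc : ∀ {K : Euc m → Euc m}, LocallyIntegrableOn K Ω volume →
        LocallyIntegrableOn (fun x => K x p) Ω volume := by
      intro K hK x hx
      obtain ⟨s, hs, hsK⟩ := hK x hx
      exact ⟨s, hs, (EuclideanSpace.proj (𝕜 := ℝ) p).integrable_comp hsK⟩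
    refine hΩ.ae_eq_zero_of_integral_contDiff_smul_eq_zero
      ((hloc h.locInt_grad).sub (hloc h'.locInt_grad)) ?_
    intro φ hφ hφc hφΩ
    have e1 := h.integral_eq φ ⟨hφ, hφc, hφΩ⟩ p
    have e2 := h'.integral_eq φ ⟨hφ, hφc, hφΩ⟩ p
    have hint : ∀ {K : Euc m → Euc m}, LocallyIntegrableOn K Ω volume →
        IntegrableOn (fun x => K x p * φ x) Ω volume := by
      intro K hK
      have h0 : IntegrableOn (fun x => φ x • K x p) (tsupport φ) volume :=
        ((hloc hK).integrableOn_compact_subset hφΩ hφc).continuousOn_smul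
          hφ.continuous.continuousOn hφc
      have : Integrable (fun x => φ x • K x p) volume := by
        rw [← integrableOn_iff_integrable_of_support_subset (s := tsupport φ)]
        · exact h0
        · intro x hx
          exact subset_tsupport φ (fun h0 => hx (by simp [h0]))
      refine (this.integrableOn (s := Ω)).congr (ae_of_all _ fun x => ?_)
      simp [mul_comm]
    have e3 : ∫ x in Ω, (G x p - H x p) * φ x = 0 := by
      simp only [sub_mul]
      rw [integral_sub (hint h.locInt_grad) (hint h'.locInt_grad)]
      linarith
    rw [← setIntegral_eq_integral_of_forall_compl_eq_zero (s := Ω), ← e3]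
    · congr 1
      ext x
      simp [mul_comm]
    · intro x hx
      rw [image_eq_zero_of_notMem_tsupport (fun h => hx (hφΩ h)), zero_smul]
  rw [EventuallyEq, ae_restrict_iff' hΩ.measurableSet]
  filter_upwards [ae_all_iff.2 key] with x hx hxΩ
  ext p
  exact sub_eq_zero.1 (hx p hxΩ)

theorem IsWeakGrad.weakGrad_ae_eq (hΩ : IsOpen Ω) (h : IsWeakGrad Ω u G) :
    weakGrad Ω u =ᵐ[volume.restrict Ω] G := by
  have hex : ∃ G, IsWeakGrad Ω u G := ⟨G, h⟩
  rw [weakGrad, dif_pos hex]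
  exact hex.choose_spec.ae_eq hΩ h

theorem HasH1Grad.congr (h : HasH1Grad Ω u G) (hu : u =ᵐ[volume.restrict Ω] v)
    (hG : G =ᵐ[volume.restrict Ω] H) : HasH1Grad Ω v H where
  memLp := h.memLp.ae_eq hu
  memLp_grad := h.memLp_grad.ae_eq hG
  integral_eq φ hφ p := by
    have e1 : ∫ x in Ω, v x * gradient φ x p = ∫ x in Ω, u x * gradient φ x p :=
      integral_congr_ae (by filter_upwards [hu] with x hx; rw [hx])
    have e2 : ∫ x in Ω, H x p * φ x = ∫ x in Ω, G x p * φ x :=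
      integral_congr_ae (by filter_upwards [hG] with x hx; rw [hx])
    rw [e1, e2, h.integral_eq φ hφ p]

theorem HasH1Grad.memW1 (h : HasH1Grad Ω u G) : MemW1 Ω 2 u :=
  ⟨G, h.isWeakGrad, h.memLp, h.memLp_grad⟩

theorem HasH1Grad.weakGrad_ae_eq (hΩ : IsOpen Ω) (h : HasH1Grad Ω u G) :
    weakGrad Ω u =ᵐ[volume.restrict Ω] G := h.isWeakGrad.weakGrad_ae_eq hΩ

theorem HasH1Grad.ae_eq (hΩ : IsOpen Ω) (h : HasH1Grad Ω u G) (h' : HasH1Grad Ω u H) :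
    G =ᵐ[volume.restrict Ω] H := h.isWeakGrad.ae_eq hΩ h'.isWeakGrad

theorem MemW1.hasH1Grad (hΩ : IsOpen Ω) (h : MemW1 Ω 2 u) : HasH1Grad Ω u (weakGrad Ω u) := by
  obtain ⟨G, hG, hu, hG2⟩ := h
  exact (hG.hasH1Grad hu hG2).congr EventuallyEq.rfl (hG.weakGrad_ae_eq hΩ).symm

theorem memLp_apply {p : ℝ≥0∞} {μ : Measure (Euc m)} (h : MemLp G p μ) (i : Fin m) :
    MemLp (fun x => G x i) p μ := memLp_piLp_iff.1 h i

theorem HasH1Grad.add (h : HasH1Grad Ω u G) (h' : HasH1Grad Ω v H) :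
    HasH1Grad Ω (fun x => u x + v x) (fun x => G x + H x) where
  memLp := h.memLp.add h'.memLp
  memLp_grad := h.memLp_grad.add h'.memLp_grad
  integral_eq φ hφ p := by
    simp only [add_mul, PiLp.add_apply]
    have hg := memLp_apply (hφ.memLp_gradient (volume.restrict Ω) 2) p
    have hφ2 := hφ.memLp (volume.restrict Ω) 2
    rw [integral_add (h.memLp.integrable_fun_mul hg) (h'.memLp.integrable_fun_mul hg),
      integral_add ((memLp_apply h.memLp_grad p).integrable_fun_mul hφ2)
        ((memLp_apply h'.memLp_grad p).integrable_fun_mul hφ2), h.integral_eq φ hφ p,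
      h'.integral_eq φ hφ p]
    ring

theorem HasH1Grad.const_mul (h : HasH1Grad Ω u G) (c : ℝ) :
    HasH1Grad Ω (fun x => c * u x) (fun x => c • G x) where
  memLp := h.memLp.const_mul c
  memLp_grad := h.memLp_grad.const_smul c
  integral_eq φ hφ p := by
    simp only [mul_assoc, PiLp.smul_apply, smul_eq_mul]
    rw [integral_const_mul, integral_const_mul, h.integral_eq φ hφ p]
    ring

theorem HasH1Grad.sub (h : HasH1Grad Ω u G) (h' : HasH1Grad Ω v H) :
    HasH1Grad Ω (fun x => u x - v x) (fun x => G x - H x) := by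
  have := h.add (h'.const_mul (-1))
  refine this.congr (ae_of_all _ fun x => ?_) (ae_of_all _ fun x => ?_)
  · simp only; ring
  · simp only [neg_smul, one_smul]; abel

/-- A test function and its gradient are square integrable, so both sides of the integration by
parts formula are continuous in the L² norm. -/
theorem HasH1Grad.of_tendsto {U : ℕ → Euc m → ℝ} {K : ℕ → Euc m → Euc m}
    (hU : ∀ n, HasH1Grad Ω (U n) (K n)) (hu : MemLp u 2 (volume.restrict Ω))
    (hG : MemLp G 2 (volume.restrict Ω))
    (h1 : Tendsto (fun n => eLpNorm (fun x => U n x - u x) 2 (volume.restrict Ω)) atTop (𝓝 0))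
    (h2 : Tendsto (fun n => eLpNorm (fun x => K n x - G x) 2 (volume.restrict Ω)) atTop (𝓝 0)) :
    HasH1Grad Ω u G where
  memLp := hu
  memLp_grad := hG
  integral_eq φ hφ p := by
    have t1 := tendsto_integral_mul_of_eLpNorm_two (fun n => (hU n).memLp) hu
      (memLp_apply (hφ.memLp_gradient (volume.restrict Ω) 2) p) h1
    have h2' : Tendsto (fun n => eLpNorm (fun x => K n x p - G x p) 2 (volume.restrict Ω))
        atTop (𝓝 0) := by
      refine ENNReal.tendsto_zero_of_le h2 fun n => eLpNorm_mono fun x => ?_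
      exact PiLp.norm_apply_le (K n x - G x) p
    have t2 := tendsto_integral_mul_of_eLpNorm_two (fun n => memLp_apply (hU n).memLp_grad p)
      (memLp_apply hG p) (hφ.memLp (volume.restrict Ω) 2) h2'
    refine tendsto_nhds_unique t1 (t2.neg.congr fun n => ?_)
    rw [(hU n).integral_eq φ hφ p]

theorem IsTestFun.hasH1Grad {φ : Euc m → ℝ} (hφ : IsTestFun Ω φ) :
    HasH1Grad Ω φ (_root_.gradient φ) where
  memLp := hφ.memLp _ _
  memLp_grad := hφ.memLp_gradient _ _
  integral_eq ψ hψ p := by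
    have i0 := (hφ.memLp volume 2).integrable_fun_mul (hψ.memLp volume 2)
    have i1 := (hφ.memLp volume 2).integrable_fun_mul (memLp_apply (hψ.memLp_gradient volume 2) p)
    have i2 := (memLp_apply (hφ.memLp_gradient volume 2) p).integrable_fun_mul (hψ.memLp volume 2)
    rw [setIntegral_eq_integral_of_forall_compl_eq_zero,
      setIntegral_eq_integral_of_forall_compl_eq_zero]
    · simp only [gradient_apply_eq_fderiv] at i1 i2 ⊢
      exact integral_mul_fderiv_eq_neg_fderiv_mul_of_integrable i2 i1 i0
        (fun x _ => hφ.differentiable x) (fun x _ => hψ.differentiable x)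
    · intro x hx
      rw [image_eq_zero_of_notMem_tsupport (fun h => hx (hψ.2.2 h)), mul_zero]
    · intro x hx
      rw [image_eq_zero_of_notMem_tsupport (fun h => hx (hφ.2.2 h)), zero_mul]

theorem HasH10Grad.exists_seq (h : HasH10Grad Ω u G) : ∃ φ : ℕ → Euc m → ℝ,
    (∀ n, IsTestFun Ω (φ n)) ∧
    Tendsto (fun n => eLpNorm (fun x => φ n x - u x) 2 (volume.restrict Ω)) atTop (𝓝 0) ∧
    Tendsto (fun n => eLpNorm (fun x => gradient (φ n) x - G x) 2 (volume.restrict Ω))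
      atTop (𝓝 0) := by
  choose φ h1 h2 h3 using fun n : ℕ => h.approx ((n : ℝ≥0∞) + 1)⁻¹ (by simp)
  have t0 : Tendsto (fun n : ℕ => ((n : ℝ≥0∞) + 1)⁻¹) atTop (𝓝 0) := by
    have := (tendsto_add_atTop_iff_nat 1).2 ENNReal.tendsto_inv_nat_nhds_zero
    simpa using this
  refine ⟨φ, h1, ENNReal.tendsto_zero_of_le t0 fun n => ?_, ENNReal.tendsto_zero_of_le t0 fun n => ?_⟩
  · rw [eLpNorm_fun_sub_comm (f := φ n) (g := u)]; exact h2 n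
  · rw [eLpNorm_fun_sub_comm (f := gradient (φ n)) (g := G)]; exact h3 n

theorem HasH10Grad.of_tendsto_of_isTestFun {φ : ℕ → Euc m → ℝ}
    (hφ : ∀ n, IsTestFun Ω (φ n)) (hu : MemLp u 2 (volume.restrict Ω))
    (hG : MemLp G 2 (volume.restrict Ω))
    (h1 : Tendsto (fun n => eLpNorm (fun x => φ n x - u x) 2 (volume.restrict Ω)) atTop (𝓝 0))
    (h2 : Tendsto (fun n => eLpNorm (fun x => gradient (φ n) x - G x) 2 (volume.restrict Ω))
      atTop (𝓝 0)) : HasH10Grad Ω u G where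
  memLp := hu
  memLp_grad := hG
  approx ε hε := by
    obtain ⟨n, hn1, hn2⟩ := ((ENNReal.tendsto_nhds_zero.1 h1 ε hε).and
      (ENNReal.tendsto_nhds_zero.1 h2 ε hε)).exists
    refine ⟨φ n, hφ n, ?_, ?_⟩
    · rw [eLpNorm_fun_sub_comm (f := u) (g := φ n)]; exact hn1
    · rw [eLpNorm_fun_sub_comm (f := G) (g := gradient (φ n))]; exact hn2

theorem HasH10Grad.hasH1Grad (h : HasH10Grad Ω u G) : HasH1Grad Ω u G := by
  obtain ⟨φ, hφ, h1, h2⟩ := h.exists_seq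
  exact HasH1Grad.of_tendsto (fun n => (hφ n).hasH1Grad) h.memLp h.memLp_grad h1 h2

theorem HasH10Grad.of_tendsto {U : ℕ → Euc m → ℝ} {K : ℕ → Euc m → Euc m}
    (hU : ∀ n, HasH10Grad Ω (U n) (K n)) (hu : MemLp u 2 (volume.restrict Ω))
    (hG : MemLp G 2 (volume.restrict Ω))
    (h1 : Tendsto (fun n => eLpNorm (fun x => U n x - u x) 2 (volume.restrict Ω)) atTop (𝓝 0))
    (h2 : Tendsto (fun n => eLpNorm (fun x => K n x - G x) 2 (volume.restrict Ω)) atTop (𝓝 0)) :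
    HasH10Grad Ω u G where
  memLp := hu
  memLp_grad := hG
  approx ε hε := by
    have hε2 : 0 < ε / 2 := ENNReal.half_pos hε.ne'
    obtain ⟨n, hn1, hn2⟩ := ((ENNReal.tendsto_nhds_zero.1 h1 _ hε2).and
      (ENNReal.tendsto_nhds_zero.1 h2 _ hε2)).exists
    obtain ⟨φ, hφ, hφ1, hφ2⟩ := (hU n).approx _ hε2
    rw [eLpNorm_fun_sub_comm (f := U n) (g := u)] at hn1
    rw [eLpNorm_fun_sub_comm (f := K n) (g := G)] at hn2
    refine ⟨φ, hφ, ?_, ?_⟩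
    · have := eLpNorm_add_le (hu.1.sub (hU n).memLp.1)
        ((hU n).memLp.1.sub (hφ.memLp (volume.restrict Ω) 2).1) (p := 2) (by norm_num)
      rw [sub_add_sub_cancel] at this
      exact this.trans ((add_le_add hn1 hφ1).trans (ENNReal.add_halves ε).le)
    · have := eLpNorm_add_le (hG.1.sub (hU n).memLp_grad.1)
        ((hU n).memLp_grad.1.sub (hφ.memLp_gradient (volume.restrict Ω) 2).1) (p := 2) (by norm_num)
      rw [sub_add_sub_cancel] at this
      exact this.trans ((add_le_add hn2 hφ2).trans (ENNReal.add_halves ε).le)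

theorem IsTestFun.hasH10Grad {φ : Euc m → ℝ} (hφ : IsTestFun Ω φ) :
    HasH10Grad Ω φ (_root_.gradient φ) where
  memLp := hφ.memLp _ _
  memLp_grad := hφ.memLp_gradient _ _
  approx ε hε := ⟨φ, hφ, by simp, by simp⟩

theorem HasH10Grad.congr (h : HasH10Grad Ω u G) (hu : u =ᵐ[volume.restrict Ω] v)
    (hG : G =ᵐ[volume.restrict Ω] H) : HasH10Grad Ω v H where
  memLp := h.memLp.ae_eq hu
  memLp_grad := h.memLp_grad.ae_eq hG
  approx ε hε := by
    obtain ⟨φ, hφ, h1, h2⟩ := h.approx ε hε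
    refine ⟨φ, hφ, ?_, ?_⟩
    · rwa [eLpNorm_congr_ae (g := fun x => u x - φ x)]
      filter_upwards [hu] with x hx; rw [hx]
    · rwa [eLpNorm_congr_ae (g := fun x => G x - gradient φ x)]
      filter_upwards [hG] with x hx; rw [hx]

theorem HasH10Grad.add (h : HasH10Grad Ω u G) (h' : HasH10Grad Ω v H) :
    HasH10Grad Ω (fun x => u x + v x) (fun x => G x + H x) := by
  obtain ⟨φ, hφ, h1, h2⟩ := h.exists_seq
  obtain ⟨ψ, hψ, h1', h2'⟩ := h'.exists_seq
  refine HasH10Grad.of_tendsto_of_isTestFun (fun n => (hφ n).add (hψ n))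
    (h.memLp.add h'.memLp) (h.memLp_grad.add h'.memLp_grad) ?_ ?_
  · exact tendsto_eLpNorm_two_add (fun n => ((hφ n).memLp _ 2).1) h.memLp.1
      (fun n => ((hψ n).memLp _ 2).1) h'.memLp.1 h1 h1'
  · simp only [fun n => (hφ n).gradient_add (hψ n)]
    exact tendsto_eLpNorm_two_add (fun n => ((hφ n).memLp_gradient _ 2).1) h.memLp_grad.1
      (fun n => ((hψ n).memLp_gradient _ 2).1) h'.memLp_grad.1 h2 h2'

theorem HasH10Grad.const_mul (h : HasH10Grad Ω u G) (c : ℝ) :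
    HasH10Grad Ω (fun x => c * u x) (fun x => c • G x) := by
  obtain ⟨φ, hφ, h1, h2⟩ := h.exists_seq
  refine HasH10Grad.of_tendsto_of_isTestFun (fun n => (hφ n).const_mul c)
    (h.memLp.const_mul c) (h.memLp_grad.const_smul c) ?_ ?_
  · simpa using tendsto_eLpNorm_two_smul (a := fun _ _ => c) (a' := fun _ => c) (c := |c|)
      (fun _ => aestronglyMeasurable_const) aestronglyMeasurable_const (fun _ => by simp)
      (by simp) (fun n => ((hφ n).memLp _ 2).1) h.memLp h1
  · simp only [fun n => (hφ n).gradient_const_mul c]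
    exact tendsto_eLpNorm_two_smul (a := fun _ _ => c) (a' := fun _ => c) (c := |c|)
      (fun _ => aestronglyMeasurable_const) aestronglyMeasurable_const (fun _ => by simp)
      (by simp) (fun n => ((hφ n).memLp_gradient _ 2).1) h.memLp_grad h2

theorem HasH10Grad.zero : HasH10Grad Ω (fun _ => (0 : ℝ)) (fun _ => 0) := by
  refine IsTestFun.zero.hasH10Grad.congr EventuallyEq.rfl (ae_of_all _ fun x => ?_)
  simp [gradient_fun_const]

theorem HasH10Grad.sum {ι : Type*} (s : Finset ι) {U : ι → Euc m → ℝ} {K : ι → Euc m → Euc m}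
    (h : ∀ i ∈ s, HasH10Grad Ω (U i) (K i)) :
    HasH10Grad Ω (fun x => ∑ i ∈ s, U i x) (fun x => ∑ i ∈ s, K i x) := by
  classical
  induction s using Finset.induction_on with
  | empty => simpa using HasH10Grad.zero
  | insert a s ha ih =>
    simp only [Finset.sum_insert ha]
    exact (h a (by simp)).add (ih fun i hi => h i (by simp [hi]))

theorem HasH10Grad.memH10 (hΩ : IsOpen Ω) (h : HasH10Grad Ω u G) : MemH10 Ω u := by
  refine ⟨h.hasH1Grad.memW1, fun ε hε => ?_⟩
  exact (h.congr EventuallyEq.rfl (h.hasH1Grad.weakGrad_ae_eq hΩ).symm).approx ε hε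

theorem MemH10.hasH10Grad (hΩ : IsOpen Ω) (h : MemH10 Ω u) : HasH10Grad Ω u (weakGrad Ω u) :=
  ⟨(h.1.hasH1Grad hΩ).memLp, (h.1.hasH1Grad hΩ).memLp_grad, h.2⟩

/-- By uniqueness of the weak gradient, the gradient found in an approximation argument may be
replaced by the expected one. -/
theorem HasH10Grad.of_hasH1Grad (hΩ : IsOpen Ω) (h : HasH10Grad Ω u G) (h' : HasH1Grad Ω u H) :
    HasH10Grad Ω u H :=
  h.congr EventuallyEq.rfl (h.hasH1Grad.ae_eq hΩ h')

end Basic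

/-! ### Mollification -/

open scoped Convolution

section Mollify

variable {m : ℕ}

theorem lintegral_enorm_normed (φ : ContDiffBump (0 : Euc m)) :
    ∫⁻ t, ‖φ.normed volume t‖ₑ = 1 := by
  have h1 := ofReal_integral_eq_lintegral_ofReal (φ.integrable_normed (μ := volume))
    (ae_of_all _ φ.nonneg_normed)
  rw [φ.integral_normed, ENNReal.ofReal_one] at h1
  rw [h1]
  congr 1
  ext t
  rw [Real.enorm_of_nonneg (φ.nonneg_normed t)]

/-- The kernel has mass one, so the Cauchy–Schwarz inequality for the measure with that density
bounds the square of the convolution by the convolution of the square; Tonelli's theorem and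
translation invariance conclude. -/
theorem eLpNorm_normed_convolution_le (φ : ContDiffBump (0 : Euc m)) {f : Euc m → ℝ}
    (hf : AEStronglyMeasurable f volume) :
    eLpNorm (φ.normed volume ⋆[ContinuousLinearMap.lsmul ℝ ℝ, volume] f) 2 volume
      ≤ eLpNorm f 2 volume := by
  set ρ : Euc m → ℝ≥0∞ := fun t => ‖φ.normed volume t‖ₑ with hρ
  have hρm : Measurable ρ := (φ.continuous_normed).measurable.enorm
  have hfx : ∀ x, AEStronglyMeasurable (fun t => f (x - t)) volume := fun x =>
    hf.comp_quasiMeasurePreserving (quasiMeasurePreserving_sub_left_of_right_invariant volume x)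
  have hpt : ∀ x, ‖(φ.normed volume ⋆[ContinuousLinearMap.lsmul ℝ ℝ, volume] f) x‖ₑ ^ (2 : ℝ)
      ≤ ∫⁻ t, ρ t * ‖f (x - t)‖ₑ ^ (2 : ℝ) := by
    intro x
    -- The kernel is written as the product of its two square roots, one of which stays with f.
    have h1 : ‖(φ.normed volume ⋆[ContinuousLinearMap.lsmul ℝ ℝ, volume] f) x‖ₑ
        ≤ ∫⁻ t, ρ t ^ (1 / 2 : ℝ) * (ρ t * ‖f (x - t)‖ₑ ^ (2 : ℝ)) ^ (1 / 2 : ℝ) := by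
      rw [convolution_lsmul]
      refine (enorm_integral_le_lintegral_enorm _).trans (le_of_eq ?_)
      congr 1
      ext t
      rw [ENNReal.mul_rpow_of_nonneg _ _ (by norm_num : (0 : ℝ) ≤ 1 / 2), ← mul_assoc,
        ← ENNReal.rpow_add_of_nonneg _ _ (by norm_num) (by norm_num), ← ENNReal.rpow_mul]
      norm_num [enorm_smul, hρ]
    have h2 := ENNReal.lintegral_mul_norm_pow_le (μ := volume) hρm.aemeasurable
      (hρm.aemeasurable.mul ((hfx x).enorm.pow_const (2 : ℝ)))
      (by norm_num : (0 : ℝ) ≤ 1 / 2) (by norm_num : (0 : ℝ) ≤ 1 / 2) (by norm_num)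
    have h3 := h1.trans h2
    rw [hρ, lintegral_enorm_normed, ENNReal.one_rpow, one_mul] at h3
    calc _ ≤ _ := ENNReal.rpow_le_rpow h3 (by norm_num : (0 : ℝ) ≤ 2)
      _ = _ := by
        rw [← ENNReal.rpow_mul]
        norm_num [hρ]
  have hmeas : AEMeasurable (Function.uncurry fun x t => ρ t * ‖f (x - t)‖ₑ ^ (2 : ℝ))
      ((volume : Measure (Euc m)).prod volume) := by
    have h1 : AEStronglyMeasurable (fun p : Euc m × Euc m => f (p.1 - p.2))
        ((volume : Measure (Euc m)).prod volume) :=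
      hf.comp_quasiMeasurePreserving (quasiMeasurePreserving_sub_of_right_invariant volume volume)
    exact (hρm.comp measurable_snd).aemeasurable.mul (h1.enorm.pow_const _)
  rw [eLpNorm_eq_lintegral_rpow_enorm_toReal (by norm_num) (by norm_num),
    eLpNorm_eq_lintegral_rpow_enorm_toReal (by norm_num) (by norm_num)]
  refine ENNReal.rpow_le_rpow ?_ (by norm_num)
  simp only [ENNReal.toReal_ofNat]
  calc _ ≤ ∫⁻ x, ∫⁻ t, ρ t * ‖f (x - t)‖ₑ ^ (2 : ℝ) := lintegral_mono hpt
    _ = ∫⁻ t, ∫⁻ x, ρ t * ‖f (x - t)‖ₑ ^ (2 : ℝ) := lintegral_lintegral_swap hmeas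
    _ = ∫⁻ t, ρ t * ∫⁻ x, ‖f x‖ₑ ^ (2 : ℝ) := by
      congr 1
      ext t
      rw [lintegral_const_mul' _ _ (by simp [hρ]),
        lintegral_sub_right_eq_self (fun x => ‖f x‖ₑ ^ (2 : ℝ))]
    _ = ∫⁻ x, ‖f x‖ₑ ^ (2 : ℝ) := by
      rw [lintegral_mul_const _ hρm, lintegral_enorm_normed, one_mul]

theorem exists_eLpNorm_normed_convolution_sub_le {g : Euc m → ℝ} (hg : Continuous g)
    (hgc : HasCompactSupport g) {ε : ℝ≥0∞} (hε : ε ≠ 0) :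
    ∃ δ : ℝ, 0 < δ ∧ ∀ φ : ContDiffBump (0 : Euc m), φ.rOut < δ →
      eLpNorm (fun x => (φ.normed volume ⋆[ContinuousLinearMap.lsmul ℝ ℝ, volume] g) x - g x)
        2 volume ≤ ε := by
  -- This compact set carries g and all its mollifications of radius less than 1, so a uniform error
  -- η costs at most η |K|^{1/2} in L².
  set K := Metric.cthickening 1 (tsupport g) with hK
  have hKc : IsCompact K := hgc.cthickening
  have hKfin : volume K ^ (1 / 2 : ℝ) ≠ ⊤ :=
    ENNReal.rpow_ne_top_of_nonneg (by norm_num) hKc.measure_lt_top.ne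
  obtain ⟨η, hη, hηε⟩ := ENNReal.exists_nnreal_pos_mul_lt hKfin hε
  obtain ⟨δ, hδ, hgδ⟩ := Metric.uniformContinuous_iff.1
    (hgc.uniformContinuous_of_continuous hg) η (by exact_mod_cast hη)
  refine ⟨min δ 1, by positivity, fun φ hφ => ?_⟩
  have hle : ∀ x, ‖(φ.normed volume ⋆[ContinuousLinearMap.lsmul ℝ ℝ, volume] g) x - g x‖
      ≤ ‖K.indicator (fun _ => (η : ℝ)) x‖ := by
    intro x
    by_cases hx : x ∈ K
    · rw [indicator_of_mem hx, ← dist_eq_norm,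
        Real.norm_of_nonneg (show (0 : ℝ) ≤ (η : ℝ) from η.2)]
      refine φ.dist_normed_convolution_le hg.aestronglyMeasurable fun y hy => (hgδ ?_).le
      exact (Metric.mem_ball.1 hy).trans (hφ.trans_le (min_le_left _ _))
    · rw [indicator_of_notMem hx, norm_zero, ← dist_eq_norm]
      have hz : ∀ y ∈ Metric.ball x φ.rOut, g y = 0 := by
        intro y hy
        by_contra h
        refine hx (Metric.mem_cthickening_of_dist_le x y 1 _ (subset_tsupport g h) ?_)
        rw [dist_comm]
        exact ((Metric.mem_ball.1 hy).trans (hφ.trans_le (min_le_right _ _))).le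
      refine φ.dist_normed_convolution_le hg.aestronglyMeasurable fun y hy => ?_
      rw [hz y hy, hz x (Metric.mem_ball_self φ.rOut_pos), dist_self]
  refine (eLpNorm_mono hle).trans ?_
  rw [eLpNorm_indicator_const hKc.measurableSet (by norm_num) (by norm_num)]
  simpa using hηε.le

/-- Continuous functions of compact support are dense in L², and mollification does not increase the
L² norm: the error is at most three times ε/3. -/
theorem exists_eLpNorm_two_normed_convolution_sub_le {f : Euc m → ℝ} (hf : MemLp f 2 volume)
    {ε : ℝ≥0∞} (hε : ε ≠ 0) :
    ∃ δ : ℝ, 0 < δ ∧ ∀ φ : ContDiffBump (0 : Euc m), φ.rOut < δ →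
      eLpNorm (fun x => (φ.normed volume ⋆[ContinuousLinearMap.lsmul ℝ ℝ, volume] f) x - f x)
        2 volume ≤ ε := by
  have hε3 : ε / 3 ≠ 0 := (ENNReal.div_pos hε (by norm_num)).ne'
  obtain ⟨g, hgc, hfg, hg, hg2⟩ := hf.exists_hasCompactSupport_eLpNorm_sub_le (by norm_num) hε3
  obtain ⟨δ, hδ, hgδ⟩ := exists_eLpNorm_normed_convolution_sub_le hg hgc hε3
  refine ⟨δ, hδ, fun φ hφ => ?_⟩
  have hφc := φ.hasCompactSupport_normed (μ := volume)
  have hcont : ∀ {h : Euc m → ℝ}, MemLp h 2 volume →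
      Continuous (φ.normed volume ⋆[ContinuousLinearMap.lsmul ℝ ℝ, volume] h) := fun hh =>
    hφc.continuous_convolution_left _ φ.continuous_normed (hh.locallyIntegrable (by norm_num))
  have hsub : ∀ x, (φ.normed volume ⋆[ContinuousLinearMap.lsmul ℝ ℝ, volume] f) x - f x
      = ((φ.normed volume ⋆[ContinuousLinearMap.lsmul ℝ ℝ, volume] (f - g)) x
        + ((φ.normed volume ⋆[ContinuousLinearMap.lsmul ℝ ℝ, volume] g) x - g x))
        + (g x - f x) := by
    intro x
    have hex : ∀ {h : Euc m → ℝ}, MemLp h 2 volume →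
        Integrable (fun t => φ.normed volume t • h (x - t)) volume := fun hh =>
      (hφc.convolutionExists_left (ContinuousLinearMap.lsmul ℝ ℝ) φ.continuous_normed (hh.locallyIntegrable (by norm_num))) x
    rw [convolution_lsmul, convolution_lsmul, convolution_lsmul]
    simp only [Pi.sub_apply, smul_sub]
    rw [integral_sub (hex hf) (hex hg2)]
    ring
  simp only [hsub]
  have a1 := (hcont (hf.sub hg2)).aestronglyMeasurable (μ := volume)
  have a2 := (hcont hg2).aestronglyMeasurable (μ := volume)
  refine (eLpNorm_add_le (a1.add (a2.sub hg2.1)) (hg2.1.sub hf.1) (by norm_num)).trans ?_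
  refine (add_le_add_left (eLpNorm_add_le a1 (a2.sub hg2.1) (by norm_num)) _).trans ?_
  rw [eLpNorm_sub_comm] at hfg
  have h1 := eLpNorm_normed_convolution_le φ (hf.sub hg2).1
  rw [eLpNorm_sub_comm] at h1
  calc _ ≤ ε / 3 + ε / 3 + ε / 3 := add_le_add (add_le_add (h1.trans hfg) (hgδ φ hφ)) hfg
    _ = ε := ENNReal.add_thirds ε

/-- A sequence of bump functions at the origin with radii tending to zero. -/
def bumpSeq (m : ℕ) (n : ℕ) : ContDiffBump (0 : Euc m) where
  rIn := 1 / (2 * ((n : ℝ) + 1))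
  rOut := 1 / ((n : ℝ) + 1)
  rIn_pos := by positivity
  rIn_lt_rOut := by
    apply one_div_lt_one_div_of_lt <;> [positivity; linarith [(n.cast_nonneg : (0 : ℝ) ≤ n)]]

theorem tendsto_bumpSeq_rOut : Tendsto (fun n => (bumpSeq m n).rOut) atTop (𝓝 0) :=
  tendsto_one_div_add_atTop_nhds_zero_nat

/-- The mollifications of `u` extended by zero outside `Ω`. -/
def mollify (Ω : Set (Euc m)) (u : Euc m → ℝ) (n : ℕ) : Euc m → ℝ :=
  (bumpSeq m n).normed volume ⋆[ContinuousLinearMap.lsmul ℝ ℝ, volume] (Ω.indicator u)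

theorem tendsto_eLpNorm_mollify {Ω : Set (Euc m)} (hΩ : IsOpen Ω) {u : Euc m → ℝ}
    (hu : MemLp u 2 (volume.restrict Ω)) :
    Tendsto (fun n => eLpNorm (fun x => mollify Ω u n x - u x) 2 (volume.restrict Ω))
      atTop (𝓝 0) := by
  have hu' : MemLp (Ω.indicator u) 2 volume := (memLp_indicator_iff_restrict hΩ.measurableSet).2 hu
  rw [ENNReal.tendsto_nhds_zero]
  intro ε hε
  obtain ⟨δ, hδ, h⟩ := exists_eLpNorm_two_normed_convolution_sub_le hu' hε.ne'
  filter_upwards [tendsto_bumpSeq_rOut.eventually (gt_mem_nhds hδ)] with n hn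
  refine le_trans ?_ (h _ hn)
  refine le_trans (le_of_eq (eLpNorm_congr_ae ?_)) (eLpNorm_mono_measure _ Measure.restrict_le_self)
  filter_upwards [ae_restrict_mem hΩ.measurableSet] with x hx
  rw [indicator_of_mem hx, mollify]

theorem locallyIntegrable_indicator {Ω : Set (Euc m)} (hΩ : IsOpen Ω) {u : Euc m → ℝ}
    (hu : MemLp u 2 (volume.restrict Ω)) : LocallyIntegrable (Ω.indicator u) volume :=
  ((memLp_indicator_iff_restrict hΩ.measurableSet).2 hu).locallyIntegrable (by norm_num)

theorem contDiff_mollify {Ω : Set (Euc m)} (hΩ : IsOpen Ω) {u : Euc m → ℝ}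
    (hu : MemLp u 2 (volume.restrict Ω)) (n : ℕ) : ContDiff ℝ ∞ (mollify Ω u n) :=
  ((bumpSeq m n).hasCompactSupport_normed).contDiff_convolution_left _
    ((bumpSeq m n).contDiff_normed) (locallyIntegrable_indicator hΩ hu)

theorem fderiv_convolution_apply {ρ : Euc m → ℝ} (hρ : ContDiff ℝ ∞ ρ) (hρc : HasCompactSupport ρ)
    {g : Euc m → ℝ} (hg : LocallyIntegrable g volume) (x v : Euc m) :
    fderiv ℝ (ρ ⋆[ContinuousLinearMap.lsmul ℝ ℝ, volume] g) x v
      = ∫ t, fderiv ℝ ρ (x - t) v * g t := by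
  have h1 : ContDiff ℝ 1 ρ := hρ.of_le (by exact_mod_cast le_top)
  have h2 : Continuous (fderiv ℝ ρ) := hρ.continuous_fderiv (by simp)
  have hd := hρc.hasFDerivAt_convolution_left (ContinuousLinearMap.lsmul ℝ ℝ) (μ := volume) h1 hg x
  have hconv := ((hρc.fderiv ℝ).convolutionExists_left
    ((ContinuousLinearMap.lsmul ℝ ℝ).precompL (Euc m)) h2 hg x).integrable_swap
  rw [hd.fderiv, convolution_eq_swap, ContinuousLinearMap.integral_apply hconv]
  simp [ContinuousLinearMap.precompL_apply]

theorem gradient_const_sub_apply {ρ : Euc m → ℝ} (hρ : ContDiff ℝ ∞ ρ) (x t : Euc m) (p : Fin m) :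
    gradient (fun t => ρ (x - t)) t p = - fderiv ℝ ρ (x - t) (EuclideanSpace.single p 1) := by
  have h1 : HasFDerivAt (fun t => ρ (x - t)) ((fderiv ℝ ρ (x - t)).comp
      (-(ContinuousLinearMap.id ℝ (Euc m)))) t :=
    ((hρ.differentiable (by simp)) (x - t)).hasFDerivAt.comp t ((hasFDerivAt_id t).const_sub x)
  rw [gradient_apply_eq_fderiv, h1.fderiv]
  simp

theorem isTestFun_normed_const_sub {Ω : Set (Euc m)} (φ : ContDiffBump (0 : Euc m)) {x : Euc m}
    (hx : Metric.closedBall x φ.rOut ⊆ Ω) :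
    IsTestFun Ω (fun t => φ.normed volume (x - t)) := by
  have hsub : tsupport (fun t => φ.normed volume (x - t)) ⊆ Metric.closedBall x φ.rOut := by
    refine closure_minimal (fun t ht => ?_) Metric.isClosed_closedBall
    have : x - t ∈ Function.support (φ.normed volume) := ht
    rw [φ.support_normed_eq, mem_ball_zero_iff, ← dist_eq_norm, dist_comm] at this
    exact this.le
  exact ⟨φ.contDiff_normed.comp (contDiff_const.sub contDiff_id),
    HasCompactSupport.of_support_subset_isCompact (isCompact_closedBall x φ.rOut)
      (subset_closure.trans hsub), hsub.trans hx⟩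

/-- The derivative falls on the kernel, and t ↦ kernel(x - t) is a test function in Ω as soon as the
ball around x fits in Ω; the definition of the weak gradient moves the derivative back to u. The
sign from integrating by parts cancels the one from differentiating in t instead of x. -/
theorem gradient_mollify {Ω : Set (Euc m)} (hΩ : IsOpen Ω) {u : Euc m → ℝ} {G : Euc m → Euc m}
    (h : HasH1Grad Ω u G) {n : ℕ} {x : Euc m}
    (hx : Metric.closedBall x (bumpSeq m n).rOut ⊆ Ω) (p : Fin m) :
    gradient (mollify Ω u n) x p = mollify Ω (fun x => G x p) n x := by
  have hρ : ContDiff ℝ ∞ ((bumpSeq m n).normed volume) := (bumpSeq m n).contDiff_normed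
  have e := h.integral_eq _ (isTestFun_normed_const_sub _ hx) p
  rw [gradient_apply_eq_fderiv, mollify, fderiv_convolution_apply hρ
    (bumpSeq m n).hasCompactSupport_normed (locallyIntegrable_indicator hΩ h.memLp), mollify,
    convolution_lsmul_swap]
  simp only [gradient_const_sub_apply hρ, mul_neg, integral_neg, neg_inj] at e
  rw [← integral_indicator hΩ.measurableSet, ← integral_indicator hΩ.measurableSet] at e
  refine (integral_congr_ae (ae_of_all _ fun t => ?_)).trans
    (e.trans (integral_congr_ae (ae_of_all _ fun t => ?_)))
  · by_cases ht : t ∈ Ω <;> simp [ht, mul_comm]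
  · by_cases ht : t ∈ Ω <;> simp [ht, mul_comm]

/-- The restriction to a compact subset is essential: u is extended by zero outside Ω, which need
not preserve the weak derivative across the boundary. A compact K has a closed δ-neighbourhood
inside Ω, and there `gradient_mollify` applies once the radius is below δ. -/
theorem tendsto_eLpNorm_gradient_mollify {Ω : Set (Euc m)} (hΩ : IsOpen Ω) {u : Euc m → ℝ}
    {G : Euc m → Euc m} (h : HasH1Grad Ω u G) {K : Set (Euc m)} (hK : IsCompact K)
    (hKΩ : K ⊆ Ω) (p : Fin m) :
    Tendsto (fun n => eLpNorm (fun x => gradient (mollify Ω u n) x p - G x p) 2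
      (volume.restrict K)) atTop (𝓝 0) := by
  obtain ⟨δ, hδ, hδK⟩ := hK.exists_cthickening_subset_open hΩ hKΩ
  have h1 := tendsto_eLpNorm_mollify hΩ (memLp_apply h.memLp_grad p)
  rw [ENNReal.tendsto_nhds_zero] at h1 ⊢
  intro ε hε
  filter_upwards [h1 ε hε, tendsto_bumpSeq_rOut.eventually (gt_mem_nhds hδ)] with n hn hnδ
  refine le_trans ?_ ((eLpNorm_mono_measure _ (Measure.restrict_mono hKΩ le_rfl)).trans hn)
  refine le_of_eq (eLpNorm_congr_ae ?_)
  filter_upwards [ae_restrict_mem hK.measurableSet] with x hx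
  rw [gradient_mollify hΩ h]
  refine subset_trans ?_ hδK
  refine (Metric.closedBall_subset_closedBall hnδ.le).trans ?_
  exact Metric.closedBall_subset_cthickening hx δ

end Mollify

/-! ### The chain rule -/

section Pi

variable {α ι : Type*} [MeasurableSpace α] {μ : Measure α} [Fintype ι]

theorem aestronglyMeasurable_pi_real {f : α → ι → ℝ}
    (h : ∀ i, AEStronglyMeasurable (fun x => f x i) μ) : AEStronglyMeasurable f μ :=
  (aemeasurable_pi_lambda _ fun i => (h i).aemeasurable).aestronglyMeasurable

theorem norm_pi_le_sum_abs (z : ι → ℝ) : ‖z‖ ≤ ∑ i, |z i| :=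
  (pi_norm_le_iff_of_nonneg (Finset.sum_nonneg fun _ _ => abs_nonneg _)).2 fun i =>
    Finset.single_le_sum (f := fun i => |z i|) (fun _ _ => abs_nonneg _) (Finset.mem_univ i)

theorem tendsto_eLpNorm_two_pi {f : ℕ → α → ι → ℝ} {g : α → ι → ℝ}
    (hf : ∀ n i, AEStronglyMeasurable (fun x => f n x i) μ)
    (hg : ∀ i, AEStronglyMeasurable (fun x => g x i) μ)
    (h : ∀ i, Tendsto (fun n => eLpNorm (fun x => f n x i - g x i) 2 μ) atTop (𝓝 0)) :
    Tendsto (fun n => eLpNorm (fun x => f n x - g x) 2 μ) atTop (𝓝 0) := by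
  have hs : Tendsto (fun n => ∑ i, eLpNorm (fun x => f n x i - g x i) 2 μ) atTop (𝓝 0) := by
    simpa using tendsto_finsetSum Finset.univ fun i _ => h i
  refine ENNReal.tendsto_zero_of_le hs fun n => ?_
  calc eLpNorm (fun x => f n x - g x) 2 μ
      ≤ eLpNorm (∑ i, fun x => |f n x i - g x i|) 2 μ := by
        refine eLpNorm_mono fun x => ?_
        rw [Finset.sum_apply, Real.norm_of_nonneg (Finset.sum_nonneg fun _ _ => abs_nonneg _)]
        exact norm_pi_le_sum_abs _
    _ ≤ ∑ i, eLpNorm (fun x => |f n x i - g x i|) 2 μ :=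
        eLpNorm_sum_le (fun i _ => ((hf n i).sub (hg i)).norm) (by norm_num)
    _ = ∑ i, eLpNorm (fun x => f n x i - g x i) 2 μ := by
        congr 1
        ext i
        exact eLpNorm_norm (fun x => f n x i - g x i)

theorem fderiv_pi_apply_eq_sum [DecidableEq ι] (F : (ι → ℝ) → ℝ) (z w : ι → ℝ) :
    fderiv ℝ F z w = ∑ i, fderiv ℝ F z (Pi.single i 1) * w i := by
  have := LinearMap.pi_apply_eq_sum_univ (fderiv ℝ F z).toLinearMap w
  simp only [ContinuousLinearMap.coe_coe, smul_eq_mul] at this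
  rw [this]
  refine Finset.sum_congr rfl fun i _ => ?_
  rw [mul_comm]
  congr 2
  ext j
  simp [Pi.single_apply, eq_comm]

end Pi

section ChainRule

variable {m : ℕ} {Ω : Set (Euc m)} {ι : Type*} [Fintype ι]

theorem Continuous.memLp_restrict_isCompact {f : Euc m → ℝ} (hf : Continuous f) {K : Set (Euc m)}
    (hK : IsCompact K) (p : ℝ≥0∞) : MemLp f p (volume.restrict K) := by
  obtain ⟨C, hC⟩ := hK.exists_bound_of_continuousOn hf.continuousOn
  have : IsFiniteMeasure (volume.restrict K) := ⟨by simpa using hK.measure_lt_top⟩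
  refine MemLp.of_bound hf.aestronglyMeasurable C ?_
  filter_upwards [ae_restrict_mem hK.measurableSet] with x hx using hC x hx

theorem gradient_comp_pi {F : (ι → ℝ) → ℝ} (hF : ContDiff ℝ 1 F) {V : ι → Euc m → ℝ}
    (hV : ∀ i, ContDiff ℝ 1 (V i)) (x : Euc m) (p : Fin m) :
    gradient (fun x => F fun i => V i x) x p
      = fderiv ℝ F (fun i => V i x) (fun i => gradient (V i) x p) := by
  have h1 : HasFDerivAt (fun x => fun i => V i x)
      (ContinuousLinearMap.pi fun i => fderiv ℝ (V i) x) x :=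
    hasFDerivAt_pi.2 fun i => ((hV i).differentiable one_ne_zero x).hasFDerivAt
  have h2 := ((hF.differentiable one_ne_zero) (fun i => V i x)).hasFDerivAt.comp x h1
  rw [gradient_apply_eq_fderiv, show (fun x => F fun i => V i x) = F ∘ fun x i => V i x from rfl,
    h2.fderiv]
  simp only [ContinuousLinearMap.comp_apply]
  congr 1
  ext i
  simp [gradient_apply_eq_fderiv]

theorem integral_mul_gradient_eq_of_contDiff {w φ : Euc m → ℝ} (hw : ContDiff ℝ 1 w)
    (hφ : IsTestFun Ω φ) (p : Fin m) :
    ∫ x in tsupport φ, w x * gradient φ x p = - ∫ x in tsupport φ, gradient w x p * φ x := by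
  have hgw := (continuous_gradient hw)
  have hgφ := (continuous_gradient hφ.contDiff_one)
  have cp : ∀ {f : Euc m → Euc m}, Continuous f → Continuous fun x => f x p := fun hf =>
    (EuclideanSpace.proj (𝕜 := ℝ) p).continuous.comp hf
  have i0 : Integrable (fun x => w x * φ x) volume :=
    (hw.continuous.mul hφ.1.continuous).integrable_of_hasCompactSupport hφ.2.1.mul_left
  have i1 : Integrable (fun x => w x * gradient φ x p) volume := by
    refine (hw.continuous.mul (cp hgφ)).integrable_of_hasCompactSupport ?_
    exact HasCompactSupport.mul_left (hφ.2.1.gradient.comp_left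
      (g := fun v : Euc m => v p) (by simp))
  have i2 : Integrable (fun x => gradient w x p * φ x) volume :=
    ((cp hgw).mul hφ.1.continuous).integrable_of_hasCompactSupport hφ.2.1.mul_left
  rw [setIntegral_eq_integral_of_forall_compl_eq_zero,
    setIntegral_eq_integral_of_forall_compl_eq_zero]
  · simp only [gradient_apply_eq_fderiv] at i1 i2 ⊢
    exact integral_mul_fderiv_eq_neg_fderiv_mul_of_integrable i2 i1 i0
      (fun x _ => hw.differentiable one_ne_zero x) (fun x _ => hφ.differentiable x)
  · intro x hx
    rw [image_eq_zero_of_notMem_tsupport hx, mul_zero]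
  · intro x hx
    rw [gradient_eq_zero_of_notMem_tsupport hx]
    simp

theorem setIntegral_eq_setIntegral_tsupport (hΩ : IsOpen Ω) {φ w : Euc m → ℝ}
    (hφ : IsTestFun Ω φ) (hw : ∀ x ∉ tsupport φ, w x = 0) :
    ∫ x in Ω, w x = ∫ x in tsupport φ, w x :=
  setIntegral_eq_of_subset_of_forall_sdiff_eq_zero hΩ.measurableSet hφ.2.2 fun x hx => hw x hx.2

/-- Smooth functions converging in `H¹(K)`, and almost everywhere, to given Sobolev functions. -/
theorem exists_seq_smooth_tendsto (hΩ : IsOpen Ω) {U : ι → Euc m → ℝ} {G : ι → Euc m → Euc m}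
    (h : ∀ i, HasH1Grad Ω (U i) (G i)) {K : Set (Euc m)} (hK : IsCompact K) (hKΩ : K ⊆ Ω) :
    ∃ V : ℕ → ι → Euc m → ℝ, (∀ n i, ContDiff ℝ ∞ (V n i)) ∧
      (∀ᵐ x ∂(volume.restrict K),
        Tendsto (fun n => fun i => V n i x) atTop (𝓝 fun i => U i x)) ∧
      (∀ i, Tendsto (fun n => eLpNorm (fun x => V n i x - U i x) 2 (volume.restrict K))
        atTop (𝓝 0)) ∧
      ∀ i p, Tendsto (fun n => eLpNorm (fun x => gradient (V n i) x p - G i x p) 2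
        (volume.restrict K)) atTop (𝓝 0) := by
  have hle : volume.restrict K ≤ volume.restrict Ω := Measure.restrict_mono hKΩ le_rfl
  have hsm : ∀ n i, ContDiff ℝ ∞ (mollify Ω (U i) n) := fun n i => contDiff_mollify hΩ (h i).memLp n
  have h0 : ∀ i, Tendsto (fun n => eLpNorm (fun x => mollify Ω (U i) n x - U i x) 2
      (volume.restrict K)) atTop (𝓝 0) := fun i =>
    ENNReal.tendsto_zero_of_le (tendsto_eLpNorm_mollify hΩ (h i).memLp)
      fun n => eLpNorm_mono_measure _ hle
  obtain ⟨ns, hns, hae⟩ := exists_subseq_tendsto_ae_of_eLpNorm_two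
    (f := fun n x i => mollify Ω (U i) n x) (g := fun x i => U i x) (μ := volume.restrict K)
    (fun n => aestronglyMeasurable_pi_real fun i => (hsm n i).continuous.aestronglyMeasurable)
    (aestronglyMeasurable_pi_real fun i => (h i).memLp.1.mono_measure hle)
    (tendsto_eLpNorm_two_pi (fun n i => (hsm n i).continuous.aestronglyMeasurable)
      (fun i => (h i).memLp.1.mono_measure hle) h0)
  refine ⟨fun n i => mollify Ω (U i) (ns n), fun n i => hsm _ i, hae,
    fun i => (h0 i).comp hns.tendsto_atTop,
    fun i p => (tendsto_eLpNorm_gradient_mollify hΩ (h i) hK hKΩ p).comp hns.tendsto_atTop⟩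

/-- Smooth approximations obey the classical chain rule. The left side passes to the limit by
dominated convergence, the right side because bounded coefficients converging almost everywhere
multiply gradients converging in L². -/
theorem HasH1Grad.integral_comp_mul_gradient (hΩ : IsOpen Ω) {U : ι → Euc m → ℝ}
    {G : ι → Euc m → Euc m} (h : ∀ i, HasH1Grad Ω (U i) (G i)) {F : (ι → ℝ) → ℝ}
    (hF : ContDiff ℝ 1 F) {c : ℝ} (hFc : ∀ z, |F z| ≤ c) (hF' : ∀ z, ‖fderiv ℝ F z‖ ≤ c)
    {φ : Euc m → ℝ} (hφ : IsTestFun Ω φ) (p : Fin m) :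
    ∫ x in Ω, F (fun i => U i x) * gradient φ x p
      = - ∫ x in Ω, fderiv ℝ F (fun i => U i x) (fun i => G i x p) * φ x := by
  classical
  have hKc : IsCompact (tsupport φ) := hφ.2.1
  have hle : volume.restrict (tsupport φ) ≤ volume.restrict Ω := Measure.restrict_mono hφ.2.2 le_rfl
  -- Both integrals are carried by the support of φ, a compact subset of Ω, where mollification
  -- approximates the gradients.
  rw [setIntegral_eq_setIntegral_tsupport hΩ hφ fun x hx => by
      rw [gradient_eq_zero_of_notMem_tsupport hx]; simp,
    setIntegral_eq_setIntegral_tsupport hΩ hφ fun x hx => by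
      rw [image_eq_zero_of_notMem_tsupport hx, mul_zero]]
  obtain ⟨V, hV, hVae, hV0, hV1⟩ := exists_seq_smooth_tendsto hΩ h hKc hφ.2.2
  have hV' : ∀ n i, ContDiff ℝ 1 (V n i) := fun n i => (hV n i).of_le (by exact_mod_cast le_top)
  have hFV : ∀ n, ContDiff ℝ 1 fun x => F fun i => V n i x := fun n =>
    hF.comp (contDiff_pi.2 (hV' n))
  have hc0 : 0 ≤ c := (abs_nonneg _).trans (hFc 0)
  have hFm : AEStronglyMeasurable (fun x => fun i => U i x) (volume.restrict (tsupport φ)) :=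
    aestronglyMeasurable_pi_real fun i => (h i).memLp.1.mono_measure hle
  have cp : ∀ {f : Euc m → Euc m}, Continuous f → Continuous fun x => f x p := fun hf =>
    (EuclideanSpace.proj (𝕜 := ℝ) p).continuous.comp hf
  have cφ := cp (continuous_gradient hφ.contDiff_one)
  have L : Tendsto (fun n => ∫ x in tsupport φ, F (fun i => V n i x) * gradient φ x p) atTop
      (𝓝 (∫ x in tsupport φ, F (fun i => U i x) * gradient φ x p)) := by
    refine tendsto_integral_of_dominated_convergence (fun x => c * |gradient φ x p|)
      (fun n => ((hFV n).continuous.mul cφ).aestronglyMeasurable) ?_ (fun n => ae_of_all _ fun x => ?_)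
      ?_
    · exact (continuous_const.mul cφ.abs).continuousOn.integrableOn_compact hKc
    · rw [norm_mul]
      exact mul_le_mul_of_nonneg_right (hFc _) (norm_nonneg _)
    · filter_upwards [hVae] with x hx
      exact ((hF.continuous.tendsto _).comp hx).mul_const _
  have cF' : ∀ i, Continuous fun z => fderiv ℝ F z (Pi.single i 1) := fun i =>
    (hF.continuous_fderiv one_ne_zero).clm_apply continuous_const
  have R : ∀ i, Tendsto (fun n => ∫ x in tsupport φ,
      (fderiv ℝ F (fun i => V n i x) (Pi.single i 1) * gradient (V n i) x p) * φ x) atTop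
      (𝓝 (∫ x in tsupport φ, (fderiv ℝ F (fun i => U i x) (Pi.single i 1) * G i x p) * φ x)) := by
    intro i
    have hb : ∀ z, |fderiv ℝ F z (Pi.single i 1)| ≤ c := by
      intro z
      have := (fderiv ℝ F z).le_opNorm (Pi.single i 1)
      rw [Pi.norm_single, norm_one, mul_one] at this
      exact this.trans (hF' z)
    have ca : ∀ n, Continuous fun x => fderiv ℝ F (fun i => V n i x) (Pi.single i 1) := fun n =>
      (cF' i).comp (continuous_pi fun j => (hV n j).continuous)
    have cg : ∀ n, Continuous fun x => gradient (V n i) x p := fun n =>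
      cp (continuous_gradient (hV' n i))
    have hGL : MemLp (fun x => G i x p) 2 (volume.restrict (tsupport φ)) :=
      (memLp_apply (h i).memLp_grad p).mono_measure hle
    have hlimm : AEStronglyMeasurable (fun x => fderiv ℝ F (fun i => U i x) (Pi.single i 1))
        (volume.restrict (tsupport φ)) := (cF' i).comp_aestronglyMeasurable hFm
    have key := tendsto_eLpNorm_two_smul (μ := volume.restrict (tsupport φ)) (c := c)
      (fun n => (ca n).aestronglyMeasurable) hlimm (fun n => ae_of_all _ fun x => hb _)
      (by filter_upwards [hVae] with x hx using ((cF' i).tendsto _).comp hx)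
      (fun n => (cg n).aestronglyMeasurable) hGL (hV1 i p)
    refine tendsto_integral_mul_of_eLpNorm_two (fun n => ?_) ?_ (hφ.memLp _ 2) key
    · exact ((ca n).mul (cg n)).memLp_restrict_isCompact hKc 2
    · refine (hGL.norm.const_mul c).mono (hlimm.mul hGL.1) (ae_of_all _ fun x => ?_)
      rw [Real.norm_of_nonneg (mul_nonneg hc0 (norm_nonneg _)), norm_mul]
      exact mul_le_mul_of_nonneg_right (hb _) (norm_nonneg _)
  have hR := tendsto_finsetSum Finset.univ fun i _ => R i
  have hGint : ∀ i, Integrable (fun x => (fderiv ℝ F (fun i => U i x) (Pi.single i 1) * G i x p)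
      * φ x) (volume.restrict (tsupport φ)) := by
    intro i
    have hGL : MemLp (fun x => G i x p) 2 (volume.restrict (tsupport φ)) :=
      (memLp_apply (h i).memLp_grad p).mono_measure hle
    refine MemLp.integrable_fun_mul ?_ (hφ.memLp _ 2)
    refine (hGL.norm.const_mul c).mono (((cF' i).comp_aestronglyMeasurable hFm).mul hGL.1)
      (ae_of_all _ fun x => ?_)
    rw [Real.norm_of_nonneg (mul_nonneg hc0 (norm_nonneg _)), norm_mul]
    refine mul_le_mul_of_nonneg_right ?_ (norm_nonneg _)
    have := (fderiv ℝ F (fun i => U i x)).le_opNorm (Pi.single i 1)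
    rw [Pi.norm_single, norm_one, mul_one] at this
    exact this.trans (hF' _)
  have hlim : ∑ i, ∫ x in tsupport φ, (fderiv ℝ F (fun i => U i x) (Pi.single i 1) * G i x p) * φ x
      = ∫ x in tsupport φ, fderiv ℝ F (fun i => U i x) (fun i => G i x p) * φ x := by
    rw [← integral_finsetSum _ fun i _ => hGint i]
    congr 1
    ext x
    rw [fderiv_pi_apply_eq_sum F, Finset.sum_mul]
  rw [hlim] at hR
  refine tendsto_nhds_unique L (hR.neg.congr fun n => ?_)
  rw [integral_mul_gradient_eq_of_contDiff (hFV n) hφ p, ← integral_finsetSum]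
  · congr 2
    ext x
    rw [gradient_comp_pi hF (hV' n), fderiv_pi_apply_eq_sum F, Finset.sum_mul]
  · intro i _
    refine MemLp.integrable_fun_mul ?_ (hφ.memLp _ 2)
    exact (((cF' i).comp (continuous_pi fun j => (hV n j).continuous)).mul
      (cp (continuous_gradient (hV' n i)))).memLp_restrict_isCompact hKc 2

/-- Chain rule for Sobolev functions, for a `C¹` function whose gradient need not be bounded. -/
theorem HasH1Grad.comp (hΩ : IsOpen Ω) (hΩb : volume Ω ≠ ⊤) {U : ι → Euc m → ℝ}
    {G : ι → Euc m → Euc m} (h : ∀ i, HasH1Grad Ω (U i) (G i)) {F : (ι → ℝ) → ℝ}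
    (hF : ContDiff ℝ 1 F) {c : ℝ}
    (hFc : ∀ᵐ x ∂(volume.restrict Ω), |F (fun i => U i x)| ≤ c * (1 + ‖fun i => U i x‖))
    {K : Euc m → Euc m} (hK : MemLp K 2 (volume.restrict Ω))
    (hKF : ∀ᵐ x ∂(volume.restrict Ω), ∀ p,
      K x p = fderiv ℝ F (fun i => U i x) (fun i => G i x p)) :
    HasH1Grad Ω (fun x => F fun i => U i x) K := by
  have : IsFiniteMeasure (volume.restrict Ω) := ⟨by simpa using hΩb.lt_top⟩
  have hUm : AEStronglyMeasurable (fun x => fun i => U i x) (volume.restrict Ω) :=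
    aestronglyMeasurable_pi_real fun i => (h i).memLp.1
  have hUL : MemLp (fun x => fun i => U i x) 2 (volume.restrict Ω) :=
    memLp_pi_iff.2 fun i => (h i).memLp
  have hFU : MemLp (fun x => F fun i => U i x) 2 (volume.restrict Ω) := by
    refine MemLp.mono' (((memLp_const (1 : ℝ)).add hUL.norm).const_mul c)
      (hF.continuous.comp_aestronglyMeasurable hUm) ?_
    simpa using hFc
  refine ⟨hFU, hK, fun φ hφ p => ?_⟩
  -- F is cut off in its argument at radius of order n + 1; the product is C¹ with compact support,
  -- so the case of bounded F and bounded derivative covers it.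
  let χ : ContDiffBump (0 : ι → ℝ) := ⟨1, 2, one_pos, one_lt_two⟩
  have hχ : ContDiff ℝ 1 χ := χ.contDiff
  obtain ⟨D, hD⟩ : ∃ D, ∀ z, ‖fderiv ℝ χ z‖ ≤ D := by
    have := (χ.hasCompactSupport.fderiv ℝ).exists_bound_of_continuous
      (hχ.continuous_fderiv one_ne_zero)
    exact this
  have hD0 : 0 ≤ D := (norm_nonneg _).trans (hD 0)
  let s : ℕ → ℝ := fun n => ((n : ℝ) + 1)⁻¹
  have hs : ∀ n, 0 < s n := fun n => by positivity
  let Fn : ℕ → (ι → ℝ) → ℝ := fun n z => F z * χ (s n • z)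
  have hχn : ∀ n, ContDiff ℝ 1 fun z : ι → ℝ => χ (s n • z) := fun n =>
    hχ.comp (contDiff_const_smul (s n))
  have hFn : ∀ n, ContDiff ℝ 1 (Fn n) := fun n => hF.mul (hχn n)
  have hFnc : ∀ n, HasCompactSupport (Fn n) := by
    intro n
    refine HasCompactSupport.mul_left ?_
    exact χ.hasCompactSupport.comp_smul (hs n).ne'
  have hderiv : ∀ n z w, fderiv ℝ (Fn n) z w
      = χ (s n • z) * fderiv ℝ F z w + F z * (s n * fderiv ℝ χ (s n • z) w) := by
    intro n z w
    have h1 : HasFDerivAt (fun z : ι → ℝ => χ (s n • z))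
        ((fderiv ℝ χ (s n • z)).comp (s n • ContinuousLinearMap.id ℝ (ι → ℝ))) z :=
      ((hχ.differentiable one_ne_zero) (s n • z)).hasFDerivAt.comp z
        ((hasFDerivAt_id z).const_smul (s n))
    have h2 := ((hF.differentiable one_ne_zero) z).hasFDerivAt.mul h1
    rw [show Fn n = fun z => F z * χ (s n • z) from rfl]
    erw [h2.fderiv]
    simp
    ring
  have hzero : ∀ (n : ℕ) (z : ι → ℝ), 2 * ((n : ℝ) + 1) < ‖z‖ → fderiv ℝ χ (s n • z) = 0 := by
    intro n z hz
    by_contra hne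
    have h1 : s n • z ∈ tsupport χ := support_fderiv_subset ℝ hne
    rw [χ.tsupport_eq, mem_closedBall_zero_iff, norm_smul, Real.norm_of_nonneg (hs n).le] at h1
    have h2 : ((n : ℝ) + 1)⁻¹ * ‖z‖ ≤ 2 := h1
    rw [inv_mul_le_iff₀ (by positivity)] at h2
    linarith
  -- A majorant independent of n. The derivative of the cut-off carries a factor 1/(n+1) and lives
  -- where |U| ≤ 2(n+1); there linear growth gives |F| ≤ 3|c|(n+1), so the two factors cancel.
  have hbound : ∀ n, ∀ᵐ x ∂(volume.restrict Ω),
      |fderiv ℝ (Fn n) (fun i => U i x) (fun i => G i x p)|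
        ≤ |K x p| + 3 * |c| * D * ‖fun i => G i x p‖ := by
    intro n
    filter_upwards [hFc, hKF] with x hx hKx
    rw [hderiv, ← hKx p]
    refine (abs_add_le _ _).trans (add_le_add ?_ ?_)
    · rw [abs_mul, abs_of_nonneg χ.nonneg]
      exact mul_le_of_le_one_left (abs_nonneg _) χ.le_one
    · by_cases hz : 2 * ((n : ℝ) + 1) < ‖fun i => U i x‖
      · rw [hzero n _ hz]
        simp only [zero_apply, mul_zero, abs_zero]
        positivity
      · push Not at hz
        rw [abs_mul, abs_mul, abs_of_pos (hs n)]
        have e1 : |fderiv ℝ χ (s n • fun i => U i x) (fun i => G i x p)|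
            ≤ D * ‖fun i => G i x p‖ :=
          ((fderiv ℝ χ _).le_opNorm _).trans (mul_le_mul_of_nonneg_right (hD _) (norm_nonneg _))
        have hn : (0 : ℝ) ≤ n := n.cast_nonneg
        have e2 : |F fun i => U i x| * s n ≤ 3 * |c| := by
          rw [← div_eq_mul_inv, div_le_iff₀ (by positivity)]
          calc |F fun i => U i x| ≤ c * (1 + ‖fun i => U i x‖) := hx
            _ ≤ |c| * (1 + 2 * ((n : ℝ) + 1)) := by gcongr; exact le_abs_self c
            _ ≤ |c| * (3 * ((n : ℝ) + 1)) := by gcongr; linarith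
            _ = 3 * |c| * ((n : ℝ) + 1) := by ring
        calc _ = (|F fun i => U i x| * s n) *
              |fderiv ℝ χ (s n • fun i => U i x) (fun i => G i x p)| := by ring
          _ ≤ (3 * |c|) * (D * ‖fun i => G i x p‖) := by gcongr
          _ = _ := by ring
  have hsmall : ∀ z : ι → ℝ, ∀ᶠ n in atTop, ‖s n • z‖ < 1 := by
    intro z
    have : Tendsto (fun n => s n * ‖z‖) atTop (𝓝 0) := by
      simpa [s] using (tendsto_one_div_add_atTop_nhds_zero_nat (𝕜 := ℝ)).mul_const ‖z‖
    filter_upwards [this.eventually (gt_mem_nhds one_pos)] with n hn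
    rwa [norm_smul, Real.norm_of_nonneg (hs n).le]
  have hone : ∀ z : ι → ℝ, ‖z‖ < 1 → χ z = 1 := fun z hz =>
    χ.one_of_mem_closedBall (mem_closedBall_zero_iff.2 hz.le)
  have hone' : ∀ z : ι → ℝ, ‖z‖ < 1 → fderiv ℝ χ z = 0 := by
    intro z hz
    have h1 : (χ : (ι → ℝ) → ℝ) =ᶠ[𝓝 z] fun _ => 1 := by
      filter_upwards [Metric.isOpen_ball.mem_nhds (mem_ball_zero_iff.2 hz)] with y hy
      exact hone y (mem_ball_zero_iff.1 hy)
    rw [h1.fderiv_eq]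
    simp
  have hGL : MemLp (fun x => fun i => G i x p) 2 (volume.restrict Ω) :=
    memLp_pi_iff.2 fun i => memLp_apply (h i).memLp_grad p
  have L : Tendsto (fun n => ∫ x in Ω, Fn n (fun i => U i x) * gradient φ x p) atTop
      (𝓝 (∫ x in Ω, F (fun i => U i x) * gradient φ x p)) := by
    refine tendsto_integral_of_dominated_convergence
      (fun x => |(F fun i => U i x) * gradient φ x p|)
      (fun n => ((hFn n).continuous.comp_aestronglyMeasurable hUm).mul
        (memLp_apply (hφ.memLp_gradient _ 2) p).1)
      (hFU.integrable_fun_mul (memLp_apply (hφ.memLp_gradient _ 2) p)).abs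
      (fun n => ae_of_all _ fun x => ?_) (ae_of_all _ fun x => ?_)
    · rw [Real.norm_eq_abs, abs_mul, abs_mul, abs_mul, abs_of_nonneg χ.nonneg]
      gcongr
      exact mul_le_of_le_one_right (abs_nonneg _) χ.le_one
    · refine tendsto_const_nhds.congr' ?_
      filter_upwards [hsmall fun i => U i x] with n hn
      simp only [Fn]
      rw [hone _ hn, mul_one]
  have R : Tendsto (fun n => ∫ x in Ω, fderiv ℝ (Fn n) (fun i => U i x) (fun i => G i x p) * φ x)
      atTop (𝓝 (∫ x in Ω, K x p * φ x)) := by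
    refine tendsto_integral_of_dominated_convergence
      (fun x => (|K x p| + 3 * |c| * D * ‖fun i => G i x p‖) * |φ x|) (fun n => ?_) ?_
      (fun n => ?_) ?_
    · refine AEStronglyMeasurable.mul ?_ (hφ.memLp _ 2).1
      have hc : Continuous fun q : (ι → ℝ) × (ι → ℝ) => fderiv ℝ (Fn n) q.1 q.2 :=
        (((hFn n).continuous_fderiv one_ne_zero).comp continuous_fst).clm_apply continuous_snd
      exact hc.comp_aestronglyMeasurable (hUm.prodMk hGL.1)
    · exact ((memLp_apply hK p).abs.add (hGL.norm.const_mul _)).integrable_fun_mul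
        (hφ.memLp _ 2).abs
    · filter_upwards [hbound n] with x hx
      rw [norm_mul]
      exact mul_le_mul_of_nonneg_right hx (abs_nonneg _)
    · filter_upwards [hKF] with x hx
      refine tendsto_const_nhds.congr' ?_
      filter_upwards [hsmall fun i => U i x] with n hn
      rw [hderiv, hone _ hn, hone' _ hn, hx p]
      simp
  refine tendsto_nhds_unique L (R.neg.congr fun n => ?_)
  -- These bounds may depend on n, since the identity they serve is exact for each n.
  obtain ⟨c1, hc1⟩ := (hFnc n).exists_bound_of_continuous (hFn n).continuous
  obtain ⟨c2, hc2⟩ := ((hFnc n).fderiv ℝ).exists_bound_of_continuous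
    ((hFn n).continuous_fderiv one_ne_zero)
  exact (HasH1Grad.integral_comp_mul_gradient hΩ h (hFn n) (c := max c1 c2)
    (fun z => (hc1 z).trans (le_max_left _ _)) (fun z => (hc2 z).trans (le_max_right _ _)) hφ p).symm

end ChainRule

/-! ### Functions dominated by a function in `H¹₀` -/

theorem EuclideanSpace.norm_le_sum_abs {m : ℕ} (z : Euc m) : ‖z‖ ≤ ∑ p, |z p| := by
  rw [EuclideanSpace.norm_eq]
  refine Real.sqrt_le_iff.2 ⟨Finset.sum_nonneg fun _ _ => abs_nonneg _, ?_⟩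
  calc ∑ i, ‖z i‖ ^ 2 = ∑ i, |z i| * |z i| := by simp [pow_two]
    _ ≤ ∑ i, |z i| * ∑ p, |z p| := by
      refine Finset.sum_le_sum fun i _ => mul_le_mul_of_nonneg_left ?_ (abs_nonneg _)
      exact Finset.single_le_sum (f := fun i => |z i|) (fun _ _ => abs_nonneg _) (Finset.mem_univ i)
    _ = (∑ p, |z p|) ^ 2 := by rw [← Finset.sum_mul, pow_two]

theorem eLpNorm_euc_le_sum {α : Type*} [MeasurableSpace α] {μ : Measure α} {m : ℕ} {f : α → Euc m}
    (hf : AEStronglyMeasurable f μ) {q : ℝ≥0∞} (hq : 1 ≤ q) :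
    eLpNorm f q μ ≤ ∑ p, eLpNorm (fun x => f x p) q μ := by
  calc eLpNorm f q μ ≤ eLpNorm (∑ p, fun x => |f x p|) q μ := by
        refine eLpNorm_mono fun x => ?_
        rw [Finset.sum_apply, Real.norm_of_nonneg (Finset.sum_nonneg fun _ _ => abs_nonneg _)]
        exact EuclideanSpace.norm_le_sum_abs _
    _ ≤ ∑ p, eLpNorm (fun x => |f x p|) q μ :=
        eLpNorm_sum_le (fun p _ =>
          ((EuclideanSpace.proj (𝕜 := ℝ) p).continuous.comp_aestronglyMeasurable hf).norm) hq
    _ = ∑ p, eLpNorm (fun x => f x p) q μ := by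
        congr 1
        ext p
        exact eLpNorm_norm (fun x => f x p)

/-- The factor `b² / (b² + s²(1 + a²))`. -/
def cutRatio (s a b : ℝ) : ℝ := b ^ 2 / (b ^ 2 + s ^ 2 * (1 + a ^ 2))

/-- The derivative of `a * cutRatio s a b` in `a`. -/
def cutDerivLeft (s a b : ℝ) : ℝ :=
  b ^ 2 * (b ^ 2 + s ^ 2 - s ^ 2 * a ^ 2) / (b ^ 2 + s ^ 2 * (1 + a ^ 2)) ^ 2

/-- The derivative of `a * cutRatio s a b` in `b`. -/
def cutDerivRight (s a b : ℝ) : ℝ :=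
  2 * a * b * (s ^ 2 * (1 + a ^ 2)) / (b ^ 2 + s ^ 2 * (1 + a ^ 2)) ^ 2

/-! ### The regularised cut-off factor: bounds, smoothness, gradient -/

section Cut

variable {s : ℝ} (hs : 0 < s) (a b : ℝ)
include hs

theorem cut_denom_pos : 0 < b ^ 2 + s ^ 2 * (1 + a ^ 2) := by positivity

theorem abs_cutRatio_le : |cutRatio s a b| ≤ 1 := by
  have := cut_denom_pos hs a b
  rw [cutRatio, abs_of_nonneg (by positivity), div_le_one this]
  nlinarith [mul_nonneg (sq_nonneg s) (sq_nonneg a), sq_nonneg s]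

theorem abs_cutDerivLeft_le : |cutDerivLeft s a b| ≤ 1 := by
  have h0 := cut_denom_pos hs a b
  rw [cutDerivLeft, abs_div, abs_of_pos (pow_pos h0 2), div_le_one (pow_pos h0 2), abs_mul,
    abs_of_nonneg (sq_nonneg b), pow_two (b ^ 2 + s ^ 2 * (1 + a ^ 2))]
  have e1 : 0 ≤ s ^ 2 * a ^ 2 := by positivity
  refine mul_le_mul ?_ ?_ (abs_nonneg _) h0.le
  · nlinarith [sq_nonneg s]
  · rw [abs_le]
    constructor <;> nlinarith [sq_nonneg s, sq_nonneg b]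

/-- The inequality 2s|a||b| ≤ b² + s²a² compensates for the product ab. For fixed s this keeps the
gradient of the cut-off product square integrable without any relation between a and b. -/
theorem abs_cutDerivRight_le : |cutDerivRight s a b| ≤ 1 / s := by
  have h0 := cut_denom_pos hs a b
  rw [cutDerivRight, abs_div, abs_of_pos (pow_pos h0 2), div_le_div_iff₀ (pow_pos h0 2) hs, abs_mul,
    one_mul, abs_of_nonneg (show 0 ≤ s ^ 2 * (1 + a ^ 2) by positivity),
    pow_two (b ^ 2 + s ^ 2 * (1 + a ^ 2))]
  have e1 : |2 * a * b| * s ≤ b ^ 2 + s ^ 2 * (1 + a ^ 2) := by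
    have : |2 * a * b| * s = 2 * (s * |a|) * |b| := by
      rw [abs_mul, abs_mul, abs_of_pos (by norm_num : (0 : ℝ) < 2)]; ring
    rw [this]
    nlinarith [sq_nonneg (s * |a| - |b|), sq_abs a, sq_abs b, sq_nonneg s, mul_pow s |a| 2]
  calc _ = (|2 * a * b| * s) * (s ^ 2 * (1 + a ^ 2)) := by ring
    _ ≤ (b ^ 2 + s ^ 2 * (1 + a ^ 2)) * (b ^ 2 + s ^ 2 * (1 + a ^ 2)) := by
      refine mul_le_mul e1 ?_ (by positivity) h0.le
      nlinarith [sq_nonneg b]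

/-- Unlike 1/s, this bound is uniform in s. It is the point where the domination of one function by
the other enters, and it permits s → 0. -/
theorem abs_cutDerivRight_le_of_abs_le {c : ℝ} (h : |a| ≤ c * |b|) : |cutDerivRight s a b| ≤ |c| := by
  have h0 := cut_denom_pos hs a b
  rw [cutDerivRight, abs_div, abs_of_pos (pow_pos h0 2), div_le_iff₀ (pow_pos h0 2), abs_mul,
    abs_of_nonneg (show 0 ≤ s ^ 2 * (1 + a ^ 2) by positivity)]
  have e1 : |2 * a * b| ≤ |c| * (2 * b ^ 2) := by
    have : |2 * a * b| = 2 * |a| * |b| := by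
      rw [abs_mul, abs_mul, abs_of_pos (by norm_num : (0 : ℝ) < 2)]
    rw [this, ← sq_abs b]
    have h2 : c * |b| ≤ |c| * |b| := mul_le_mul_of_nonneg_right (le_abs_self c) (abs_nonneg b)
    nlinarith [abs_nonneg b, mul_le_mul_of_nonneg_right (h.trans h2) (abs_nonneg b)]
  calc _ ≤ (|c| * (2 * b ^ 2)) * (s ^ 2 * (1 + a ^ 2)) := by gcongr
    _ = |c| * (2 * b ^ 2 * (s ^ 2 * (1 + a ^ 2))) := by ring
    _ ≤ _ := by
      refine mul_le_mul_of_nonneg_left ?_ (abs_nonneg c)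
      nlinarith [sq_nonneg (b ^ 2), sq_nonneg (s ^ 2 * (1 + a ^ 2))]

theorem contDiff_mul_cutRatio {E : Type*} [NormedAddCommGroup E] [NormedSpace ℝ E] {f g : E → ℝ}
    (hf : ContDiff ℝ ∞ f) (hg : ContDiff ℝ ∞ g) :
    ContDiff ℝ ∞ fun x => f x * cutRatio s (f x) (g x) := by
  refine hf.mul (ContDiff.div (hg.pow 2) ?_ fun x => (cut_denom_pos hs _ _).ne')
  exact (hg.pow 2).add (contDiff_const.mul (contDiff_const.add (hf.pow 2)))

theorem continuous_cutRatio : Continuous fun q : ℝ × ℝ => cutRatio s q.1 q.2 := by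
  unfold cutRatio
  exact Continuous.div (by fun_prop) (by fun_prop) fun q => (cut_denom_pos hs _ _).ne'

theorem continuous_cutDerivLeft : Continuous fun q : ℝ × ℝ => cutDerivLeft s q.1 q.2 := by
  unfold cutDerivLeft
  exact Continuous.div (by fun_prop) (by fun_prop) fun q => (pow_pos (cut_denom_pos hs _ _) 2).ne'

theorem continuous_cutDerivRight : Continuous fun q : ℝ × ℝ => cutDerivRight s q.1 q.2 := by
  unfold cutDerivRight
  exact Continuous.div (by fun_prop) (by fun_prop) fun q => (pow_pos (cut_denom_pos hs _ _) 2).ne'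

theorem gradient_mul_cutRatio {m : ℕ} {f g : Euc m → ℝ} (hf : Differentiable ℝ f)
    (hg : Differentiable ℝ g) (x : Euc m) :
    gradient (fun x => f x * cutRatio s (f x) (g x)) x
      = cutDerivLeft s (f x) (g x) • gradient f x + cutDerivRight s (f x) (g x) • gradient g x := by
  have h0 := (cut_denom_pos hs (f x) (g x)).ne'
  ext p
  set e : Euc m := EuclideanSpace.single p 1
  have hline : ∀ {k : Euc m → ℝ}, DifferentiableAt ℝ k x →
      HasDerivAt (fun t : ℝ => k (x + t • e)) (gradient k x p) 0 := fun hk => by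
    rw [gradient_apply_eq_fderiv]
    exact hk.hasFDerivAt.hasLineDerivAt e
  have hf' := hline (hf x)
  have hg' := hline (hg x)
  have h0' : g (x + (0 : ℝ) • e) ^ 2 + s ^ 2 * (1 + f (x + (0 : ℝ) • e) ^ 2) ≠ 0 := by simpa using h0
  have hd := hf'.fun_mul ((hg'.fun_pow 2).fun_div ((hg'.fun_pow 2).fun_add
    (((hf'.fun_pow 2).const_add 1).const_mul (s ^ 2))) h0')
  have hdiff : DifferentiableAt ℝ (fun x => f x * cutRatio s (f x) (g x)) x := by
    have hc : ContDiff ℝ ∞ fun q : ℝ × ℝ => q.1 * cutRatio s q.1 q.2 :=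
      contDiff_mul_cutRatio hs contDiff_fst contDiff_snd
    exact (hc.differentiable (by simp) (f x, g x)).comp x ((hf x).prodMk (hg x))
  have hq := (hline hdiff).unique hd
  rw [hq]
  simp only [zero_smul, add_zero, cutDerivLeft, cutDerivRight, PiLp.add_apply, PiLp.smul_apply,
    smul_eq_mul]
  field_simp
  ring

end Cut

/-! ### Approximation of dominated functions by test functions -/

section Domination

variable {m : ℕ} {Ω : Set (Euc m)} {v w : Euc m → ℝ} {G H : Euc m → Euc m}

theorem tendsto_eLpNorm_euc_gradient_mollify (hΩ : IsOpen Ω) (h : HasH1Grad Ω v G)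
    {K : Set (Euc m)} (hK : IsCompact K) (hKΩ : K ⊆ Ω) :
    Tendsto (fun n => eLpNorm (fun x => gradient (mollify Ω v n) x - G x) 2
      (volume.restrict K)) atTop (𝓝 0) := by
  have hs := tendsto_finsetSum Finset.univ
    fun p _ => tendsto_eLpNorm_gradient_mollify hΩ h hK hKΩ p
  simp only [Finset.sum_const_zero] at hs
  refine ENNReal.tendsto_zero_of_le hs fun n => ?_
  refine eLpNorm_euc_le_sum (AEStronglyMeasurable.sub ?_ ?_) (by norm_num)
  · exact (continuous_gradient ((contDiff_mollify hΩ h.memLp n).of_le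
      (by exact_mod_cast le_top))).aestronglyMeasurable
  · exact h.memLp_grad.1.mono_measure (Measure.restrict_mono hKΩ le_rfl)

/-- The factor vanishes wherever φ does, so the product inherits the support of φ while f need only
be smooth. The term s²(1 + a²) keeps the denominator positive, hence the quotient smooth. -/
theorem IsTestFun.mul_cutRatio {s : ℝ} (hs : 0 < s) {f φ : Euc m → ℝ} (hf : ContDiff ℝ ∞ f)
    (hφ : IsTestFun Ω φ) : IsTestFun Ω fun x => f x * cutRatio s (f x) (φ x) := by
  have hsub : Function.support (fun x => f x * cutRatio s (f x) (φ x)) ⊆ tsupport φ := by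
    refine subset_trans (fun x hx => ?_) (subset_tsupport φ)
    exact fun hφx : φ x = 0 => hx (by simp [cutRatio, hφx])
  exact ⟨contDiff_mul_cutRatio hs hf hφ.1, HasCompactSupport.of_support_subset_isCompact hφ.2.1 hsub,
    (closure_minimal hsub (isClosed_tsupport φ)).trans hφ.2.2⟩

theorem tendsto_eLpNorm_piecewise {E : Type*} [NormedAddCommGroup E] {K : ℕ → Set (Euc m)}
    [∀ n, DecidablePred (· ∈ K n)] (hK : ∀ n, MeasurableSet (K n))
    {f : ℕ → Euc m → E} {g : Euc m → E} {b : ℕ → ℝ≥0∞} (hb : Tendsto b atTop (𝓝 0))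
    (h : ∀ n, eLpNorm (fun x => f n x - g x) 2 (volume.restrict (K n)) ≤ b n) :
    Tendsto (fun n => eLpNorm (fun x => (K n).piecewise (f n) g x - g x) 2 (volume.restrict Ω))
      atTop (𝓝 0) := by
  refine ENNReal.tendsto_zero_of_le hb fun n => le_trans ?_ (h n)
  rw [← eLpNorm_indicator_eq_eLpNorm_restrict (hK n)]
  refine le_trans (le_of_eq (congrArg (fun f => eLpNorm f 2 _) ?_))
    (eLpNorm_mono_measure _ Measure.restrict_le_self)
  ext x
  by_cases hx : x ∈ K n <;> simp [hx]

/-- Approximate w by test functions φ_n, and v by mollifications that are accurate only on the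
support of φ_n: the product sees nothing else. For fixed s the factor and its two derivative
coefficients are bounded and continuous, so values and gradients both converge in L². -/
theorem HasH10Grad.mul_cutRatio (hΩ : IsOpen Ω) (hv : HasH1Grad Ω v G) (hw : HasH10Grad Ω w H)
    {s : ℝ} (hs : 0 < s) :
    HasH10Grad Ω (fun x => v x * cutRatio s (v x) (w x))
      (fun x => cutDerivLeft s (v x) (w x) • G x + cutDerivRight s (v x) (w x) • H x) := by
  classical
  obtain ⟨φ, hφ, hφ0, hφ1⟩ := hw.exists_seq
  have hb : Tendsto (fun n : ℕ => ((n : ℝ≥0∞) + 1)⁻¹) atTop (𝓝 0) := by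
    have := (tendsto_add_atTop_iff_nat 1).2 ENNReal.tendsto_inv_nat_nhds_zero
    simpa using this
  have hle : ∀ n, volume.restrict (tsupport (φ n)) ≤ volume.restrict Ω := fun n =>
    Measure.restrict_mono (hφ n).2.2 le_rfl
  have hex : ∀ n : ℕ, ∃ N, eLpNorm (fun x => mollify Ω v N x - v x) 2
      (volume.restrict (tsupport (φ n))) ≤ ((n : ℝ≥0∞) + 1)⁻¹ ∧
      eLpNorm (fun x => gradient (mollify Ω v N) x - G x) 2
      (volume.restrict (tsupport (φ n))) ≤ ((n : ℝ≥0∞) + 1)⁻¹ := by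
    intro n
    have hpos : (0 : ℝ≥0∞) < ((n : ℝ≥0∞) + 1)⁻¹ := by simp
    exact ((ENNReal.tendsto_nhds_zero.1 (ENNReal.tendsto_zero_of_le
      (tendsto_eLpNorm_mollify hΩ hv.memLp) fun N => eLpNorm_mono_measure _ (hle n)) _ hpos).and
      (ENNReal.tendsto_nhds_zero.1 (tendsto_eLpNorm_euc_gradient_mollify hΩ hv (hφ n).2.1
        (hφ n).2.2) _ hpos)).exists
  choose N hN0 hN1 using hex
  have hKm : ∀ n, MeasurableSet (tsupport (φ n)) := fun n => (hφ n).2.1.measurableSet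
  have hVs : ∀ n, ContDiff ℝ ∞ (mollify Ω v (N n)) := fun n => contDiff_mollify hΩ hv.memLp _
  have hVg : ∀ n, Continuous (gradient (mollify Ω v (N n))) := fun n =>
    continuous_gradient ((hVs n).of_le (by exact_mod_cast le_top))
  -- Off the support of φ_n the mollification is replaced by v itself. The product is unchanged, and
  -- V_n, W_n now converge to v and its gradient in L² of the whole of Ω.
  set V : ℕ → Euc m → ℝ := fun n => (tsupport (φ n)).piecewise (mollify Ω v (N n)) v with hVdef
  set W : ℕ → Euc m → Euc m := fun n =>
    (tsupport (φ n)).piecewise (gradient (mollify Ω v (N n))) G with hWdef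
  have hVm : ∀ n, AEStronglyMeasurable (V n) (volume.restrict Ω) := fun n =>
    AEStronglyMeasurable.piecewise (hKm n) (hVs n).continuous.aestronglyMeasurable
      (hv.memLp.1.mono_measure Measure.restrict_le_self)
  have hWm : ∀ n, AEStronglyMeasurable (W n) (volume.restrict Ω) := fun n =>
    AEStronglyMeasurable.piecewise (hKm n) (hVg n).aestronglyMeasurable
      (hv.memLp_grad.1.mono_measure Measure.restrict_le_self)
  have hV0 : Tendsto (fun n => eLpNorm (fun x => V n x - v x) 2 (volume.restrict Ω)) atTop (𝓝 0) :=
    tendsto_eLpNorm_piecewise hKm hb hN0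
  have hW0 : Tendsto (fun n => eLpNorm (fun x => W n x - G x) 2 (volume.restrict Ω)) atTop (𝓝 0) :=
    tendsto_eLpNorm_piecewise hKm hb hN1
  have hφm : ∀ n, AEStronglyMeasurable (φ n) (volume.restrict Ω) := fun n => ((hφ n).memLp _ 2).1
  have hval : ∀ n x, mollify Ω v (N n) x * cutRatio s (mollify Ω v (N n) x) (φ n x)
      = cutRatio s (V n x) (φ n x) • V n x := by
    intro n x
    by_cases hx : x ∈ tsupport (φ n)
    · simp [hVdef, hx, mul_comm]
    · simp [cutRatio, image_eq_zero_of_notMem_tsupport hx]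
  have hgrad : ∀ n x, gradient (fun x => mollify Ω v (N n) x
      * cutRatio s (mollify Ω v (N n) x) (φ n x)) x
      = cutDerivLeft s (V n x) (φ n x) • W n x
        + cutDerivRight s (V n x) (φ n x) • gradient (φ n) x := by
    intro n x
    rw [gradient_mul_cutRatio hs ((hVs n).differentiable (by simp)) (hφ n).differentiable]
    by_cases hx : x ∈ tsupport (φ n)
    · simp [hVdef, hWdef, hx]
    · simp [cutDerivLeft, cutDerivRight, image_eq_zero_of_notMem_tsupport hx]
  obtain ⟨n₁, hn₁, hae₁⟩ := exists_subseq_tendsto_ae_of_eLpNorm_two hVm hv.memLp.1 hV0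
  obtain ⟨n₂, hn₂, hae₂⟩ := exists_subseq_tendsto_ae_of_eLpNorm_two (fun k => hφm (n₁ k)) hw.memLp.1
    (hφ0.comp hn₁.tendsto_atTop)
  have hsub : Tendsto (fun k => n₁ (n₂ k)) atTop atTop := hn₁.tendsto_atTop.comp hn₂.tendsto_atTop
  have hae : ∀ {g : ℝ × ℝ → ℝ}, Continuous g → ∀ᵐ x ∂(volume.restrict Ω),
      Tendsto (fun k => g (V (n₁ (n₂ k)) x, φ (n₁ (n₂ k)) x)) atTop (𝓝 (g (v x, w x))) := by
    intro g hg
    filter_upwards [hae₁, hae₂] with x h1 h2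
    exact (hg.tendsto _).comp ((h1.comp hn₂.tendsto_atTop).prodMk_nhds h2)
  have hmeas : ∀ {g : ℝ × ℝ → ℝ}, Continuous g → ∀ k,
      AEStronglyMeasurable (fun x => g (V (n₁ (n₂ k)) x, φ (n₁ (n₂ k)) x)) (volume.restrict Ω) :=
    fun hg k => hg.comp_aestronglyMeasurable ((hVm _).prodMk (hφm _))
  have hmeas' : ∀ {g : ℝ × ℝ → ℝ}, Continuous g →
      AEStronglyMeasurable (fun x => g (v x, w x)) (volume.restrict Ω) :=
    fun hg => hg.comp_aestronglyMeasurable (hv.memLp.1.prodMk hw.memLp.1)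
  have c0 := continuous_cutRatio hs
  have c1 := continuous_cutDerivLeft hs
  have c2 := continuous_cutDerivRight hs
  have mL : MemLp (fun x => cutDerivLeft s (v x) (w x) • G x) 2 (volume.restrict Ω) := by
    refine hv.memLp_grad.mono ((hmeas' c1).smul hv.memLp_grad.1) (ae_of_all _ fun x => ?_)
    rw [norm_smul]
    exact mul_le_of_le_one_left (norm_nonneg _) (abs_cutDerivLeft_le hs _ _)
  have mR : MemLp (fun x => cutDerivRight s (v x) (w x) • H x) 2 (volume.restrict Ω) := by
    refine (hw.memLp_grad.norm.const_mul (1 / s)).mono ((hmeas' c2).smul hw.memLp_grad.1)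
      (ae_of_all _ fun x => ?_)
    rw [norm_smul, norm_mul, norm_norm, Real.norm_of_nonneg (show 0 ≤ 1 / s by positivity)]
    exact mul_le_mul_of_nonneg_right (abs_cutDerivRight_le hs _ _) (norm_nonneg _)
  refine HasH10Grad.of_tendsto_of_isTestFun
    (φ := fun k x => mollify Ω v (N (n₁ (n₂ k))) x
      * cutRatio s (mollify Ω v (N (n₁ (n₂ k))) x) (φ (n₁ (n₂ k)) x))
    (fun k => (hφ _).mul_cutRatio hs (hVs _)) ?_ (mL.add mR) ?_ ?_
  · refine hv.memLp.mono (hv.memLp.1.mul (hmeas' c0)) (ae_of_all _ fun x => ?_)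
    rw [norm_mul]
    exact mul_le_of_le_one_right (norm_nonneg _) (abs_cutRatio_le hs _ _)
  · simp only [hval, fun x => mul_comm (v x) (cutRatio s (v x) (w x))]
    exact tendsto_eLpNorm_two_smul (hmeas c0) (hmeas' c0)
      (fun k => ae_of_all _ fun x => abs_cutRatio_le hs _ _) (hae c0) (fun k => hVm _) hv.memLp
      (hV0.comp hsub)
  · simp only [hgrad]
    refine tendsto_eLpNorm_two_add (fun k => (hmeas c1 k).smul (hWm _)) mL.1
      (fun k => (hmeas c2 k).smul ((hφ _).memLp_gradient _ 2).1) mR.1 ?_ ?_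
    · exact tendsto_eLpNorm_two_smul (hmeas c1) (hmeas' c1)
        (fun k => ae_of_all _ fun x => abs_cutDerivLeft_le hs _ _) (hae c1) (fun k => hWm _)
        hv.memLp_grad (hW0.comp hsub)
    · exact tendsto_eLpNorm_two_smul (hmeas c2) (hmeas' c2)
        (fun k => ae_of_all _ fun x => abs_cutDerivRight_le hs _ _) (hae c2)
        (fun k => ((hφ _).memLp_gradient _ 2).1) hw.memLp_grad (hφ1.comp hsub)

theorem tendsto_cutRatio {a b : ℝ} (hab : b = 0 → a = 0) {s : ℕ → ℝ} (hs : Tendsto s atTop (𝓝 0)) :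
    Tendsto (fun n => cutRatio (s n) a b) atTop (𝓝 (if b = 0 then 0 else 1)) := by
  by_cases hb : b = 0
  · simp [hb, hab hb, cutRatio]
  · have h1 : ContinuousAt (fun s => cutRatio s a b) 0 := by
      unfold cutRatio
      exact ContinuousAt.div (by fun_prop) (by fun_prop) (by simpa using hb)
    have h2 := h1.tendsto.comp hs
    have e : cutRatio 0 a b = 1 := by simp [cutRatio, hb]
    rw [e] at h2
    rw [if_neg hb]
    exact h2

theorem tendsto_cutDerivLeft {a b : ℝ} {s : ℕ → ℝ} (hs : Tendsto s atTop (𝓝 0)) :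
    Tendsto (fun n => cutDerivLeft (s n) a b) atTop (𝓝 (if b = 0 then 0 else 1)) := by
  by_cases hb : b = 0
  · simp [hb, cutDerivLeft]
  · have h1 : ContinuousAt (fun s => cutDerivLeft s a b) 0 := by
      unfold cutDerivLeft
      exact ContinuousAt.div (by fun_prop) (by fun_prop) (by simpa using hb)
    have h2 := h1.tendsto.comp hs
    have e : cutDerivLeft 0 a b = 1 := by
      simp only [cutDerivLeft]
      field_simp
      ring
    rw [e] at h2
    rw [if_neg hb]
    exact h2

theorem tendsto_cutDerivRight {a b : ℝ} {s : ℕ → ℝ} (hs : Tendsto s atTop (𝓝 0)) :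
    Tendsto (fun n => cutDerivRight (s n) a b) atTop (𝓝 0) := by
  by_cases hb : b = 0
  · simp [hb, cutDerivRight]
  · have h1 : ContinuousAt (fun s => cutDerivRight s a b) 0 := by
      unfold cutDerivRight
      exact ContinuousAt.div (by fun_prop) (by fun_prop) (by simpa using hb)
    have h2 := h1.tendsto.comp hs
    have e : cutDerivRight 0 a b = 0 := by simp [cutDerivRight]
    rwa [e] at h2

/-- A Sobolev function dominated by a function in `H¹₀` lies in `H¹₀`. -/
theorem HasH10Grad.of_abs_le (hΩ : IsOpen Ω) (hv : HasH1Grad Ω v G) (hw : HasH10Grad Ω w H) {c : ℝ}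
    (hc : ∀ᵐ x ∂(volume.restrict Ω), |v x| ≤ c * |w x|) : HasH10Grad Ω v G := by
  classical
  let s : ℕ → ℝ := fun n => 1 / ((n : ℝ) + 1)
  have hs : ∀ n, 0 < s n := fun n => by positivity
  have hs0 : Tendsto s atTop (𝓝 0) := tendsto_one_div_add_atTop_nhds_zero_nat
  have hmeas : ∀ {g : ℝ × ℝ → ℝ}, Continuous g →
      AEStronglyMeasurable (fun x => g (v x, w x)) (volume.restrict Ω) :=
    fun hg => hg.comp_aestronglyMeasurable (hv.memLp.1.prodMk hw.memLp.1)
  have hm0 := fun n => hmeas (continuous_cutRatio (hs n))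
  have hm1 := fun n => hmeas (continuous_cutDerivLeft (hs n))
  have hm2 := fun n => hmeas (continuous_cutDerivRight (hs n))
  -- As s → 0 the cut-off factor and its derivative in a tend to the indicator of {w ≠ 0}, and the
  -- derivative in b tends to 0. The values of the product therefore tend to v, since v vanishes
  -- with w, and the gradients to χG.
  let χ : Euc m → ℝ := fun x => if w x = 0 then 0 else 1
  have hχm : AEStronglyMeasurable χ (volume.restrict Ω) := by
    have : Measurable fun t : ℝ => if t = 0 then (0 : ℝ) else 1 :=
      Measurable.ite (measurableSet_singleton 0) measurable_const measurable_const
    exact (this.comp_aemeasurable hw.memLp.1.aemeasurable).aestronglyMeasurable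
  have hχG : MemLp (fun x => χ x • G x) 2 (volume.restrict Ω) := by
    refine hv.memLp_grad.mono (hχm.smul hv.memLp_grad.1) (ae_of_all _ fun x => ?_)
    rw [norm_smul]
    refine mul_le_of_le_one_left (norm_nonneg _) ?_
    by_cases hx : w x = 0 <;> simp [χ, hx]
  have hself : ∀ {E : Type} [NormedAddCommGroup E] (f : Euc m → E),
      Tendsto (fun _ : ℕ => eLpNorm (fun x => f x - f x) 2 (volume.restrict Ω)) atTop (𝓝 0) := by
    intro E _ f
    simp
  have hvw : ∀ᵐ x ∂(volume.restrict Ω), w x = 0 → v x = 0 := by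
    filter_upwards [hc] with x hx hwx
    simpa [hwx] using hx
  have t0 : Tendsto (fun n => eLpNorm (fun x => cutRatio (s n) (v x) (w x) • v x - χ x • v x) 2
      (volume.restrict Ω)) atTop (𝓝 0) := by
    refine tendsto_eLpNorm_two_smul (G := fun _ => v) (c := 1) hm0 hχm
      (fun n => ae_of_all _ fun x => abs_cutRatio_le (hs n) _ _) ?_
      (fun _ => hv.memLp.1) hv.memLp (hself v)
    filter_upwards [hvw] with x hx using tendsto_cutRatio hx hs0
  have t1 : Tendsto (fun n => eLpNorm (fun x => cutDerivLeft (s n) (v x) (w x) • G x - χ x • G x) 2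
      (volume.restrict Ω)) atTop (𝓝 0) :=
    tendsto_eLpNorm_two_smul (G := fun _ => G) (c := 1) hm1 hχm
      (fun n => ae_of_all _ fun x => abs_cutDerivLeft_le (hs n) _ _)
      (ae_of_all _ fun x => tendsto_cutDerivLeft hs0)
      (fun _ => hv.memLp_grad.1) hv.memLp_grad (hself G)
  have t2 : Tendsto (fun n => eLpNorm (fun x => cutDerivRight (s n) (v x) (w x) • H x
      - (0 : ℝ) • H x) 2 (volume.restrict Ω)) atTop (𝓝 0) := by
    refine tendsto_eLpNorm_two_smul (G := fun _ => H) (a' := fun _ => 0) (c := |c|) hm2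
      aestronglyMeasurable_const (fun n => ?_)
      (ae_of_all _ fun x => tendsto_cutDerivRight hs0)
      (fun _ => hw.memLp_grad.1) hw.memLp_grad (hself H)
    filter_upwards [hc] with x hx
    exact abs_cutDerivRight_le_of_abs_le (hs n) _ _ hx
  have m1 : ∀ n, AEStronglyMeasurable (fun x => cutDerivLeft (s n) (v x) (w x) • G x)
      (volume.restrict Ω) := fun n => (hm1 n).smul hv.memLp_grad.1
  have m2 : ∀ n, AEStronglyMeasurable (fun x => cutDerivRight (s n) (v x) (w x) • H x)
      (volume.restrict Ω) := fun n => (hm2 n).smul hw.memLp_grad.1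
  have m3 : AEStronglyMeasurable (fun x => (0 : ℝ) • H x) (volume.restrict Ω) :=
    by simpa using aestronglyMeasurable_const
  have t12 : Tendsto (fun n => eLpNorm (fun x => (cutDerivLeft (s n) (v x) (w x) • G x
      + cutDerivRight (s n) (v x) (w x) • H x) - (χ x • G x + (0 : ℝ) • H x)) 2
      (volume.restrict Ω)) atTop (𝓝 0) := tendsto_eLpNorm_two_add m1 hχG.1 m2 m3 t1 t2
  have hlim : HasH10Grad Ω v (fun x => χ x • G x) := by
    refine HasH10Grad.of_tendsto (fun n => HasH10Grad.mul_cutRatio hΩ hv hw (hs n)) hv.memLp hχG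
      (t0.congr fun n => eLpNorm_congr_ae ?_) (t12.congr fun n => eLpNorm_congr_ae ?_)
    · filter_upwards [hvw] with x hx
      by_cases hwx : w x = 0
      · simp [hx hwx]
      · simp [χ, hwx, mul_comm]
    · exact ae_of_all _ fun x => by simp only [zero_smul, add_zero]
  -- Uniqueness of the weak gradient identifies χG with G; that the gradient of v vanishes almost
  -- everywhere on {w = 0} comes out rather than going in.
  exact hlim.of_hasH1Grad hΩ hv

end Domination

/-! ### A weighted Gagliardo–Nirenberg inequality -/

theorem norm_gradient {m : ℕ} (u : Euc m → ℝ) (x : Euc m) : ‖gradient u x‖ = ‖fderiv ℝ u x‖ := by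
  simp [gradient]

theorem enorm_gradient {m : ℕ} (u : Euc m → ℝ) (x : Euc m) : ‖gradient u x‖ₑ = ‖fderiv ℝ u x‖ₑ := by
  rw [← ofReal_norm, ← ofReal_norm, norm_gradient]

/-! ### Hölder interpolation, and Sobolev inequalities in dimensions one, two and at least three -/

section Interpolation

variable {α : Type*} [MeasurableSpace α] {μ : Measure α}

/-- Hölder's inequality for the three functions c^θ, f^r, f² with weights 2/θ, a and 1 - 2/θ - a.
The relation a(r - 2) = 4/θ is what makes the total power of f equal to 2. -/
theorem lintegral_weight_mul_sq_le {c f : α → ℝ≥0∞} (hc : AEMeasurable c μ) (hf : AEMeasurable f μ)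
    {θ r a : ℝ} (hθ : 2 ≤ θ) (hr : 0 ≤ r) (ha : 0 ≤ a) (har : a * (r - 2) = 4 / θ)
    (haθ : a ≤ 1 - 2 / θ) :
    ∫⁻ x, c x ^ (2 : ℝ) * f x ^ (2 : ℝ) ∂μ
      ≤ (∫⁻ x, c x ^ θ ∂μ) ^ (2 / θ) * ((∫⁻ x, f x ^ r ∂μ) ^ a
        * (∫⁻ x, f x ^ (2 : ℝ) ∂μ) ^ (1 - 2 / θ - a)) := by
  have hθ0 : 0 < θ := by linarith
  have h := ENNReal.lintegral_prod_norm_pow_le (μ := μ) (Finset.univ : Finset (Fin 3))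
    (f := ![fun x => c x ^ θ, fun x => f x ^ r, fun x => f x ^ (2 : ℝ)])
    (p := ![2 / θ, a, 1 - 2 / θ - a])
    (by
      intro i _
      fin_cases i
      exacts [hc.pow_const _, hf.pow_const _, hf.pow_const _])
    (by simp [Fin.sum_univ_three])
    (by
      intro i _
      fin_cases i
      · exact (by positivity : 0 ≤ 2 / θ)
      · exact ha
      · exact (by linarith : 0 ≤ 1 - 2 / θ - a))
  simp only [Fin.prod_univ_three, Matrix.cons_val_zero, Matrix.cons_val_one, Matrix.cons_val] at h
  rw [← mul_assoc]
  refine le_trans (le_of_eq ?_) h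
  congr 1
  ext x
  rw [← ENNReal.rpow_mul, ← ENNReal.rpow_mul, ← ENNReal.rpow_mul, mul_assoc,
    ← ENNReal.rpow_add_of_nonneg _ _ (by positivity) (by nlinarith)]
  congr 2
  · field_simp
  · have : 2 / θ * 2 = 4 / θ := by ring
    nlinarith

end Interpolation

/-- In the plane H¹ embeds in every L^r with r finite but not in L^∞, so arbitrarily high powers are
reached by induction: the embedding of W^{1,1} in L² is applied to u^{k+2}, whose gradient is
(k+2)u^{k+1}∇u, and Cauchy–Schwarz separates u^{k+1} from ∇u. -/
theorem lintegral_enorm_pow_le_of_dim_two (k : ℕ) :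
    ∃ κ : ℝ≥0, ∀ u : Euc 2 → ℝ, ContDiff ℝ 1 u → HasCompactSupport u →
      ∫⁻ x, ‖u x‖ₑ ^ (2 * ((k : ℝ) + 1)) ≤ κ * ((∫⁻ x, ‖u x‖ₑ ^ (2 : ℝ))
        * (∫⁻ x, ‖fderiv ℝ u x‖ₑ ^ (2 : ℝ)) ^ (k : ℝ)) := by
  induction k with
  | zero => exact ⟨1, fun u _ _ => by simp⟩
  | succ k ih =>
    obtain ⟨κ, hκ⟩ := ih
    set C := eLpNormLESNormFDerivOneConst (volume : Measure (Euc 2)) ((2 : ℝ≥0) : ℝ)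
    refine ⟨C ^ 2 * (k + 2) ^ 2 * κ, fun u hu huc => ?_⟩
    have hv : ContDiff ℝ 1 fun x => u x ^ (k + 2) := hu.pow _
    have hvc : HasCompactSupport fun x => u x ^ (k + 2) :=
      huc.comp_left (g := fun t : ℝ => t ^ (k + 2)) (by simp)
    have hconj : NNReal.HolderConjugate (Module.finrank ℝ (Euc 2) : ℝ≥0) 2 := by
      have : (Module.finrank ℝ (Euc 2) : ℝ≥0) = 2 := by simp
      rw [this]
      exact NNReal.HolderConjugate.two_two
    have h1 := eLpNorm_le_eLpNorm_fderiv_one volume hv hvc hconj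
    have hder : ∀ x, ‖fderiv ℝ (fun x => u x ^ (k + 2)) x‖ₑ
        = ((k : ℝ≥0∞) + 2) * (‖u x‖ₑ ^ ((k : ℝ) + 1) * ‖fderiv ℝ u x‖ₑ) := by
      intro x
      have hd := ((hu.differentiable one_ne_zero x).hasFDerivAt.pow (k + 2)).fderiv
      rw [hd, enorm_smul, ← mul_assoc, nsmul_eq_mul, enorm_mul, enorm_pow]
      congr 2
      · rw [← ofReal_norm, Real.norm_natCast, ENNReal.ofReal_natCast]
        push_cast
        ring
      · rw [show k + 2 - 1 = k + 1 by omega, ← ENNReal.rpow_natCast]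
        push_cast
        ring_nf
    rw [eLpNorm_one_eq_lintegral_enorm] at h1
    simp only [hder] at h1
    rw [lintegral_const_mul' _ _ (by finiteness)] at h1
    have hum : AEMeasurable (fun x => ‖u x‖ₑ ^ (2 * ((k : ℝ) + 1))) volume :=
      hu.continuous.enorm.measurable.aemeasurable.pow_const _
    have hdm : AEMeasurable (fun x => ‖fderiv ℝ u x‖ₑ ^ (2 : ℝ)) volume :=
      ((hu.continuous_fderiv one_ne_zero).enorm.measurable.aemeasurable).pow_const _
    have h2 := ENNReal.lintegral_mul_norm_pow_le hum hdm (p := 1 / 2) (q := 1 / 2) (by norm_num)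
      (by norm_num) (by norm_num)
    have e2 : ∀ x, (‖u x‖ₑ ^ (2 * ((k : ℝ) + 1))) ^ (1 / 2 : ℝ) * (‖fderiv ℝ u x‖ₑ ^ (2 : ℝ)) ^ (1 / 2 : ℝ)
        = ‖u x‖ₑ ^ ((k : ℝ) + 1) * ‖fderiv ℝ u x‖ₑ := by
      intro x
      rw [← ENNReal.rpow_mul, ← ENNReal.rpow_mul,
        show 2 * ((k : ℝ) + 1) * (1 / 2) = k + 1 by ring, show (2 : ℝ) * (1 / 2) = 1 by norm_num,
        ENNReal.rpow_one]
    simp only [e2] at h2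
    have h3 : ∫⁻ x, ‖u x‖ₑ ^ (2 * (((k + 1 : ℕ) : ℝ) + 1))
        = eLpNorm (fun x => u x ^ (k + 2)) (2 : ℝ≥0) volume ^ ((2 : ℝ≥0) : ℝ) := by
      rw [eLpNorm_nnreal_pow_eq_lintegral two_ne_zero]
      congr 1
      ext x
      rw [enorm_pow, ← ENNReal.rpow_natCast, ← ENNReal.rpow_mul]
      congr 1
      push_cast
      ring
    set B := ∫⁻ x, ‖fderiv ℝ u x‖ₑ ^ (2 : ℝ)
    rw [h3]
    calc _ ≤ ((C : ℝ≥0∞) * (((k : ℝ≥0∞) + 2) * ((∫⁻ x, ‖u x‖ₑ ^ (2 * ((k : ℝ) + 1))) ^ (1 / 2 : ℝ)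
          * B ^ (1 / 2 : ℝ)))) ^ (2 : ℝ) := by
          refine ENNReal.rpow_le_rpow (h1.trans ?_) (by norm_num)
          gcongr
      _ = (C : ℝ≥0∞) ^ 2 * ((k : ℝ≥0∞) + 2) ^ 2
          * ((∫⁻ x, ‖u x‖ₑ ^ (2 * ((k : ℝ) + 1))) * B) := by
          rw [ENNReal.mul_rpow_of_nonneg _ _ (by norm_num), ENNReal.mul_rpow_of_nonneg _ _ (by norm_num),
            ENNReal.mul_rpow_of_nonneg _ _ (by norm_num), ← ENNReal.rpow_mul, ← ENNReal.rpow_mul]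
          norm_num
          ring
      _ ≤ (C : ℝ≥0∞) ^ 2 * ((k : ℝ≥0∞) + 2) ^ 2
          * ((κ * ((∫⁻ x, ‖u x‖ₑ ^ (2 : ℝ)) * B ^ (k : ℝ))) * B) := by
          gcongr
          exact hκ u hu huc
      _ = _ := by
          push_cast
          rw [ENNReal.rpow_add_of_nonneg _ _ (by positivity) (by norm_num), ENNReal.rpow_one]
          ring

/-- On the line u² is the integral of 2uu' from infinity, and Cauchy–Schwarz bounds that integral.
-/
theorem enorm_sq_le_of_dim_one {u : Euc 1 → ℝ} (hu : ContDiff ℝ 1 u) (huc : HasCompactSupport u)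
    (x : Euc 1) :
    ‖u x‖ₑ ^ (2 : ℝ) ≤ 2 * ((∫⁻ x, ‖u x‖ₑ ^ (2 : ℝ)) ^ (1 / 2 : ℝ)
      * (∫⁻ x, ‖fderiv ℝ u x‖ₑ ^ (2 : ℝ)) ^ (1 / 2 : ℝ)) := by
  let e : ℝ → Euc 1 := fun t => WithLp.toLp 2 fun _ => t
  have he : MeasurePreserving e volume volume := by
    have h1 := (EuclideanSpace.volume_preserving_symm_measurableEquiv_toLp (Fin 1)).symm
    have h2 := (volume_preserving_funUnique (Fin 1) ℝ).symm
    exact h1.comp h2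
  have hex : ∀ x : Euc 1, e (x 0) = x := by
    intro x
    ext i
    simp [e, Subsingleton.elim i 0]
  have hed : ∀ t, HasDerivAt e (EuclideanSpace.single 0 1) t := by
    intro t
    have h0 : e = fun t => t • (EuclideanSpace.single 0 1 : Euc 1) := by
      ext t i
      simp [e, Subsingleton.elim i 0]
    rw [h0]
    simpa using (hasDerivAt_id t).smul_const (EuclideanSpace.single 0 1 : Euc 1)
  have hec : ContDiff ℝ 1 e := by
    have h0 : e = fun t => t • (EuclideanSpace.single 0 1 : Euc 1) := by
      ext t i
      simp [e, Subsingleton.elim i 0]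
    rw [h0]
    exact contDiff_id.smul contDiff_const
  have hv : ContDiff ℝ 1 fun t => u (e t) ^ 2 := (hu.comp hec).pow 2
  have hvc : HasCompactSupport fun t => u (e t) ^ 2 := by
    have h1 : HasCompactSupport (fun x : Euc 1 => u x ^ 2) :=
      huc.comp_left (g := fun t : ℝ => t ^ 2) (by simp)
    have h2 : IsCompact ((fun x : Euc 1 => x 0) '' tsupport fun x : Euc 1 => u x ^ 2) :=
      h1.isCompact.image (EuclideanSpace.proj (𝕜 := ℝ) (0 : Fin 1)).continuous
    refine HasCompactSupport.intro h2 fun t ht => ?_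
    by_contra h
    exact ht ⟨e t, subset_tsupport (fun x : Euc 1 => u x ^ 2) h, rfl⟩
  have h1 := hvc.enorm_le_lintegral_Ici_deriv hv (x 0)
  rw [hex] at h1
  have hder : ∀ t, ‖deriv (fun t => u (e t) ^ 2) t‖ₑ ≤ 2 * (‖u (e t)‖ₑ * ‖fderiv ℝ u (e t)‖ₑ) := by
    intro t
    have h3 : HasDerivAt (fun t => u (e t)) (fderiv ℝ u (e t) (EuclideanSpace.single 0 1)) t :=
      ((hu.differentiable one_ne_zero (e t)).hasFDerivAt).comp_hasDerivAt t (hed t)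
    rw [(h3.fun_pow 2).deriv, enorm_mul, enorm_mul, mul_assoc]
    have h4 : ‖fderiv ℝ u (e t) (EuclideanSpace.single 0 1)‖ₑ ≤ ‖fderiv ℝ u (e t)‖ₑ := by
      have := (fderiv ℝ u (e t)).le_opNorm (EuclideanSpace.single 0 1)
      rw [PiLp.norm_single, norm_one, mul_one] at this
      rw [← ofReal_norm, ← ofReal_norm]
      exact ENNReal.ofReal_le_ofReal this
    gcongr
    · rw [← ofReal_norm]
      simp
    · simp
  have hgm : Measurable fun x : Euc 1 => ‖u x‖ₑ * ‖fderiv ℝ u x‖ₑ :=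
    hu.continuous.enorm.measurable.mul (hu.continuous_fderiv one_ne_zero).enorm.measurable
  calc ‖u x‖ₑ ^ (2 : ℝ) = ‖u x ^ 2‖ₑ := by rw [enorm_pow, ← ENNReal.rpow_natCast]; norm_num
    _ ≤ ∫⁻ t, ‖deriv (fun t => u (e t) ^ 2) t‖ₑ := h1.trans (setLIntegral_le_lintegral _ _)
    _ ≤ ∫⁻ t, 2 * (‖u (e t)‖ₑ * ‖fderiv ℝ u (e t)‖ₑ) := lintegral_mono hder
    _ = 2 * ∫⁻ t, ‖u (e t)‖ₑ * ‖fderiv ℝ u (e t)‖ₑ := lintegral_const_mul' _ _ (by norm_num)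
    _ = 2 * ∫⁻ x, ‖u x‖ₑ * ‖fderiv ℝ u x‖ₑ := by rw [he.lintegral_comp hgm]
    _ ≤ _ := by
      gcongr
      have h2 := ENNReal.lintegral_mul_norm_pow_le (μ := (volume : Measure (Euc 1)))
        (hu.continuous.enorm.measurable.aemeasurable.pow_const (2 : ℝ))
        ((hu.continuous_fderiv one_ne_zero).enorm.measurable.aemeasurable.pow_const (2 : ℝ))
        (p := 1 / 2) (q := 1 / 2) (by norm_num) (by norm_num) (by norm_num)
      refine le_trans (le_of_eq ?_) h2
      congr 1
      ext x
      rw [← ENNReal.rpow_mul, ← ENNReal.rpow_mul]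
      norm_num

theorem lintegral_enorm_pow_le_of_three_le_dim {m : ℕ} (hm : 3 ≤ m) :
    ∃ κ : ℝ≥0, ∀ u : Euc m → ℝ, ContDiff ℝ 1 u → HasCompactSupport u →
      ∫⁻ x, ‖u x‖ₑ ^ (2 * (m : ℝ) / (m - 2)) ≤ κ * (∫⁻ x, ‖fderiv ℝ u x‖ₑ ^ (2 : ℝ)) ^
        ((m : ℝ) / (m - 2)) := by
  have hm' : (3 : ℝ) ≤ m := by exact_mod_cast hm
  have hm2 : (0 : ℝ) < m - 2 := by linarith
  have hq0 : 0 < 2 * (m : ℝ) / (m - 2) := by positivity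
  set q : ℝ≥0 := ⟨2 * (m : ℝ) / (m - 2), hq0.le⟩ with hq
  have hq' : q ≠ 0 := by
    intro h
    have := congrArg NNReal.toReal h
    exact hq0.ne' this
  set C := SNormLESNormFDerivOfEqConst ℝ (volume : Measure (Euc m)) (2 : ℝ≥0)
  refine ⟨C ^ (q : ℝ), fun u hu huc => ?_⟩
  have h1 := eLpNorm_le_eLpNorm_fderiv_of_eq (volume : Measure (Euc m)) hu huc (p := 2) (p' := q)
    (by norm_num) (by simp; omega) (by
      change (2 * (m : ℝ) / (m - 2))⁻¹ = _
      rw [finrank_euclideanSpace_fin]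
      push_cast
      field_simp)
  have h2 := ENNReal.rpow_le_rpow h1 q.coe_nonneg
  have h3 : eLpNorm u q volume ^ (q : ℝ) = _ := eLpNorm_nnreal_pow_eq_lintegral hq'
  have h4 : eLpNorm (fderiv ℝ u) (2 : ℝ≥0) volume ^ ((2 : ℝ≥0) : ℝ) = _ :=
    eLpNorm_nnreal_pow_eq_lintegral two_ne_zero
  have h5 : eLpNorm (fderiv ℝ u) (2 : ℝ≥0) volume
      = (∫⁻ x, ‖fderiv ℝ u x‖ₑ ^ (2 : ℝ)) ^ (1 / 2 : ℝ) := by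
    have h6 : eLpNorm (fderiv ℝ u) (2 : ℝ≥0) volume ^ (2 : ℝ)
      = ∫⁻ x, ‖fderiv ℝ u x‖ₑ ^ (2 : ℝ) := h4
    rw [← h6, ← ENNReal.rpow_mul]
    norm_num
  have h7 : ∫⁻ x, ‖u x‖ₑ ^ (2 * (m : ℝ) / (m - 2)) = eLpNorm u q volume ^ (q : ℝ) := h3.symm
  rw [h7]
  refine h2.trans (le_of_eq ?_)
  rw [ENNReal.mul_rpow_of_nonneg _ _ q.coe_nonneg, h5, ← ENNReal.rpow_mul,
    ENNReal.coe_rpow_of_nonneg _ q.coe_nonneg]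
  congr 2
  change 1 / 2 * (2 * (m : ℝ) / (m - 2)) = _
  ring

/-- A weighted Gagliardo–Nirenberg inequality. -/
theorem exists_weighted_gagliardoNirenberg {m : ℕ} (hm : m ≠ 0) {θ : ℝ} (hmθ : (m : ℝ) < θ)
    (hθ : 2 ≤ θ) :
    ∃ κ : ℝ≥0, ∀ (c : Euc m → ℝ≥0∞) (u : Euc m → ℝ), AEMeasurable c volume → ContDiff ℝ 1 u →
      HasCompactSupport u →
      ∫⁻ x, c x ^ (2 : ℝ) * ‖u x‖ₑ ^ (2 : ℝ) ≤ κ * ((∫⁻ x, c x ^ θ) ^ (2 / θ)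
        * ((∫⁻ x, ‖u x‖ₑ ^ (2 : ℝ)) ^ (1 - m / θ)
          * (∫⁻ x, ‖fderiv ℝ u x‖ₑ ^ (2 : ℝ)) ^ (m / θ))) := by
  have hθ0 : 0 < θ := by linarith
  obtain rfl | rfl | hm3 : m = 1 ∨ m = 2 ∨ 3 ≤ m := by omega
  -- Dimension one: |u|² is raised partly to the power 2/θ, where the uniform bound S is used, and
  -- the remaining power 1 - 2/θ is paired with c by Hölder's inequality.
  · refine ⟨2 ^ (2 / θ), fun c u hc hu huc => ?_⟩
    have hum : AEMeasurable (fun x => ‖u x‖ₑ) volume := hu.continuous.enorm.measurable.aemeasurable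
    have hS := enorm_sq_le_of_dim_one hu huc
    set A := ∫⁻ x, ‖u x‖ₑ ^ (2 : ℝ)
    set B := ∫⁻ x, ‖fderiv ℝ u x‖ₑ ^ (2 : ℝ)
    set S := 2 * (A ^ (1 / 2 : ℝ) * B ^ (1 / 2 : ℝ))
    have h2θ : 2 / θ ≤ 1 := by rw [div_le_one hθ0]; exact hθ
    have hpt : ∀ x, c x ^ (2 : ℝ) * ‖u x‖ₑ ^ (2 : ℝ)
        ≤ S ^ (2 / θ) * ((c x ^ θ) ^ (2 / θ) * (‖u x‖ₑ ^ (2 : ℝ)) ^ (1 - 2 / θ)) := by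
      intro x
      have e1 : ‖u x‖ₑ ^ (2 : ℝ) = (‖u x‖ₑ ^ (2 : ℝ)) ^ (2 / θ) * (‖u x‖ₑ ^ (2 : ℝ)) ^ (1 - 2 / θ) := by
        rw [← ENNReal.rpow_add_of_nonneg _ _ (by positivity) (by linarith)]
        simp
      have e2 : c x ^ (2 : ℝ) = (c x ^ θ) ^ (2 / θ) := by
        rw [← ENNReal.rpow_mul]
        congr 1
        field_simp
      calc _ = (‖u x‖ₑ ^ (2 : ℝ)) ^ (2 / θ) * ((c x ^ θ) ^ (2 / θ)
            * (‖u x‖ₑ ^ (2 : ℝ)) ^ (1 - 2 / θ)) := by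
            rw [← e2]
            nth_rw 1 [e1]
            ring
        _ ≤ _ := by
            gcongr
            exact hS x
    have hH := ENNReal.lintegral_mul_norm_pow_le (μ := (volume : Measure (Euc 1)))
      (hc.pow_const θ) (hum.pow_const (2 : ℝ)) (p := 2 / θ) (q := 1 - 2 / θ) (by positivity)
      (by linarith) (by ring)
    have hm1 : AEMeasurable (fun x => (c x ^ θ) ^ (2 / θ) * (‖u x‖ₑ ^ (2 : ℝ)) ^ (1 - 2 / θ)) volume :=
      ((hc.pow_const θ).pow_const _).mul ((hum.pow_const (2 : ℝ)).pow_const _)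
    calc _ ≤ ∫⁻ x, S ^ (2 / θ) * ((c x ^ θ) ^ (2 / θ) * (‖u x‖ₑ ^ (2 : ℝ)) ^ (1 - 2 / θ)) :=
          lintegral_mono hpt
      _ = S ^ (2 / θ) * ∫⁻ x, (c x ^ θ) ^ (2 / θ) * (‖u x‖ₑ ^ (2 : ℝ)) ^ (1 - 2 / θ) :=
          lintegral_const_mul'' _ hm1
      _ ≤ S ^ (2 / θ) * ((∫⁻ x, c x ^ θ) ^ (2 / θ) * A ^ (1 - 2 / θ)) := by gcongr
      _ = _ := by
          have e3 : S ^ (2 / θ) = 2 ^ (2 / θ) * (A ^ (1 / θ) * B ^ (1 / θ)) := by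
            rw [ENNReal.mul_rpow_of_nonneg _ _ (by positivity),
              ENNReal.mul_rpow_of_nonneg _ _ (by positivity), ← ENNReal.rpow_mul, ← ENNReal.rpow_mul]
            congr 3 <;> ring
          have e4 : A ^ (1 - ((1 : ℕ) : ℝ) / θ) = A ^ (1 / θ) * A ^ (1 - 2 / θ) := by
            rw [← ENNReal.rpow_add_of_nonneg _ _ (by positivity) (by linarith)]
            congr 1
            push_cast
            ring
          rw [e3, e4, ENNReal.coe_rpow_of_nonneg _ (by positivity)]
          push_cast
          ring
  · have hθ2 : 0 < θ - 2 := by push_cast at hmθ; linarith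
    -- Dimension two: with r = 2(k+1) the weight on f^r must be 2/(θk), and k is taken large enough
    -- for it not to exceed 1 - 2/θ. This is possible because θ > 2.
    obtain ⟨k, hk⟩ := exists_nat_gt (2 / (θ - 2))
    have hk0 : (0 : ℝ) < k := lt_trans (by positivity) hk
    obtain ⟨κ, hκ⟩ := lintegral_enorm_pow_le_of_dim_two k
    have ha0 : 0 < 2 / (θ * k) := by positivity
    have haθ : 2 / (θ * k) ≤ 1 - 2 / θ := by
      rw [div_lt_iff₀ hθ2] at hk
      rw [div_le_iff₀ (by positivity), sub_mul, div_mul_eq_mul_div, le_sub_iff_add_le, one_mul,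
        show 2 * (θ * (k : ℝ)) / θ = 2 * k by field_simp]
      nlinarith
    refine ⟨κ ^ (2 / (θ * k)), fun c u hc hu huc => ?_⟩
    have hum : AEMeasurable (fun x => ‖u x‖ₑ) volume := hu.continuous.enorm.measurable.aemeasurable
    have h1 := lintegral_weight_mul_sq_le hc hum (θ := θ) (r := 2 * ((k : ℝ) + 1))
      (a := 2 / (θ * k)) hθ (by positivity) ha0.le (by field_simp; ring) haθ
    have h2 := hκ u hu huc
    set A := ∫⁻ x, ‖u x‖ₑ ^ (2 : ℝ)
    set B := ∫⁻ x, ‖fderiv ℝ u x‖ₑ ^ (2 : ℝ)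
    refine h1.trans ?_
    calc _ ≤ (∫⁻ x, c x ^ θ) ^ (2 / θ) * ((κ * (A * B ^ (k : ℝ))) ^ (2 / (θ * k))
          * A ^ (1 - 2 / θ - 2 / (θ * k))) := by gcongr
      _ = _ := by
          have e4 : A ^ (1 - ((2 : ℕ) : ℝ) / θ) = A ^ (2 / (θ * k)) * A ^ (1 - 2 / θ - 2 / (θ * k)) := by
            rw [← ENNReal.rpow_add_of_nonneg _ _ (by positivity) (by linarith)]
            congr 1
            push_cast
            ring
          have e5 : B ^ (((2 : ℕ) : ℝ) / θ) = (B ^ (k : ℝ)) ^ (2 / (θ * k)) := by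
            rw [← ENNReal.rpow_mul]
            congr 1
            push_cast
            field_simp
          rw [e4, e5, ENNReal.coe_rpow_of_nonneg _ (by positivity),
            ENNReal.mul_rpow_of_nonneg _ _ (by positivity),
            ENNReal.mul_rpow_of_nonneg _ _ (by positivity)]
          ring
  · have hm' : (3 : ℝ) ≤ m := by exact_mod_cast hm3
    have hm2 : (0 : ℝ) < m - 2 := by linarith
    obtain ⟨κ, hκ⟩ := lintegral_enorm_pow_le_of_three_le_dim hm3
    have ha0 : 0 < ((m : ℝ) - 2) / θ := by positivity
    have ha1 : ((m : ℝ) - 2) / θ ≤ 1 - 2 / θ := by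
      rw [sub_div, sub_le_sub_iff_right, div_le_one hθ0]
      exact hmθ.le
    -- Dimension at least three: for the critical exponent r = 2m/(m-2) one has r - 2 = 4/(m-2),
    -- which forces the weight (m-2)/θ.
    refine ⟨κ ^ (((m : ℝ) - 2) / θ), fun c u hc hu huc => ?_⟩
    have hum : AEMeasurable (fun x => ‖u x‖ₑ) volume := hu.continuous.enorm.measurable.aemeasurable
    have h1 := lintegral_weight_mul_sq_le hc hum (θ := θ) (r := 2 * (m : ℝ) / (m - 2))
      (a := ((m : ℝ) - 2) / θ) hθ (by positivity) ha0.le (by field_simp; ring) ha1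
    have h2 := hκ u hu huc
    set A := ∫⁻ x, ‖u x‖ₑ ^ (2 : ℝ)
    set B := ∫⁻ x, ‖fderiv ℝ u x‖ₑ ^ (2 : ℝ)
    refine h1.trans ?_
    calc _ ≤ (∫⁻ x, c x ^ θ) ^ (2 / θ) * ((κ * B ^ ((m : ℝ) / (m - 2))) ^ (((m : ℝ) - 2) / θ)
          * A ^ (1 - 2 / θ - ((m : ℝ) - 2) / θ)) := by gcongr
      _ = _ := by
          have e4 : 1 - (m : ℝ) / θ = 1 - 2 / θ - ((m : ℝ) - 2) / θ := by ring
          have e5 : B ^ ((m : ℝ) / θ) = (B ^ ((m : ℝ) / (m - 2))) ^ (((m : ℝ) - 2) / θ) := by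
            rw [← ENNReal.rpow_mul]
            congr 1
            field_simp
          rw [e4, e5, ENNReal.coe_rpow_of_nonneg _ (by positivity),
            ENNReal.mul_rpow_of_nonneg _ _ (by positivity)]
          ring

/-! ### Inequalities in `H¹₀` -/

section Inequalities

theorem IsTestFun.setLIntegral_eq {m : ℕ} {Ω : Set (Euc m)} (hΩ : IsOpen Ω) {φ : Euc m → ℝ}
    (hφ : IsTestFun Ω φ) :
    (∫⁻ x, ‖φ x‖ₑ ^ (2 : ℝ) = ∫⁻ x in Ω, ‖φ x‖ₑ ^ (2 : ℝ)) ∧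
    (∫⁻ x, ‖fderiv ℝ φ x‖ₑ ^ (2 : ℝ) = ∫⁻ x in Ω, ‖gradient φ x‖ₑ ^ (2 : ℝ)) := by
  constructor
  · rw [← lintegral_indicator hΩ.measurableSet]
    congr 1
    ext x
    by_cases hx : x ∈ Ω
    · rw [indicator_of_mem hx]
    · rw [indicator_of_notMem hx, image_eq_zero_of_notMem_tsupport fun h => hx (hφ.2.2 h)]
      simp
  · rw [← lintegral_indicator hΩ.measurableSet]
    congr 1
    ext x
    rw [← enorm_gradient]
    by_cases hx : x ∈ Ω
    · rw [indicator_of_mem hx]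
    · rw [indicator_of_notMem hx, gradient_eq_zero_of_notMem_tsupport fun h => hx (hφ.2.2 h)]
      simp

theorem eLpNorm_two_eq_lintegral {α E : Type*} [MeasurableSpace α] [NormedAddCommGroup E]
    {μ : Measure α} (f : α → E) : eLpNorm f 2 μ = (∫⁻ x, ‖f x‖ₑ ^ (2 : ℝ) ∂μ) ^ (1 / 2 : ℝ) := by
  rw [eLpNorm_eq_lintegral_rpow_enorm_toReal (by norm_num) (by norm_num)]
  simp

theorem exists_gagliardoNirenberg_isTestFun {m : ℕ} (hm : m ≠ 0) {θ : ℝ} (hmθ : (m : ℝ) < θ)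
    (hθ : 2 ≤ θ) :
    ∃ κ : ℝ≥0, ∀ (Ω : Set (Euc m)), IsOpen Ω → ∀ (E : Type) [NormedAddCommGroup E] (c : Euc m → E)
      (φ : Euc m → ℝ), AEStronglyMeasurable c (volume.restrict Ω) → IsTestFun Ω φ →
      eLpNorm (fun x => ‖c x‖ * φ x) 2 (volume.restrict Ω)
        ≤ κ * (eLpNorm c (ENNReal.ofReal θ) (volume.restrict Ω)
          * (eLpNorm φ 2 (volume.restrict Ω) ^ (1 - m / θ)
            * eLpNorm (gradient φ) 2 (volume.restrict Ω) ^ (m / θ))) := by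
  have hθ0 : 0 < θ := by linarith
  obtain ⟨κ, hκ⟩ := exists_weighted_gagliardoNirenberg hm hmθ hθ
  refine ⟨κ ^ (1 / 2 : ℝ), fun Ω hΩ E _ c φ hc hφ => ?_⟩
  have hcm : AEMeasurable (Ω.indicator fun x => ‖c x‖ₑ) volume :=
    (aemeasurable_indicator_iff hΩ.measurableSet).2 hc.enorm
  have h := hκ (Ω.indicator fun x => ‖c x‖ₑ) φ hcm hφ.contDiff_one hφ.2.1
  rw [(hφ.setLIntegral_eq hΩ).1, (hφ.setLIntegral_eq hΩ).2] at h
  have e1 : ∫⁻ x, (Ω.indicator fun x => ‖c x‖ₑ) x ^ θ = ∫⁻ x in Ω, ‖c x‖ₑ ^ θ := by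
    rw [← lintegral_indicator hΩ.measurableSet]
    congr 1
    ext x
    by_cases hx : x ∈ Ω
    · simp [hx]
    · simp [hx, hθ0]
  have e2 : ∫⁻ x, (Ω.indicator fun x => ‖c x‖ₑ) x ^ (2 : ℝ) * ‖φ x‖ₑ ^ (2 : ℝ)
      = ∫⁻ x in Ω, ‖‖c x‖ * φ x‖ₑ ^ (2 : ℝ) := by
    rw [← lintegral_indicator hΩ.measurableSet]
    congr 1
    ext x
    by_cases hx : x ∈ Ω
    · simp [hx, enorm_mul, mul_pow]
    · simp [hx]
  rw [e1, e2] at h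
  have hθE : ENNReal.ofReal θ ≠ 0 := by simpa using hθ0
  rw [eLpNorm_two_eq_lintegral, eLpNorm_two_eq_lintegral, eLpNorm_two_eq_lintegral,
    eLpNorm_eq_lintegral_rpow_enorm_toReal hθE ENNReal.ofReal_ne_top, ENNReal.toReal_ofReal hθ0.le]
  refine (ENNReal.rpow_le_rpow h (by norm_num : (0 : ℝ) ≤ 1 / 2)).trans (le_of_eq ?_)
  rw [ENNReal.mul_rpow_of_nonneg _ _ (by norm_num), ENNReal.mul_rpow_of_nonneg _ _ (by norm_num),
    ENNReal.mul_rpow_of_nonneg _ _ (by norm_num), ENNReal.coe_rpow_of_nonneg _ (by norm_num)]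
  simp only [← ENNReal.rpow_mul]
  congr 3
  · ring
  · congr 1
    ring
  · congr 1
    ring

theorem eLpNorm_le_add_sub {α E : Type*} [MeasurableSpace α] [NormedAddCommGroup E]
    {μ : Measure α} {f g : α → E} (hf : AEStronglyMeasurable f μ) (hg : AEStronglyMeasurable g μ) :
    eLpNorm f 2 μ ≤ eLpNorm g 2 μ + eLpNorm (fun x => f x - g x) 2 μ := by
  have := eLpNorm_add_le hg (hf.sub hg) (p := 2) (by norm_num)
  rw [add_sub_cancel] at this
  exact this

/-- The Gagliardo–Nirenberg inequality in `H¹₀`, with a bounded weight. -/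
theorem exists_gagliardoNirenberg {m : ℕ} (hm : m ≠ 0) {θ : ℝ} (hmθ : (m : ℝ) < θ) (hθ : 2 ≤ θ) :
    ∃ κ : ℝ≥0, ∀ (Ω : Set (Euc m)), IsOpen Ω → volume Ω ≠ ⊤ →
      ∀ (E : Type) [NormedAddCommGroup E] (c : Euc m → E)
      (u : Euc m → ℝ) (G : Euc m → Euc m), MemLp c ⊤ (volume.restrict Ω) → HasH10Grad Ω u G →
      eLpNorm (fun x => ‖c x‖ * u x) 2 (volume.restrict Ω)
        ≤ κ * (eLpNorm c (ENNReal.ofReal θ) (volume.restrict Ω)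
          * (eLpNorm u 2 (volume.restrict Ω) ^ (1 - m / θ)
            * eLpNorm G 2 (volume.restrict Ω) ^ (m / θ))) := by
  have hθ0 : 0 < θ := by linarith
  have hm0 : 0 < (m : ℝ) := by exact_mod_cast Nat.pos_of_ne_zero hm
  have hl : 0 < (m : ℝ) / θ := by positivity
  have hl1 : 0 < 1 - (m : ℝ) / θ := by rw [sub_pos, div_lt_one hθ0]; exact hmθ
  obtain ⟨κ, hκ⟩ := exists_gagliardoNirenberg_isTestFun hm hmθ hθ
  refine ⟨κ, fun Ω hΩ hΩf E _ c u G hc hu => ?_⟩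
  have : IsFiniteMeasure (volume.restrict Ω) := ⟨by simpa using hΩf.lt_top⟩
  obtain ⟨φ, hφ, h0, h1⟩ := hu.exists_seq
  set μ := volume.restrict Ω
  set e0 : ℕ → ℝ≥0∞ := fun n => eLpNorm (fun x => φ n x - u x) 2 μ
  set e1 : ℕ → ℝ≥0∞ := fun n => eLpNorm (fun x => gradient (φ n) x - G x) 2 μ
  have hcθ : MemLp c (ENNReal.ofReal θ) μ := hc.mono_exponent le_top
  -- Boundedness of c is used only here: it makes the error of replacing u by a test function tend
  -- to 0. The limiting estimate contains only the L^θ norm of c.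
  have hbound : ∀ n, eLpNorm (fun x => ‖c x‖ * u x) 2 μ
      ≤ κ * (eLpNorm c (ENNReal.ofReal θ) μ * ((eLpNorm u 2 μ + e0 n) ^ (1 - m / θ)
        * (eLpNorm G 2 μ + e1 n) ^ (m / θ))) + eLpNorm c ⊤ μ * e0 n := by
    intro n
    have hφm := ((hφ n).memLp μ 2).1
    have hgm := ((hφ n).memLp_gradient μ 2).1
    refine (eLpNorm_le_add_sub (hc.1.norm.mul hu.memLp.1) (hc.1.norm.mul hφm)).trans ?_
    refine add_le_add ((hκ Ω hΩ E c (φ n) hc.1 (hφ n)).trans ?_) ?_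
    · gcongr
      · exact eLpNorm_le_add_sub hφm hu.memLp.1
      · exact eLpNorm_le_add_sub hgm hu.memLp_grad.1
    · have h2 := eLpNorm_smul_le_mul_eLpNorm (p := ⊤) (q := 2) (r := 2) (hφm.sub hu.memLp.1)
        hc.1.norm
      rw [eLpNorm_norm] at h2
      refine le_trans (le_of_eq ?_) h2
      rw [eLpNorm_fun_sub_comm]
      congr 1
      ext x
      simp [mul_sub]
  have hlim : Tendsto (fun n => κ * (eLpNorm c (ENNReal.ofReal θ) μ
      * ((eLpNorm u 2 μ + e0 n) ^ (1 - m / θ)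
        * (eLpNorm G 2 μ + e1 n) ^ (m / θ))) + eLpNorm c ⊤ μ * e0 n) atTop
      (𝓝 (κ * (eLpNorm c (ENNReal.ofReal θ) μ * ((eLpNorm u 2 μ + 0) ^ (1 - m / θ)
        * (eLpNorm G 2 μ + 0) ^ (m / θ))) + eLpNorm c ⊤ μ * 0)) := by
    have t0 := (tendsto_const_nhds (x := eLpNorm u 2 μ)).add h0
    have t1 := (tendsto_const_nhds (x := eLpNorm G 2 μ)).add h1
    have f0 : (eLpNorm u 2 μ + 0) ^ (1 - m / θ) ≠ ⊤ :=
      ENNReal.rpow_ne_top_of_nonneg hl1.le (by simpa using hu.memLp.2.ne)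
    have f1 : (eLpNorm G 2 μ + 0) ^ (m / θ) ≠ ⊤ :=
      ENNReal.rpow_ne_top_of_nonneg hl.le (by simpa using hu.memLp_grad.2.ne)
    refine Tendsto.add ?_ (ENNReal.Tendsto.const_mul h0 (Or.inr hc.2.ne))
    refine ENNReal.Tendsto.const_mul (ENNReal.Tendsto.const_mul ?_ (Or.inr hcθ.2.ne))
      (Or.inr ENNReal.coe_ne_top)
    exact ENNReal.Tendsto.mul (t0.ennrpow_const _) (Or.inr f1) (t1.ennrpow_const _) (Or.inr f0)
  have := ge_of_tendsto' hlim hbound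
  simpa using this

/-- The Poincaré inequality in `H¹₀`. -/
theorem exists_poincare {m : ℕ} (hm : m ≠ 0) {Ω : Set (Euc m)} (hΩ : IsOpen Ω)
    (hΩf : volume Ω ≠ ⊤) :
    ∃ P : ℝ≥0, ∀ (u : Euc m → ℝ) (G : Euc m → Euc m), HasH10Grad Ω u G →
      eLpNorm u 2 (volume.restrict Ω) ≤ P * eLpNorm G 2 (volume.restrict Ω) := by
  have hm0 : 0 < (m : ℝ) := by exact_mod_cast Nat.pos_of_ne_zero hm
  -- Any admissible θ would do; the weight is the constant 1, whose L^θ norm on Ω is finite.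
  set θ : ℝ := m + 2 with hθdef
  have hθ0 : 0 < θ := by positivity
  have hl : 0 < (m : ℝ) / θ := by positivity
  have hl1 : 0 < 1 - (m : ℝ) / θ := by
    rw [sub_pos, div_lt_one hθ0]; linarith
  obtain ⟨κ, hκ⟩ := exists_gagliardoNirenberg hm (θ := θ) (by linarith) (by linarith)
  have : IsFiniteMeasure (volume.restrict Ω) := ⟨by simpa using hΩf.lt_top⟩
  set μ := volume.restrict Ω
  have h1 : MemLp (fun _ : Euc m => (1 : ℝ)) ⊤ μ := memLp_const 1
  have h1θ : eLpNorm (fun _ : Euc m => (1 : ℝ)) (ENNReal.ofReal θ) μ ≠ ⊤ :=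
    (h1.mono_exponent le_top).2.ne
  set K := κ * eLpNorm (fun _ : Euc m => (1 : ℝ)) (ENNReal.ofReal θ) μ with hK
  have hKf : K ≠ ⊤ := ENNReal.mul_ne_top ENNReal.coe_ne_top h1θ
  refine ⟨(K ^ ((m : ℝ) / θ)⁻¹).toNNReal, fun u G hu => ?_⟩
  rw [ENNReal.coe_toNNReal (ENNReal.rpow_ne_top_of_nonneg (by positivity) hKf)]
  have h := hκ Ω hΩ hΩf ℝ (fun _ => 1) u G h1 hu
  simp only [norm_one, one_mul] at h
  rw [← mul_assoc, ← hK] at h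
  change eLpNorm u 2 μ ≤ K * (eLpNorm u 2 μ ^ (1 - (m : ℝ) / θ) * eLpNorm G 2 μ ^ ((m : ℝ) / θ)) at h
  set N0 := eLpNorm u 2 μ
  set N1 := eLpNorm G 2 μ
  have hN0 : N0 ≠ ⊤ := hu.memLp.2.ne
  -- Otherwise the power 1 - m/θ of N0 is positive and finite and can be divided out.
  by_cases hz : N0 = 0
  · rw [hz]; exact zero_le
  have e : N0 = N0 ^ (1 - (m : ℝ) / θ) * N0 ^ ((m : ℝ) / θ) := by
    rw [← ENNReal.rpow_add_of_nonneg _ _ hl1.le hl.le]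
    simp
  nth_rw 1 [e] at h
  have h2 : N0 ^ ((m : ℝ) / θ) ≤ K * N1 ^ ((m : ℝ) / θ) := by
    refine (ENNReal.mul_le_mul_iff_right (a := N0 ^ (1 - (m : ℝ) / θ)) ?_ ?_).1 ?_
    · exact (ENNReal.rpow_pos (pos_iff_ne_zero.2 hz) hN0).ne'
    · exact ENNReal.rpow_ne_top_of_nonneg hl1.le hN0
    · refine h.trans (le_of_eq ?_)
      ring
  have h3 := ENNReal.rpow_le_rpow h2 (z := ((m : ℝ) / θ)⁻¹) (by positivity)
  rw [ENNReal.mul_rpow_of_nonneg _ _ (by positivity), ← ENNReal.rpow_mul, ← ENNReal.rpow_mul,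
    mul_inv_cancel₀ hl.ne', ENNReal.rpow_one, ENNReal.rpow_one] at h3
  exact h3

/-- On sets of small measure, the `L²` norm of a function in `H¹₀` is small compared to that of its
gradient. -/
theorem exists_eLpNorm_restrict_le_measure_rpow {m : ℕ} (hm : m ≠ 0) {Ω : Set (Euc m)}
    (hΩ : IsOpen Ω) (hΩf : volume Ω ≠ ⊤) :
    ∃ P : ℝ≥0, ∀ (u : Euc m → ℝ) (G : Euc m → Euc m) (A : Set (Euc m)), HasH10Grad Ω u G →
      NullMeasurableSet A (volume.restrict Ω) →
      eLpNorm (A.indicator u) 2 (volume.restrict Ω)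
        ≤ P * ((volume.restrict Ω) A ^ (1 / ((m : ℝ) + 2)) * eLpNorm G 2 (volume.restrict Ω)) := by
  have hm0 : 0 < (m : ℝ) := by exact_mod_cast Nat.pos_of_ne_zero hm
  set θ : ℝ := m + 2 with hθdef
  have hθ0 : 0 < θ := by positivity
  have hl : 0 < (m : ℝ) / θ := by positivity
  have hl1 : 0 < 1 - (m : ℝ) / θ := by
    rw [sub_pos, div_lt_one hθ0]; linarith
  obtain ⟨κ, hκ⟩ := exists_gagliardoNirenberg hm (θ := θ) (by linarith) (by linarith)
  obtain ⟨P, hP⟩ := exists_poincare hm hΩ hΩf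
  have : IsFiniteMeasure (volume.restrict Ω) := ⟨by simpa using hΩf.lt_top⟩
  refine ⟨κ * P ^ (1 - (m : ℝ) / θ), fun u G A hu hA => ?_⟩
  set μ := volume.restrict Ω
  have hθE : ENNReal.ofReal θ ≠ 0 := by simpa using hθ0
  -- The weight is now the indicator of A, and its L^θ norm with θ = m + 2 produces the small power
  -- of the measure of A.
  have h1 : MemLp (A.indicator fun _ : Euc m => (1 : ℝ)) ⊤ μ := by
    refine MemLp.of_bound ((aestronglyMeasurable_const).indicator₀ hA) 1 (ae_of_all _ fun x => ?_)
    by_cases hx : x ∈ A <;> simp [hx]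
  have h := hκ Ω hΩ hΩf ℝ (A.indicator fun _ => 1) u G h1 hu
  have e1 : (fun x => ‖(A.indicator fun _ : Euc m => (1 : ℝ)) x‖ * u x) = A.indicator u := by
    ext x
    by_cases hx : x ∈ A <;> simp [hx]
  rw [e1, eLpNorm_indicator_const₀ hA hθE ENNReal.ofReal_ne_top, ENNReal.toReal_ofReal hθ0.le] at h
  simp only [enorm_one, one_mul] at h
  refine h.trans ?_
  set N1 := eLpNorm G 2 μ
  have h2 : eLpNorm u 2 μ ^ (1 - (m : ℝ) / θ) * N1 ^ ((m : ℝ) / θ)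
      ≤ (P : ℝ≥0∞) ^ (1 - (m : ℝ) / θ) * N1 := by
    calc _ ≤ (P * N1) ^ (1 - (m : ℝ) / θ) * N1 ^ ((m : ℝ) / θ) := by
          gcongr
          exact hP u G hu
      _ = (P : ℝ≥0∞) ^ (1 - (m : ℝ) / θ) * (N1 ^ (1 - (m : ℝ) / θ) * N1 ^ ((m : ℝ) / θ)) := by
          rw [ENNReal.mul_rpow_of_nonneg _ _ hl1.le, mul_assoc]
      _ = _ := by
          rw [← ENNReal.rpow_add_of_nonneg _ _ hl1.le hl.le]
          simp
  calc _ ≤ κ * (μ A ^ (1 / θ) * ((P : ℝ≥0∞) ^ (1 - (m : ℝ) / θ) * N1)) := by gcongr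
    _ = _ := by
      rw [ENNReal.coe_mul, ENNReal.coe_rpow_of_nonneg _ hl1.le]
      ring

end Inequalities

set_option maxSynthPendingDepth 3

/-! ### Integrals of products of `L²` functions -/

section LTwoIntegral

variable {α : Type*} [MeasurableSpace α] {μ : Measure α}
  {E : Type*} [NormedAddCommGroup E]

theorem MeasureTheory.MemLp.toReal_eLpNorm_two_sq {f : α → E} (hf : MemLp f 2 μ) :
    (eLpNorm f 2 μ).toReal ^ 2 = ∫ x, ‖f x‖ ^ 2 ∂μ := by
  have h1 : ∫ x, ‖f x‖ ^ 2 ∂μ = (∫⁻ x, ‖f x‖ₑ ^ (2 : ℝ) ∂μ).toReal := by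
    rw [integral_eq_lintegral_of_nonneg_ae (f := fun x => ‖f x‖ ^ 2) (ae_of_all _ fun x => sq_nonneg _)
      (hf.norm.1.pow 2)]
    congr 2
    ext x
    rw [ENNReal.ofReal_pow (norm_nonneg _), ofReal_norm]
    norm_cast
  rw [h1, eLpNorm_two_eq_lintegral, ← ENNReal.toReal_pow, ← ENNReal.rpow_natCast,
    ← ENNReal.rpow_mul]
  norm_num

theorem abs_integral_mul_le {f g : α → ℝ} (hf : MemLp f 2 μ) (hg : MemLp g 2 μ) :
    |∫ x, f x * g x ∂μ| ≤ (eLpNorm f 2 μ).toReal * (eLpNorm g 2 μ).toReal := by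
  have h1 := eLpNorm_smul_le_mul_eLpNorm (p := 2) (q := 2) (r := 1) hg.1 hf.1
  have h2 : ‖∫ x, f x * g x ∂μ‖ₑ ≤ eLpNorm f 2 μ * eLpNorm g 2 μ :=
    (enorm_integral_le_lintegral_enorm _).trans ((eLpNorm_one_eq_lintegral_enorm).symm.le.trans h1)
  rw [← ENNReal.toReal_mul, ← Real.norm_eq_abs, ← toReal_enorm]
  exact ENNReal.toReal_mono (ENNReal.mul_ne_top hf.2.ne hg.2.ne) h2

end LTwoIntegral

/-! ### Jets and the bilinear form of the system -/

/-- The space of the values and gradients of `ℝⁿ`-valued functions at a point. -/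
def Jet (m n : ℕ) : Type := PiLp 2 fun _ : Fin n => WithLp 2 (ℝ × Euc m)

namespace Jet

variable {m n : ℕ}

instance : NormedAddCommGroup (Jet m n) :=
  inferInstanceAs (NormedAddCommGroup (PiLp 2 fun _ : Fin n => WithLp 2 (ℝ × Euc m)))

instance : InnerProductSpace ℝ (Jet m n) :=
  inferInstanceAs (InnerProductSpace ℝ (PiLp 2 fun _ : Fin n => WithLp 2 (ℝ × Euc m)))

instance : CompleteSpace (Jet m n) :=
  inferInstanceAs (CompleteSpace (PiLp 2 fun _ : Fin n => WithLp 2 (ℝ × Euc m)))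

/-- The `i`-th value, as a linear map. -/
def valₗ (i : Fin n) : Jet m n →ₗ[ℝ] ℝ :=
  ((WithLp.fstL 2 ℝ ℝ (Euc m)).comp (PiLp.proj 2 (fun _ : Fin n => WithLp 2 (ℝ × Euc m)) i) :
    (PiLp 2 fun _ : Fin n => WithLp 2 (ℝ × Euc m)) →ₗ[ℝ] ℝ)

/-- The `i`-th gradient, as a linear map. -/
def gradₗ (i : Fin n) : Jet m n →ₗ[ℝ] Euc m :=
  ((WithLp.sndL 2 ℝ ℝ (Euc m)).comp (PiLp.proj 2 (fun _ : Fin n => WithLp 2 (ℝ × Euc m)) i) :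
    (PiLp 2 fun _ : Fin n => WithLp 2 (ℝ × Euc m)) →ₗ[ℝ] Euc m)

theorem norm_sq_eq_sum (U : Jet m n) : ‖U‖ ^ 2 = ∑ i, (valₗ i U ^ 2 + ‖gradₗ i U‖ ^ 2) := by
  refine (PiLp.norm_sq_eq_of_L2 (fun _ : Fin n => WithLp 2 (ℝ × Euc m)) U).trans ?_
  refine Finset.sum_congr rfl fun i _ => ?_
  refine (WithLp.prod_norm_sq_eq_of_L2 _).trans ?_
  rw [Real.norm_eq_abs, sq_abs]
  rfl

theorem abs_valₗ_le (i : Fin n) (U : Jet m n) : |valₗ i U| ≤ ‖U‖ := by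
  refine abs_le_of_sq_le_sq ?_ (norm_nonneg _)
  rw [norm_sq_eq_sum]
  refine le_trans ?_ (Finset.single_le_sum (f := fun i => valₗ i U ^ 2 + ‖gradₗ i U‖ ^ 2)
    (fun i _ => by positivity) (Finset.mem_univ i))
  simp only [le_add_iff_nonneg_right]
  positivity

theorem norm_gradₗ_le (i : Fin n) (U : Jet m n) : ‖gradₗ i U‖ ≤ ‖U‖ := by
  refine le_of_sq_le_sq ?_ (norm_nonneg _)
  rw [norm_sq_eq_sum]
  refine le_trans ?_ (Finset.single_le_sum (f := fun i => valₗ i U ^ 2 + ‖gradₗ i U‖ ^ 2)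
    (fun i _ => by positivity) (Finset.mem_univ i))
  simp only [le_add_iff_nonneg_left]
  positivity

/-- The `i`-th value. -/
def val (i : Fin n) : Jet m n →L[ℝ] ℝ :=
  (valₗ i).mkContinuous 1 fun U => by simpa using abs_valₗ_le i U

/-- The `i`-th gradient. -/
def grad (i : Fin n) : Jet m n →L[ℝ] Euc m :=
  (gradₗ i).mkContinuous 1 fun U => by simpa using norm_gradₗ_le i U

/-- The `p`-th coordinate of the `i`-th gradient. -/
def partialDeriv (i : Fin n) (p : Fin m) : Jet m n →L[ℝ] ℝ :=
  (EuclideanSpace.proj p).comp (grad i)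

theorem partialDeriv_apply (i : Fin n) (p : Fin m) (U : Jet m n) :
    partialDeriv i p U = grad i U p := rfl

/-- The jet of a pair of functions. -/
def mk (u : Fin n → Euc m → ℝ) (G : Fin n → Euc m → Euc m) (x : Euc m) : Jet m n :=
  WithLp.toLp 2 fun i => WithLp.toLp 2 (u i x, G i x)

@[simp] theorem val_mk (u : Fin n → Euc m → ℝ) (G : Fin n → Euc m → Euc m) (x : Euc m)
    (i : Fin n) : val i (mk u G x) = u i x := rfl

@[simp] theorem grad_mk (u : Fin n → Euc m → ℝ) (G : Fin n → Euc m → Euc m) (x : Euc m)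
    (i : Fin n) : grad i (mk u G x) = G i x := rfl

theorem norm_sq (U : Jet m n) : ‖U‖ ^ 2 = ∑ i, (val i U ^ 2 + ‖grad i U‖ ^ 2) := norm_sq_eq_sum U

theorem ext {U V : Jet m n} (h : ∀ i, val i U = val i V) (h' : ∀ i, grad i U = grad i V) :
    U = V := by
  rw [← sub_eq_zero, ← norm_eq_zero, ← sq_eq_zero_iff, norm_sq]
  simp [h, h']

theorem norm_val_le (i : Fin n) : ‖(val i : Jet m n →L[ℝ] ℝ)‖ ≤ 1 :=
  ContinuousLinearMap.opNorm_le_bound _ zero_le_one fun U => by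
    rw [one_mul]
    exact abs_valₗ_le i U

theorem norm_partialDeriv_le (i : Fin n) (p : Fin m) :
    ‖(partialDeriv i p : Jet m n →L[ℝ] ℝ)‖ ≤ 1 :=
  ContinuousLinearMap.opNorm_le_bound _ zero_le_one fun U => by
    rw [one_mul]
    exact (PiLp.norm_apply_le (grad i U) p).trans (norm_gradₗ_le i U)

theorem memLp_mk {μ : Measure (Euc m)} {p : ℝ≥0∞} {u : Fin n → Euc m → ℝ}
    {G : Fin n → Euc m → Euc m} (hu : ∀ i, MemLp (u i) p μ) (hG : ∀ i, MemLp (G i) p μ) :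
    MemLp (mk u G) p μ :=
  (memLp_piLp_iff (E := fun _ : Fin n => WithLp 2 (ℝ × Euc m)) (f := mk u G)).2 fun i =>
    memLp_prodLp_iff.2 ⟨hu i, hG i⟩

end Jet

theorem norm_smulRight_le_one {E : Type*} [NormedAddCommGroup E] [NormedSpace ℝ E]
    {S T : E →L[ℝ] ℝ} (hS : ‖S‖ ≤ 1) (hT : ‖T‖ ≤ 1) : ‖S.smulRight T‖ ≤ 1 := by
  rw [ContinuousLinearMap.norm_smulRight_apply]
  exact mul_le_one₀ hS (norm_nonneg _) hT

namespace EllipticSystem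

variable {m n : ℕ} (S : EllipticSystem m n)

/-- The bilinear form of the system, acting on the jet of the solution and on the jet of the test
function. -/
def bilin (x : Euc m) : Jet m n →L[ℝ] Jet m n →L[ℝ] ℝ :=
  (∑ i, ∑ j, ∑ p, ∑ q, S.a i j p q x • (Jet.partialDeriv j p).smulRight (Jet.partialDeriv i q))
    + (∑ i, ∑ j, ∑ p, S.C i j x p • (Jet.partialDeriv j p).smulRight (Jet.val i))
    + ∑ i, ∑ j, S.D i x j • (Jet.val j).smulRight (Jet.val i)

theorem bilin_apply (x : Euc m) (U Φ : Jet m n) : S.bilin x U Φ =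
    (∑ i, ∑ j, ∑ p, ∑ q, S.a i j p q x * Jet.grad j U p * Jet.grad i Φ q)
    + (∑ i, ∑ j, inner ℝ (S.C i j x) (Jet.grad j U) * Jet.val i Φ)
    + ∑ i, (∑ j, S.D i x j * Jet.val j U) * Jet.val i Φ := by
  simp only [bilin, add_apply, sum_apply,
    smul_apply, ContinuousLinearMap.smulRight_apply, smul_eq_mul,
    Jet.partialDeriv_apply, PiLp.inner_apply, Finset.sum_mul, RCLike.inner_apply, conj_trivial]
  congr 1
  · congr 1
    · simp only [mul_assoc]
    · refine Finset.sum_congr rfl fun i _ => Finset.sum_congr rfl fun j _ =>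
        Finset.sum_congr rfl fun p _ => ?_
      ring
  · simp only [mul_assoc]

variable {S} {Ω : Set (Euc m)} {ρ : ℝ}

theorem StandingAssumptions.memLp_bilin (hS : S.StandingAssumptions Ω ρ) :
    MemLp S.bilin ⊤ (volume.restrict Ω) := by
  have hsm : ∀ {c : Euc m → ℝ} (T : Jet m n →L[ℝ] Jet m n →L[ℝ] ℝ),
      MemLp c ⊤ (volume.restrict Ω) → MemLp (fun x => c x • T) ⊤ (volume.restrict Ω) :=
    fun T hc => hc.continuousLinearMap_comp (ContinuousLinearMap.toSpanSingleton ℝ T)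
  have e : S.bilin = fun x => (∑ i, ∑ j, ∑ p, ∑ q,
      S.a i j p q x • (Jet.partialDeriv j p).smulRight (Jet.partialDeriv i q))
    + (∑ i, ∑ j, ∑ p, S.C i j x p • (Jet.partialDeriv j p).smulRight (Jet.val i))
    + ∑ i, ∑ j, S.D i x j • (Jet.val j).smulRight (Jet.val i) := rfl
  rw [e]
  refine ((memLp_finsetSum _ fun i _ => memLp_finsetSum _ fun j _ => memLp_finsetSum _ fun p _ =>
    memLp_finsetSum _ fun q _ => hsm _ (hS.a_mem i j p q)).add
    (memLp_finsetSum _ fun i _ => memLp_finsetSum _ fun j _ => memLp_finsetSum _ fun p _ =>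
      hsm _ (memLp_apply (hS.C_mem i j) p))).add
    (memLp_finsetSum _ fun i _ => memLp_finsetSum _ fun j _ => hsm _ (memLp_piLp_iff.1 (hS.D_mem i) j))

theorem norm_bilin_le {x : Euc m} {Λa ΛC ΛD : ℝ} (ha : ∀ i j p q, |S.a i j p q x| ≤ Λa)
    (hC : ∀ i j, ‖S.C i j x‖ ≤ ΛC) (hD : ∀ i, ‖S.D i x‖ ≤ ΛD) :
    ‖S.bilin x‖ ≤ n * (n * (m * (m * Λa))) + n * (n * (m * ΛC)) + n * (n * ΛD) := by
  have hsm : ∀ {c b : ℝ} {S T : Jet m n →L[ℝ] ℝ}, |c| ≤ b → ‖S‖ ≤ 1 → ‖T‖ ≤ 1 →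
      ‖c • S.smulRight T‖ ≤ b := by
    intro c b S T hc hS hT
    rw [norm_smul, Real.norm_eq_abs]
    exact (mul_le_of_le_one_right (abs_nonneg c) (norm_smulRight_le_one hS hT)).trans hc
  have hsum : ∀ {k : ℕ} {b : ℝ} (T : Fin k → Jet m n →L[ℝ] Jet m n →L[ℝ] ℝ), (∀ i, ‖T i‖ ≤ b) →
      ‖∑ i, T i‖ ≤ k * b := by
    intro k b T hT
    refine (norm_sum_le_of_le _ fun i _ => hT i).trans (le_of_eq ?_)
    simp
  refine (norm_add_le_of_le (norm_add_le_of_le ?_ ?_) ?_)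
  · exact hsum _ fun i => hsum _ fun j => hsum _ fun p => hsum _ fun q =>
      hsm (ha i j p q) (Jet.norm_partialDeriv_le j p) (Jet.norm_partialDeriv_le i q)
  · exact hsum _ fun i => hsum _ fun j => hsum _ fun p =>
      hsm ((PiLp.norm_apply_le (S.C i j x) p).trans (hC i j)) (Jet.norm_partialDeriv_le j p)
        (Jet.norm_val_le i)
  · exact hsum _ fun i => hsum _ fun j =>
      hsm ((PiLp.norm_apply_le (S.D i x) j).trans (hD i)) (Jet.norm_val_le j)
        (Jet.norm_val_le i)

/-- The bilinear form of the system on square integrable jets. -/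
def StandingAssumptions.form (hS : S.StandingAssumptions Ω ρ) :
    Lp (Jet m n) 2 (volume.restrict Ω) →L[ℝ] Lp (Jet m n) 2 (volume.restrict Ω) →L[ℝ] ℝ :=
  (ContinuousLinearMap.lpPairing (volume.restrict Ω) 2 2
    (ContinuousLinearMap.id ℝ (Jet m n →L[ℝ] ℝ))).comp
  ((ContinuousLinearMap.id ℝ (Jet m n →L[ℝ] Jet m n →L[ℝ] ℝ)).holderL (volume.restrict Ω) ⊤ 2 2
    hS.memLp_bilin.toLp)

theorem StandingAssumptions.form_apply (hS : S.StandingAssumptions Ω ρ)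
    (U Φ : Lp (Jet m n) 2 (volume.restrict Ω)) :
    hS.form U Φ = ∫ x in Ω, S.bilin x (U x) (Φ x) := by
  rw [form, ContinuousLinearMap.comp_apply, ContinuousLinearMap.lpPairing_eq_integral]
  refine integral_congr_ae ?_
  filter_upwards [ContinuousLinearMap.coeFn_holder (r := 2)
    (ContinuousLinearMap.id ℝ (Jet m n →L[ℝ] Jet m n →L[ℝ] ℝ)) hS.memLp_bilin.toLp U,
    hS.memLp_bilin.coeFn_toLp] with x hx hx'
  simp only [ContinuousLinearMap.holderL_apply_apply]
  rw [ContinuousLinearMap.coe_id', id, hx, hx']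
  rfl

theorem StandingAssumptions.integrable_bilin (hS : S.StandingAssumptions Ω ρ)
    {U Φ : Euc m → Jet m n} (hU : MemLp U 2 (volume.restrict Ω))
    (hΦ : MemLp Φ 2 (volume.restrict Ω)) :
    Integrable (fun x => S.bilin x (U x) (Φ x)) (volume.restrict Ω) := by
  have h1 := ContinuousLinearMap.memLp_of_bilin (r := 2)
    (ContinuousLinearMap.id ℝ (Jet m n →L[ℝ] Jet m n →L[ℝ] ℝ)) hS.memLp_bilin hU
  exact memLp_one_iff_integrable.1 (ContinuousLinearMap.memLp_of_bilin (r := 1)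
    (ContinuousLinearMap.id ℝ (Jet m n →L[ℝ] ℝ)) h1 hΦ)

end EllipticSystem

/-! ### Coercivity -/

/-- Young's inequality with the conjugate exponents 2/(1+l) and 2/(1-l), after multiplying and
dividing by r^{(1+l)/2}; the factors 1/p and 1/q are at most 1 and are dropped. For l = m/θ the
exponents of K and r are those of the zero-order condition. -/
theorem young_rpow {l K r X Y : ℝ} (hl : 0 < l) (hl1 : l < 1) (hK : 0 ≤ K) (hr : 0 < r)
    (hX : 0 ≤ X) (hY : 0 ≤ Y) :
    K * (X ^ (1 + l) * Y ^ (1 - l))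
      ≤ r * X ^ 2 + K ^ (2 / (1 - l)) * r ^ (-((1 + l) / (1 - l))) * Y ^ 2 := by
  have h1 : 0 < 1 - l := by linarith
  have h2 : 0 < 1 + l := by linarith
  set p : ℝ := 2 / (1 + l) with hp
  set q : ℝ := 2 / (1 - l) with hq
  have hp0 : 0 < p := by positivity
  have hp1 : 1 ≤ p := by rw [hp, le_div_iff₀ h2]; linarith
  have hq1 : 1 ≤ q := by rw [hq, le_div_iff₀ h1]; linarith
  have hpq : p.HolderConjugate q := by
    refine (Real.holderConjugate_iff).2 ⟨?_, ?_⟩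
    · rw [hp, lt_div_iff₀ h2]; linarith
    · rw [hp, hq]; field_simp; ring
  have hy := Real.young_inequality_of_nonneg (a := r ^ (1 / p) * X ^ (1 + l))
    (b := K * r ^ (-(1 / p)) * Y ^ (1 - l)) (by positivity) (by positivity) hpq
  have ea : (r ^ (1 / p) * X ^ (1 + l)) ^ p = r * X ^ 2 := by
    rw [Real.mul_rpow (by positivity) (by positivity), ← Real.rpow_mul hr.le, ← Real.rpow_mul hX,
      one_div_mul_cancel hp0.ne', Real.rpow_one, hp, mul_div_cancel₀ _ h2.ne', Real.rpow_two]
  have eb : (K * r ^ (-(1 / p)) * Y ^ (1 - l)) ^ q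
      = K ^ q * r ^ (-((1 + l) / (1 - l))) * Y ^ 2 := by
    rw [Real.mul_rpow (by positivity) (by positivity), Real.mul_rpow hK (by positivity),
      ← Real.rpow_mul hr.le, ← Real.rpow_mul hY]
    have e1 : -(1 / p) * q = -((1 + l) / (1 - l)) := by rw [hp, hq]; field_simp
    have e2 : (1 - l) * q = 2 := by rw [hq, mul_div_cancel₀ _ h1.ne']
    rw [e1, e2, Real.rpow_two]
  have el : r ^ (1 / p) * X ^ (1 + l) * (K * r ^ (-(1 / p)) * Y ^ (1 - l))
      = K * (X ^ (1 + l) * Y ^ (1 - l)) := by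
    have : r ^ (1 / p) * r ^ (-(1 / p)) = 1 := by
      rw [← Real.rpow_add hr, add_neg_cancel, Real.rpow_zero]
    linear_combination K * (X ^ (1 + l) * Y ^ (1 - l)) * this
  rw [el, ea, eb] at hy
  refine hy.trans (add_le_add ?_ ?_)
  · exact div_le_self (by positivity) hp1
  · exact div_le_self (by positivity) hq1

namespace EllipticSystem

variable {m n : ℕ} {S : EllipticSystem m n} {Ω : Set (Euc m)} {ρ : ℝ}

/-- The coefficient of `|μ|²` in the lower bound on the zero-order coefficients. -/
def zeroOrderBound (S : EllipticSystem m n) (Ω : Set (Euc m)) (ρ θ ν : ℝ) : ℝ :=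
  ν * ρ ^ ((m + θ) / (m - θ))
      * (∑ i, ∑ j, (eLpNorm (S.C i j) (ENNReal.ofReal θ) (volume.restrict Ω)).toReal)
          ^ (2 * θ / (θ - m))

theorem StandingAssumptions.le_bilin_self (hS : S.StandingAssumptions Ω ρ) {θ ν : ℝ}
    (hD : S.ZeroOrderCoercive Ω ρ θ ν) :
    ∀ᵐ x ∂(volume.restrict Ω), ∀ U : Jet m n,
      ρ * ∑ i, ‖Jet.grad i U‖ ^ 2 + (∑ i, ∑ j, inner ℝ (S.C i j x) (Jet.grad j U) * Jet.val i U)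
        + S.zeroOrderBound Ω ρ θ ν * ∑ i, Jet.val i U ^ 2 ≤ S.bilin x U U := by
  have hsymm : ∀ᵐ x ∂(volume.restrict Ω), ∀ i j p q, S.a i j p q x = S.a i j q p x := by
    simp only [ae_all_iff]; exact hS.a_symm
  filter_upwards [hS.elliptic, hD, hsymm] with x he hd hs U
  rw [bilin_apply]
  refine add_le_add (add_le_add ?_ le_rfl) ?_
  · have := he fun i p => Jet.grad i U p
    refine le_trans (le_of_eq ?_) (this.trans (le_of_eq ?_))
    · congr 1
      refine Finset.sum_congr rfl fun i _ => ?_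
      rw [EuclideanSpace.norm_sq_eq]
      simp
    · refine Finset.sum_congr rfl fun i _ => Finset.sum_congr rfl fun j _ => ?_
      rw [Finset.sum_comm]
      refine Finset.sum_congr rfl fun p _ => Finset.sum_congr rfl fun q _ => ?_
      -- The weak form pairs p with the gradient of y^j and q with that of φ^i, whereas ellipticity
      -- pairs p with i and q with j; the symmetry of a in p, q reconciles them.
      rw [hs i j q p]
      ring
  · have := hd (WithLp.toLp 2 fun i => Jet.val i U)
    rw [← zeroOrderBound] at this
    refine le_trans (le_of_eq ?_) (this.trans (le_of_eq ?_))
    · rw [EuclideanSpace.norm_sq_eq]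
      simp
    · refine Finset.sum_congr rfl fun i _ => ?_
      rw [PiLp.inner_apply]
      congr 1
      refine Finset.sum_congr rfl fun j _ => ?_
      simp [mul_comm]

/-- The zero-order terms control the first-order terms in `H¹₀`. -/
theorem exists_coercive (hm : m ≠ 0) {θ : ℝ} (hmθ : (m : ℝ) < θ) (hθ : 2 ≤ θ) :
    ∃ ν₀ : ℝ, 0 < ν₀ ∧ ∀ (S : EllipticSystem m n) (Ω : Set (Euc m)) (ρ ν : ℝ), IsOpen Ω →
      volume Ω ≠ ⊤ → 0 < ρ → ν₀ ≤ ν → S.StandingAssumptions Ω ρ → S.ZeroOrderCoercive Ω ρ θ ν →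
      ∀ (u : Fin n → Euc m → ℝ) (G : Fin n → Euc m → Euc m), (∀ i, HasH10Grad Ω (u i) (G i)) →
      ρ / 2 * ∑ i, ∫ x in Ω, ‖G i x‖ ^ 2 ≤ ∫ x in Ω, S.bilin x (Jet.mk u G x) (Jet.mk u G x) := by
  have hθ0 : 0 < θ := by linarith
  have hm0 : 0 < (m : ℝ) := by exact_mod_cast Nat.pos_of_ne_zero hm
  set l : ℝ := m / θ with hldef
  have hl : 0 < l := by positivity
  have hl1 : l < 1 := by rw [hldef, div_lt_one hθ0]; exact hmθ
  have hl1' : 0 < 1 - l := by linarith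
  have hmθ' : 0 < θ - m := by linarith
  have hmθ'' : (m : ℝ) - θ ≠ 0 := by linarith
  obtain ⟨κ, hκ⟩ := exists_gagliardoNirenberg hm hmθ hθ
  -- The power of κ comes from applying Young's inequality to κ Σ|C^{ij}|, the power of 2 from
  -- applying it at ρ/2 instead of ρ; adding 1 ensures positivity.
  refine ⟨κ ^ (2 * θ / (θ - m)) * 2 ^ ((m + θ) / (θ - m)) + 1, by positivity, ?_⟩
  intro S Ω ρ ν hΩ hΩf hρ hν hS hD u G hu
  have : IsFiniteMeasure (volume.restrict Ω) := ⟨by simpa using hΩf.lt_top⟩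
  set μ := volume.restrict Ω with hμ
  set a : Fin n → ℝ := fun i => (eLpNorm (u i) 2 μ).toReal with ha
  set b : Fin n → ℝ := fun i => (eLpNorm (G i) 2 μ).toReal with hb
  set c : Fin n → Fin n → ℝ := fun i j => (eLpNorm (S.C i j) (ENNReal.ofReal θ) μ).toReal with hc
  set X := √(∑ i, b i ^ 2) with hX
  set Y := √(∑ i, a i ^ 2) with hY
  have hX2 : X ^ 2 = ∑ i, b i ^ 2 := Real.sq_sqrt (by positivity)
  have hY2 : Y ^ 2 = ∑ i, a i ^ 2 := Real.sq_sqrt (by positivity)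
  have ha0 : ∀ i, 0 ≤ a i := fun i => ENNReal.toReal_nonneg
  have hb0 : ∀ i, 0 ≤ b i := fun i => ENNReal.toReal_nonneg
  have hc0 : ∀ i j, 0 ≤ c i j := fun i j => ENNReal.toReal_nonneg
  have haY : ∀ i, a i ≤ Y := fun i => Real.le_sqrt_of_sq_le
    (Finset.single_le_sum (f := fun i => a i ^ 2) (fun i _ => sq_nonneg _) (Finset.mem_univ i))
  have hbX : ∀ i, b i ≤ X := fun i => Real.le_sqrt_of_sq_le
    (Finset.single_le_sum (f := fun i => b i ^ 2) (fun i _ => sq_nonneg _) (Finset.mem_univ i))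
  have hCu : ∀ i j, MemLp (fun x => ‖S.C i j x‖ * u i x) 2 μ := fun i j => by
    have := (hu i).memLp.smul (p := ⊤) (q := 2) (r := 2) (hS.C_mem i j).norm
    exact this
  have hint : ∀ i j, Integrable (fun x => inner ℝ (S.C i j x) (G j x) * u i x) μ := by
    intro i j
    have hm : AEStronglyMeasurable (fun x => inner ℝ (S.C i j x) (G j x)) μ :=
      (hS.C_mem i j).1.inner (𝕜 := ℝ) (hu j).memLp_grad.1
    refine ((hCu i j).norm.integrable_fun_mul (hu j).memLp_grad.norm).mono
      (hm.mul (hu i).memLp.1) (ae_of_all _ fun x => ?_)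
    simp only [norm_mul, norm_norm]
    calc _ ≤ ‖S.C i j x‖ * ‖G j x‖ * ‖u i x‖ := by
          gcongr; exact norm_inner_le_norm (𝕜 := ℝ) _ _
      _ = _ := by ring
  have hterm : ∀ i j, -(κ * (X ^ (1 + l) * Y ^ (1 - l)) * c i j)
      ≤ ∫ x, inner ℝ (S.C i j x) (G j x) * u i x ∂μ := by
    intro i j
    have h1 : |∫ x, inner ℝ (S.C i j x) (G j x) * u i x ∂μ|
        ≤ ∫ x, ‖‖S.C i j x‖ * u i x‖ * ‖G j x‖ ∂μ := by
      rw [← Real.norm_eq_abs]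
      refine norm_integral_le_of_norm_le
        ((hCu i j).norm.integrable_fun_mul (hu j).memLp_grad.norm) (ae_of_all _ fun x => ?_)
      simp only [norm_mul, norm_norm]
      calc _ ≤ ‖S.C i j x‖ * ‖G j x‖ * ‖u i x‖ := by
            gcongr; exact norm_inner_le_norm (𝕜 := ℝ) _ _
        _ = _ := by ring
    have h2 := (le_abs_self _).trans (abs_integral_mul_le (hCu i j).norm (hu j).memLp_grad.norm)
    rw [eLpNorm_norm, eLpNorm_norm] at h2
    have h3 : (eLpNorm (fun x => ‖S.C i j x‖ * u i x) 2 μ).toReal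
        ≤ κ * (c i j * (a i ^ (1 - l) * b i ^ l)) := by
      have h4 := hκ Ω hΩ hΩf (Euc m) (S.C i j) (u i) (G i) (hS.C_mem i j) (hu i)
      have hfin : (κ : ℝ≥0∞) * (eLpNorm (S.C i j) (ENNReal.ofReal θ) μ
          * (eLpNorm (u i) 2 μ ^ (1 - m / θ) * eLpNorm (G i) 2 μ ^ (m / θ))) ≠ ⊤ := by
        refine ENNReal.mul_ne_top ENNReal.coe_ne_top (ENNReal.mul_ne_top
          ((hS.C_mem i j).mono_exponent le_top).2.ne (ENNReal.mul_ne_top ?_ ?_))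
        · exact ENNReal.rpow_ne_top_of_nonneg hl1'.le (hu i).memLp.2.ne
        · exact ENNReal.rpow_ne_top_of_nonneg hl.le (hu i).memLp_grad.2.ne
      refine (ENNReal.toReal_mono hfin h4).trans (le_of_eq ?_)
      simp only [ENNReal.toReal_mul, ENNReal.coe_toReal, ← ENNReal.toReal_rpow]
      rfl
    -- The norms of the individual components are bounded by the full norms X and Y, so that the sum
    -- over i, j of the |C^{ij}| factors out.
    have h5 : a i ^ (1 - l) * b i ^ l * b j ≤ X ^ (1 + l) * Y ^ (1 - l) := by
      calc a i ^ (1 - l) * b i ^ l * b j ≤ Y ^ (1 - l) * X ^ l * X := by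
            gcongr
            · exact haY i
            · exact hbX i
            · exact hbX j
        _ = _ := by
          rw [add_comm 1 l, Real.rpow_add_one' (Real.sqrt_nonneg _) (by positivity)]
          ring
    have h6 : (eLpNorm (fun x => ‖S.C i j x‖ * u i x) 2 μ).toReal * b j
        ≤ κ * (X ^ (1 + l) * Y ^ (1 - l)) * c i j :=
      calc _ ≤ κ * (c i j * (a i ^ (1 - l) * b i ^ l)) * b j :=
            mul_le_mul_of_nonneg_right h3 (hb0 j)
        _ = κ * c i j * (a i ^ (1 - l) * b i ^ l * b j) := by ring
        _ ≤ κ * c i j * (X ^ (1 + l) * Y ^ (1 - l)) :=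
            mul_le_mul_of_nonneg_left h5 (mul_nonneg κ.coe_nonneg (hc0 i j))
        _ = _ := by ring
    exact (abs_le.1 (h1.trans (h2.trans h6))).1
  have hsum : -(κ * (∑ i, ∑ j, c i j) * (X ^ (1 + l) * Y ^ (1 - l)))
      ≤ ∑ i, ∑ j, ∫ x, inner ℝ (S.C i j x) (G j x) * u i x ∂μ := by
    refine le_trans (le_of_eq ?_) (Finset.sum_le_sum fun i _ => Finset.sum_le_sum fun j _ =>
      hterm i j)
    simp only [Finset.sum_neg_distrib, ← Finset.mul_sum]
    ring
  set Z := ∑ i, ∑ j, c i j with hZ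
  have hZ0 : 0 ≤ Z := Finset.sum_nonneg fun i _ => Finset.sum_nonneg fun j _ => hc0 i j
  -- Half of the ellipticity absorbs the gradient part; the rest is a multiple of Y² that the
  -- zero-order terms cover by `hN`.
  have hyoung := young_rpow hl hl1 (mul_nonneg κ.coe_nonneg hZ0) (half_pos hρ)
    (Real.sqrt_nonneg (∑ i, b i ^ 2)) (Real.sqrt_nonneg (∑ i, a i ^ 2))
  rw [← hX, ← hY] at hyoung
  have he1 : 2 / (1 - l) = 2 * θ / (θ - m) := by
    rw [hldef]; field_simp
  have he2 : (1 + l) / (1 - l) = (m + θ) / (θ - m) := by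
    rw [hldef]; field_simp; ring
  have he3 : (m + θ) / (m - θ) = -((m + θ) / (θ - m)) := by
    rw [← neg_sub, div_neg]
  have hN : ((κ : ℝ) * Z) ^ (2 / (1 - l)) * (ρ / 2) ^ (-((1 + l) / (1 - l)))
      ≤ S.zeroOrderBound Ω ρ θ ν := by
    rw [he1, he2, zeroOrderBound, he3, Real.mul_rpow κ.coe_nonneg hZ0,
      Real.div_rpow hρ.le zero_le_two, Real.rpow_neg zero_le_two, div_inv_eq_mul]
    calc _ = (κ ^ (2 * θ / (θ - m)) * 2 ^ ((m + θ) / (θ - m)))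
          * ρ ^ (-((m + θ) / (θ - m))) * Z ^ (2 * θ / (θ - m)) := by ring
      _ ≤ _ := by
        gcongr
        linarith
  have hJ : MemLp (Jet.mk u G) 2 μ :=
    Jet.memLp_mk (fun i => (hu i).memLp) (fun i => (hu i).memLp_grad)
  have hbi : ∀ i, Integrable (fun x => ‖G i x‖ ^ 2) μ := fun i => (hu i).memLp_grad.norm.integrable_sq
  have hai : ∀ i, Integrable (fun x => u i x ^ 2) μ := fun i => (hu i).memLp.integrable_sq
  have i1 : Integrable (fun x => ρ * ∑ i, ‖G i x‖ ^ 2) μ :=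
    (integrable_finsetSum _ fun i _ => hbi i).const_mul ρ
  have i2 : Integrable (fun x => ∑ i, ∑ j, inner ℝ (S.C i j x) (G j x) * u i x) μ :=
    integrable_finsetSum _ fun i _ => integrable_finsetSum _ fun j _ => hint i j
  have i3 : Integrable (fun x => S.zeroOrderBound Ω ρ θ ν * ∑ i, u i x ^ 2) μ :=
    (integrable_finsetSum _ fun i _ => hai i).const_mul _
  have i12 : Integrable (fun x => ρ * ∑ i, ‖G i x‖ ^ 2
      + ∑ i, ∑ j, inner ℝ (S.C i j x) (G j x) * u i x) μ := i1.add i2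
  have hmono : ∫ x, ((ρ * ∑ i, ‖G i x‖ ^ 2)
      + (∑ i, ∑ j, inner ℝ (S.C i j x) (G j x) * u i x)
      + S.zeroOrderBound Ω ρ θ ν * ∑ i, u i x ^ 2) ∂μ
      ≤ ∫ x, S.bilin x (Jet.mk u G x) (Jet.mk u G x) ∂μ := by
    refine integral_mono_ae (i12.add i3) (hS.integrable_bilin hJ hJ) ?_
    filter_upwards [hS.le_bilin_self hD] with x hx
    exact hx (Jet.mk u G x)
  have e1 : ∑ i, ∫ x, ‖G i x‖ ^ 2 ∂μ = X ^ 2 := by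
    rw [hX2]
    exact Finset.sum_congr rfl fun i _ => ((hu i).memLp_grad.toReal_eLpNorm_two_sq).symm
  have e2 : ∑ i, ∫ x, u i x ^ 2 ∂μ = Y ^ 2 := by
    rw [hY2]
    refine Finset.sum_congr rfl fun i _ => ?_
    have := ((hu i).memLp.toReal_eLpNorm_two_sq).symm
    simpa using this
  rw [integral_add i12 i3, integral_add i1 i2, integral_const_mul, integral_const_mul,
    integral_finsetSum _ fun i _ => hbi i, integral_finsetSum _ fun i _ => hai i,
    integral_finsetSum _ fun i _ => integrable_finsetSum _ fun j _ => hint i j, e1, e2] at hmono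
  have e3 : ∑ i, ∫ x, ∑ j, inner ℝ (S.C i j x) (G j x) * u i x ∂μ
      = ∑ i, ∑ j, ∫ x, inner ℝ (S.C i j x) (G j x) * u i x ∂μ :=
    Finset.sum_congr rfl fun i _ => integral_finsetSum _ fun j _ => hint i j
  rw [e3] at hmono
  rw [e1]
  nlinarith [mul_le_mul_of_nonneg_right hN (sq_nonneg Y)]

end EllipticSystem

/-! ### The weak formulation in terms of jets -/

namespace EllipticSystem

variable {m n : ℕ} {S : EllipticSystem m n} {Ω : Set (Euc m)} {ρ : ℝ}

theorem _root_.MeasureTheory.MemLp.integrable_bdd_mul_mul {α : Type*} [MeasurableSpace α]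
    {μ : Measure α} {c f g : α → ℝ} (hc : MemLp c ⊤ μ) (hf : MemLp f 2 μ) (hg : MemLp g 2 μ) :
    Integrable (fun x => c x * f x * g x) μ := by
  have h : MemLp (fun x => c x * f x) 2 μ := hf.smul (p := ⊤) (q := 2) (r := 2) hc
  exact h.integrable_fun_mul hg

/-- Bounded coefficients make each summand integrable, so the sum of integrals can be collected into
a single integral of the bilinear form on jets, with any weak gradients in place of `weakGrad`. -/
theorem StandingAssumptions.weak_lhs_eq (hS : S.StandingAssumptions Ω ρ) (hΩ : IsOpen Ω)
    {y φ : Euc m → Euc n} {Y Φ : Fin n → Euc m → Euc m}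
    (hy : ∀ i, HasH1Grad Ω (fun x => y x i) (Y i))
    (hφ : ∀ i, HasH1Grad Ω (fun x => φ x i) (Φ i)) :
    (∑ i, ∑ j, ∑ p, ∑ q, ∫ x in Ω,
        S.a i j p q x * weakGrad Ω (fun z => y z j) x p * weakGrad Ω (fun z => φ z i) x q)
      + (∫ x in Ω, ∑ i, ((∑ j, inner ℝ (S.C i j x) (weakGrad Ω (fun z => y z j) x) * φ x i)
          + inner ℝ (S.D i x) (y x) * φ x i))
      = ∫ x in Ω, S.bilin x (Jet.mk (fun i x => y x i) Y x) (Jet.mk (fun i x => φ x i) Φ x) := by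
  have wy : ∀ᵐ x ∂(volume.restrict Ω), ∀ i, weakGrad Ω (fun z => y z i) x = Y i x :=
    ae_all_iff.2 fun i => (hy i).weakGrad_ae_eq hΩ
  have wφ : ∀ᵐ x ∂(volume.restrict Ω), ∀ i, weakGrad Ω (fun z => φ z i) x = Φ i x :=
    ae_all_iff.2 fun i => (hφ i).weakGrad_ae_eq hΩ
  have i1 : ∀ i j p q, Integrable (fun x => S.a i j p q x * Y j x p * Φ i x q)
      (volume.restrict Ω) := fun i j p q =>
    (hS.a_mem i j p q).integrable_bdd_mul_mul (memLp_apply (hy j).memLp_grad p)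
      (memLp_apply (hφ i).memLp_grad q)
  have i2 : Integrable (fun x => ∑ i, ∑ j, ∑ p, ∑ q, S.a i j p q x * Y j x p * Φ i x q)
      (volume.restrict Ω) :=
    integrable_finsetSum _ fun i _ => integrable_finsetSum _ fun j _ =>
      integrable_finsetSum _ fun p _ => integrable_finsetSum _ fun q _ => i1 i j p q
  have e1 : (∑ i, ∑ j, ∑ p, ∑ q, ∫ x in Ω,
      S.a i j p q x * weakGrad Ω (fun z => y z j) x p * weakGrad Ω (fun z => φ z i) x q)
      = ∫ x in Ω, ∑ i, ∑ j, ∑ p, ∑ q, S.a i j p q x * Y j x p * Φ i x q := by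
    rw [integral_finsetSum _ fun i _ => integrable_finsetSum _ fun j _ =>
      integrable_finsetSum _ fun p _ => integrable_finsetSum _ fun q _ => i1 i j p q]
    refine Finset.sum_congr rfl fun i _ => ?_
    rw [integral_finsetSum _ fun j _ =>
      integrable_finsetSum _ fun p _ => integrable_finsetSum _ fun q _ => i1 i j p q]
    refine Finset.sum_congr rfl fun j _ => ?_
    rw [integral_finsetSum _ fun p _ => integrable_finsetSum _ fun q _ => i1 i j p q]
    refine Finset.sum_congr rfl fun p _ => ?_
    rw [integral_finsetSum _ fun q _ => i1 i j p q]
    refine Finset.sum_congr rfl fun q _ => integral_congr_ae ?_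
    filter_upwards [wy, wφ] with x h1 h2
    rw [h1, h2]
  have iB := hS.integrable_bilin
    (Jet.memLp_mk (fun i => (hy i).memLp) fun i => (hy i).memLp_grad)
    (Jet.memLp_mk (fun i => (hφ i).memLp) fun i => (hφ i).memLp_grad)
  have e2 : (∫ x in Ω, ∑ i, ((∑ j, inner ℝ (S.C i j x) (weakGrad Ω (fun z => y z j) x) * φ x i)
          + inner ℝ (S.D i x) (y x) * φ x i))
      = ∫ x in Ω, (S.bilin x (Jet.mk (fun i x => y x i) Y x) (Jet.mk (fun i x => φ x i) Φ x)
        - ∑ i, ∑ j, ∑ p, ∑ q, S.a i j p q x * Y j x p * Φ i x q) := by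
    refine integral_congr_ae ?_
    filter_upwards [wy] with x h1
    rw [bilin_apply]
    simp only [h1, Jet.val_mk, Jet.grad_mk, Finset.sum_add_distrib]
    have : ∀ i, inner ℝ (S.D i x) (y x) = ∑ j, S.D i x j * y x j := fun i => by
      rw [PiLp.inner_apply]
      exact Finset.sum_congr rfl fun j _ => by simp [mul_comm]
    simp only [this]
    ring
  rw [e1, e2, integral_sub iB i2]
  ring

theorem StandingAssumptions.integral_eq (hS : S.StandingAssumptions Ω ρ) (hΩ : IsOpen Ω)
    {y : Euc m → Euc n} (hy : S.IsWeakSolution Ω y) {Y : Fin n → Euc m → Euc m}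
    (hY : ∀ i, HasH1Grad Ω (fun x => y x i) (Y i)) {φ : Fin n → Euc m → ℝ}
    {Φ : Fin n → Euc m → Euc m} (hφ : ∀ i, HasH10Grad Ω (φ i) (Φ i)) :
    ∫ x in Ω, S.bilin x (Jet.mk (fun i x => y x i) Y x) (Jet.mk φ Φ x)
      = ∫ x in Ω, ∑ i, S.f x i * φ i x := by
  have := hy.weak_eq (fun x => WithLp.toLp 2 fun i => φ i x) fun i => (hφ i).memH10 hΩ
  rw [hS.weak_lhs_eq hΩ hY (φ := fun x => WithLp.toLp 2 fun i => φ i x)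
    (Φ := Φ) fun i => (hφ i).hasH1Grad] at this
  exact this

theorem StandingAssumptions.isWeakSolution_of (hS : S.StandingAssumptions Ω ρ) (hΩ : IsOpen Ω)
    {y : Euc m → Euc n} {Y : Fin n → Euc m → Euc m}
    (hY : ∀ i, HasH1Grad Ω (fun x => y x i) (Y i)) (hb : ∀ i, MemH10 Ω (fun x => y x i - S.g x i))
    (hw : ∀ (φ : Fin n → Euc m → ℝ) (Φ : Fin n → Euc m → Euc m),
      (∀ i, HasH10Grad Ω (φ i) (Φ i)) →
      ∫ x in Ω, S.bilin x (Jet.mk (fun i x => y x i) Y x) (Jet.mk φ Φ x)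
        = ∫ x in Ω, ∑ i, S.f x i * φ i x) : S.IsWeakSolution Ω y where
  memH1 i := (hY i).memW1
  boundary := hb
  weak_eq φ hφ := by
    rw [hS.weak_lhs_eq hΩ hY fun i => ((hφ i).hasH10Grad hΩ).hasH1Grad]
    exact hw _ _ fun i => (hφ i).hasH10Grad hΩ

/-! ### The Poincaré inequality for jets, and a priori bounds -/

theorem _root_.Jet.integral_norm_sq {μ : Measure (Euc m)} {u : Fin n → Euc m → ℝ}
    {G : Fin n → Euc m → Euc m} (hu : ∀ i, MemLp (u i) 2 μ) (hG : ∀ i, MemLp (G i) 2 μ) :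
    ∫ x, ‖Jet.mk u G x‖ ^ 2 ∂μ = ∑ i, (∫ x, u i x ^ 2 ∂μ + ∫ x, ‖G i x‖ ^ 2 ∂μ) := by
  simp only [Jet.norm_sq, Jet.val_mk, Jet.grad_mk]
  have h : ∀ i, Integrable (fun x => u i x ^ 2 + ‖G i x‖ ^ 2) μ := fun i =>
    (hu i).integrable_sq.add (hG i).norm.integrable_sq
  rw [integral_finsetSum _ fun i _ => h i]
  exact Finset.sum_congr rfl fun i _ =>
    integral_add (hu i).integrable_sq (hG i).norm.integrable_sq

theorem _root_.Jet.exists_poincare (hm : m ≠ 0) (hΩ : IsOpen Ω) (hΩf : volume Ω ≠ ⊤) :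
    ∃ P : ℝ, 0 < P ∧ ∀ (u : Fin n → Euc m → ℝ) (G : Fin n → Euc m → Euc m),
      (∀ i, HasH10Grad Ω (u i) (G i)) →
      ∫ x in Ω, ‖Jet.mk u G x‖ ^ 2 ≤ P * ∑ i, ∫ x in Ω, ‖G i x‖ ^ 2 := by
  obtain ⟨P, hP⟩ := _root_.exists_poincare hm hΩ hΩf
  refine ⟨(P : ℝ) ^ 2 + 1, by positivity, fun u G hu => ?_⟩
  rw [Jet.integral_norm_sq (fun i => (hu i).memLp) fun i => (hu i).memLp_grad, Finset.mul_sum]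
  refine Finset.sum_le_sum fun i _ => ?_
  rw [add_mul, one_mul]
  refine add_le_add ?_ le_rfl
  have h1 := (hu i).memLp.toReal_eLpNorm_two_sq
  simp only [Real.norm_eq_abs, sq_abs] at h1
  rw [← h1, ← (hu i).memLp_grad.toReal_eLpNorm_two_sq, ← mul_pow]
  refine pow_le_pow_left₀ ENNReal.toReal_nonneg ?_ 2
  have := ENNReal.toReal_mono (ENNReal.mul_ne_top ENNReal.coe_ne_top (hu i).memLp_grad.2.ne)
    (hP (u i) (G i) (hu i))
  rwa [ENNReal.toReal_mul, ENNReal.coe_toReal] at this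

theorem _root_.abs_integral_le_of_abs_le {α E F : Type*} [MeasurableSpace α] {μ : Measure α}
    [NormedAddCommGroup E] [NormedAddCommGroup F] {b : α → ℝ} {f : α → E} {g : α → F} {M : ℝ}
    (hM : 0 ≤ M) (hf : MemLp f 2 μ) (hg : MemLp g 2 μ)
    (hb : ∀ᵐ x ∂μ, |b x| ≤ M * ‖f x‖ * ‖g x‖) :
    |∫ x, b x ∂μ| ≤ M * (eLpNorm f 2 μ).toReal * (eLpNorm g 2 μ).toReal := by
  have h1 : |∫ x, b x ∂μ| ≤ ∫ x, M * (‖f x‖ * ‖g x‖) ∂μ := by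
    rw [← Real.norm_eq_abs]
    refine norm_integral_le_of_norm_le ((hf.norm.integrable_fun_mul hg.norm).const_mul M) ?_
    filter_upwards [hb] with x hx
    rw [Real.norm_eq_abs]
    linarith
  refine h1.trans ?_
  rw [integral_const_mul, mul_assoc]
  refine mul_le_mul_of_nonneg_left ?_ hM
  have h2 := (le_abs_self _).trans (abs_integral_mul_le hf.norm hg.norm)
  rwa [eLpNorm_norm, eLpNorm_norm] at h2

theorem h1Norm_eq {g : Euc m → Euc n} (hg : ∀ i, MemW1 Ω 2 (fun x => g x i)) (hΩ : IsOpen Ω) :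
    (eLpNorm (Jet.mk (fun i x => g x i) fun i => weakGrad Ω fun x => g x i) 2
      (volume.restrict Ω)).toReal = (h1Norm Ω g).toReal := by
  have h := fun i => (hg i).hasH1Grad hΩ
  have hfin : ∀ i, eLpNorm (fun x => g x i) 2 (volume.restrict Ω) ^ 2
      + eLpNorm (weakGrad Ω (fun x => g x i)) 2 (volume.restrict Ω) ^ 2 ≠ ⊤ := fun i =>
    ENNReal.add_ne_top.2 ⟨ENNReal.pow_ne_top (h i).memLp.2.ne,
      ENNReal.pow_ne_top (h i).memLp_grad.2.ne⟩
  rw [h1Norm, ← ENNReal.toReal_rpow, ← Real.sqrt_eq_rpow]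
  refine (Real.sqrt_eq_iff_eq_sq ENNReal.toReal_nonneg ENNReal.toReal_nonneg).2 ?_ |>.symm
  rw [(Jet.memLp_mk (fun i => (h i).memLp) fun i => (h i).memLp_grad).toReal_eLpNorm_two_sq,
    Jet.integral_norm_sq (fun i => (h i).memLp) fun i => (h i).memLp_grad,
    ENNReal.toReal_sum fun i _ => hfin i]
  refine Finset.sum_congr rfl fun i _ => ?_
  rw [ENNReal.toReal_add (ENNReal.pow_ne_top (h i).memLp.2.ne)
    (ENNReal.pow_ne_top (h i).memLp_grad.2.ne), ENNReal.toReal_pow, ENNReal.toReal_pow,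
    (h i).memLp.toReal_eLpNorm_two_sq, (h i).memLp_grad.toReal_eLpNorm_two_sq]
  simp

end EllipticSystem

/-! ### Existence and uniqueness -/

/-- The Lax–Milgram theorem. -/
theorem IsCoercive.exists_eq {V : Type*} [NormedAddCommGroup V] [InnerProductSpace ℝ V]
    [CompleteSpace V] {B : V →L[ℝ] V →L[ℝ] ℝ} (hB : IsCoercive B) (ℓ : V →L[ℝ] ℝ) :
    ∃ u, ∀ v, B u v = ℓ v := by
  refine ⟨hB.continuousLinearEquivOfBilin.symm ((InnerProductSpace.toDual ℝ V).symm ℓ),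
    fun v => ?_⟩
  rw [← hB.continuousLinearEquivOfBilin_apply, ContinuousLinearEquiv.apply_symm_apply,
    InnerProductSpace.toDual_symm_apply]

namespace EllipticSystem

variable {m n : ℕ} {S : EllipticSystem m n} {Ω : Set (Euc m)} {ρ : ℝ}

/-- The jets of the elements of `H¹₀(Ω; ℝⁿ)`. -/
def h10Jets (n : ℕ) (Ω : Set (Euc m)) : Submodule ℝ (Lp (Jet m n) 2 (volume.restrict Ω)) where
  carrier := {U | ∀ i, HasH10Grad Ω (fun x => Jet.val i (U x)) (fun x => Jet.grad i (U x))}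
  add_mem' {U V} hU hV i := by
    refine ((hU i).add (hV i)).congr ?_ ?_
    all_goals
      filter_upwards [Lp.coeFn_add U V] with x hx
      simp only [hx, Pi.add_apply, map_add]
  zero_mem' i := by
    refine HasH10Grad.zero.congr ?_ ?_
    all_goals
      filter_upwards [Lp.coeFn_zero (Jet m n) 2 (volume.restrict Ω)] with x hx
      simp only [hx, Pi.zero_apply, map_zero]
  smul_mem' c U hU i := by
    refine ((hU i).const_mul c).congr ?_ ?_
    all_goals
      filter_upwards [Lp.coeFn_smul c U] with x hx
      simp only [hx, Pi.smul_apply, map_smul, smul_eq_mul]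

theorem mem_h10Jets {U : Lp (Jet m n) 2 (volume.restrict Ω)} : U ∈ h10Jets n Ω ↔
    ∀ i, HasH10Grad Ω (fun x => Jet.val i (U x)) (fun x => Jet.grad i (U x)) := Iff.rfl

/-- Taking a component of a jet does not increase the norm, so L² convergence of jets is
simultaneous convergence of values and gradients. Closedness gives the completeness that Lax–Milgram
needs. -/
theorem isClosed_h10Jets : IsClosed (h10Jets n Ω : Set (Lp (Jet m n) 2 (volume.restrict Ω))) := by
  refine IsSeqClosed.isClosed fun U V hU hUV i => ?_
  have hlim := (Lp.tendsto_Lp_iff_tendsto_eLpNorm' U V).1 hUV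
  have hlim' : Tendsto (fun k => eLpNorm (fun x => U k x - V x) 2 (volume.restrict Ω)) atTop
      (𝓝 0) := hlim
  refine HasH10Grad.of_tendsto (fun k => hU k i) ((Lp.memLp V).continuousLinearMap_comp _)
    ((Lp.memLp V).continuousLinearMap_comp _) ?_ ?_
  · refine ENNReal.tendsto_zero_of_le hlim' fun k => eLpNorm_mono fun x => ?_
    rw [← map_sub]
    exact Jet.abs_valₗ_le i _
  · refine ENNReal.tendsto_zero_of_le hlim' fun k => eLpNorm_mono fun x => ?_
    rw [← map_sub]
    exact Jet.norm_gradₗ_le i _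

instance : CompleteSpace (h10Jets n Ω) := isClosed_h10Jets.completeSpace_coe

theorem _root_.Jet.mk_val_grad (U : Euc m → Jet m n) (x : Euc m) :
    Jet.mk (fun i x => Jet.val i (U x)) (fun i x => Jet.grad i (U x)) x = U x :=
  Jet.ext (fun _ => rfl) fun _ => rfl

theorem toLp_mem_h10Jets {u : Fin n → Euc m → ℝ} {G : Fin n → Euc m → Euc m}
    (hu : ∀ i, HasH10Grad Ω (u i) (G i)) :
    (Jet.memLp_mk (fun i => (hu i).memLp) fun i => (hu i).memLp_grad).toLp ∈ h10Jets n Ω := by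
  intro i
  refine (hu i).congr ?_ ?_
  all_goals
    filter_upwards [(Jet.memLp_mk (fun i => (hu i).memLp) fun i => (hu i).memLp_grad).coeFn_toLp]
      with x hx
    simp [hx]

theorem _root_.Jet.norm_toLp_sq (U : Lp (Jet m n) 2 (volume.restrict Ω)) :
    ‖U‖ ^ 2 = ∫ x in Ω, ‖U x‖ ^ 2 := by
  rw [Lp.norm_def, (Lp.memLp U).toReal_eLpNorm_two_sq]

/-- The right-hand side of the system as a functional on jets. -/
def load (S : EllipticSystem m n) (x : Euc m) : Jet m n →L[ℝ] ℝ := ∑ i, S.f x i • Jet.val i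

theorem load_apply (x : Euc m) (U : Jet m n) : S.load x U = ∑ i, S.f x i * Jet.val i U := by
  simp [load]

theorem StandingAssumptions.memLp_load (hS : S.StandingAssumptions Ω ρ) :
    MemLp S.load ⊤ (volume.restrict Ω) := by
  have e : S.load = fun x => ∑ i, S.f x i • (Jet.val i : Jet m n →L[ℝ] ℝ) := rfl
  rw [e]
  exact memLp_finsetSum _ fun i _ => (memLp_piLp_iff.1 hS.f_mem i).continuousLinearMap_comp
    (ContinuousLinearMap.toSpanSingleton ℝ (Jet.val i : Jet m n →L[ℝ] ℝ))

/-- Subtracting g reduces the problem to a variational equation on the Hilbert space of jets of H¹₀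
functions, where Lax–Milgram applies. -/
theorem StandingAssumptions.exists_isWeakSolution (hS : S.StandingAssumptions Ω ρ) (hm : m ≠ 0)
    (hΩ : IsOpen Ω) (hΩf : volume Ω ≠ ⊤) (hρ : 0 < ρ)
    (hB : ∀ (u : Fin n → Euc m → ℝ) (G : Fin n → Euc m → Euc m),
      (∀ i, HasH10Grad Ω (u i) (G i)) →
      ρ / 2 * ∑ i, ∫ x in Ω, ‖G i x‖ ^ 2 ≤ ∫ x in Ω, S.bilin x (Jet.mk u G x) (Jet.mk u G x)) :
    ∃ y, S.IsWeakSolution Ω y := by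
  have : IsFiniteMeasure (volume.restrict Ω) := ⟨by simpa using hΩf.lt_top⟩
  obtain ⟨P, hP0, hP⟩ := Jet.exists_poincare (n := n) hm hΩ hΩf
  set B := hS.form.bilinearComp (h10Jets n Ω).subtypeL (h10Jets n Ω).subtypeL with hBdef
  have hcoer : IsCoercive B := by
    -- Coercivity is known for the gradients only; the Poincaré constant P converts it to the full
    -- norm.
    refine ⟨ρ / 2 / P, by positivity, fun U => ?_⟩
    have h1 := hB _ _ (mem_h10Jets.1 U.2)
    have h2 := hP _ _ (mem_h10Jets.1 U.2)
    simp only [Jet.mk_val_grad] at h1 h2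
    rw [← Jet.norm_toLp_sq] at h2
    have h3 : B U U = hS.form U U := rfl
    rw [h3, hS.form_apply]
    refine le_trans ?_ h1
    rw [mul_assoc, ← pow_two, div_mul_eq_mul_div, div_le_iff₀ hP0, mul_assoc]
    refine mul_le_mul_of_nonneg_left ?_ (by positivity)
    rw [mul_comm]
    exact h2
  have hg := fun i => (hS.g_mem i).hasH1Grad hΩ
  have hgL : MemLp (Jet.mk (fun i x => S.g x i) fun i => weakGrad Ω fun x => S.g x i) 2
      (volume.restrict Ω) := Jet.memLp_mk (fun i => (hg i).memLp) fun i => (hg i).memLp_grad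
  have hl2 : MemLp S.load 2 (volume.restrict Ω) := hS.memLp_load.mono_exponent le_top
  -- The functional for the unknown y - g: the load minus the form evaluated at g.
  set ℓ : h10Jets n Ω →L[ℝ] ℝ := ((ContinuousLinearMap.lpPairing (volume.restrict Ω) 2 2
    (ContinuousLinearMap.id ℝ (Jet m n →L[ℝ] ℝ))) hl2.toLp - hS.form hgL.toLp).comp
      (h10Jets n Ω).subtypeL with hℓ
  obtain ⟨⟨u, hu2⟩, hu⟩ := hcoer.exists_eq ℓ
  have hu1 : ∀ φ : h10Jets n Ω, hS.form u φ = ℓ φ := hu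
  have hu2 := mem_h10Jets.1 hu2
  refine ⟨fun x => WithLp.toLp 2 fun i => S.g x i + Jet.val i (u x),
    hS.isWeakSolution_of hΩ (Y := fun i x => weakGrad Ω (fun x => S.g x i) x
      + Jet.grad i (u x))
      (fun i => (hg i).add (hu2 i).hasH1Grad) (fun i => ?_) fun φ Φ hφ => ?_⟩
  · have : (fun x => S.g x i + Jet.val i (u x) - S.g x i)
        = fun x => Jet.val i (u x) := by
      ext x; ring
    change MemH10 Ω (fun x => S.g x i + Jet.val i (u x)
      - S.g x i)
    rw [this]
    exact (hu2 i).memH10 hΩ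
  · have hφL := Jet.memLp_mk (fun i => (hφ i).memLp) fun i => (hφ i).memLp_grad
    have h1 := hu1 ⟨hφL.toLp, toLp_mem_h10Jets hφ⟩
    have h2 : ℓ ⟨hφL.toLp, toLp_mem_h10Jets hφ⟩ = (ContinuousLinearMap.lpPairing (volume.restrict Ω)
      2 2 (ContinuousLinearMap.id ℝ (Jet m n →L[ℝ] ℝ))) hl2.toLp hφL.toLp
        - hS.form hgL.toLp hφL.toLp := rfl
    rw [h2, eq_sub_iff_add_eq, ← add_apply, ← map_add, hS.form_apply,
      ContinuousLinearMap.lpPairing_eq_integral] at h1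
    refine Eq.trans (integral_congr_ae ?_) (h1.trans (integral_congr_ae ?_))
    · filter_upwards [Lp.coeFn_add u hgL.toLp,
        hgL.coeFn_toLp, hφL.coeFn_toLp] with x e1 e2 e3
      have : (hφL.toLp : Euc m → Jet m n) x = Jet.mk φ Φ x := e3
      simp only [this]
      rw [e1, Pi.add_apply, e2]
      congr 2
      refine Jet.ext (fun i => ?_) fun i => ?_
      · simp [add_comm]
      · simp [add_comm]
    · filter_upwards [hl2.coeFn_toLp, hφL.coeFn_toLp] with x e2 e3
      rw [e2, e3]
      simp [load_apply]

theorem StandingAssumptions.hasH10Grad_sub (hS : S.StandingAssumptions Ω ρ)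
    (hΩ : IsOpen Ω) {y : Euc m → Euc n} (hy : S.IsWeakSolution Ω y) (i : Fin n) :
    HasH10Grad Ω (fun x => y x i - S.g x i)
      (fun x => weakGrad Ω (fun z => y z i) x - weakGrad Ω (fun z => S.g z i) x) :=
  ((hy.boundary i).hasH10Grad hΩ).of_hasH1Grad hΩ
    (((hy.memH1 i).hasH1Grad hΩ).sub ((hS.g_mem i).hasH1Grad hΩ))

theorem StandingAssumptions.isWeakSolution_unique (hS : S.StandingAssumptions Ω ρ) (hm : m ≠ 0)
    (hΩ : IsOpen Ω) (hΩf : volume Ω ≠ ⊤) (hρ : 0 < ρ)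
    (hB : ∀ (u : Fin n → Euc m → ℝ) (G : Fin n → Euc m → Euc m),
      (∀ i, HasH10Grad Ω (u i) (G i)) →
      ρ / 2 * ∑ i, ∫ x in Ω, ‖G i x‖ ^ 2 ≤ ∫ x in Ω, S.bilin x (Jet.mk u G x) (Jet.mk u G x))
    {y z : Euc m → Euc n} (hy : S.IsWeakSolution Ω y) (hz : S.IsWeakSolution Ω z) :
    z =ᵐ[volume.restrict Ω] y := by
  obtain ⟨P, hP0, hP⟩ := Jet.exists_poincare (n := n) hm hΩ hΩf
  have hY := fun i => (hy.memH1 i).hasH1Grad hΩ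
  have hZ := fun i => (hz.memH1 i).hasH1Grad hΩ
  set Y := fun i => weakGrad Ω fun x => y x i
  set Z := fun i => weakGrad Ω fun x => z x i
  -- Both solutions differ from g by H¹₀ functions, so their difference is a test function, on which
  -- the form must vanish.
  have hd : ∀ i, HasH10Grad Ω (fun x => z x i - y x i) (fun x => Z i x - Y i x) := by
    intro i
    refine (((hS.hasH10Grad_sub hΩ hz i).add ((hS.hasH10Grad_sub hΩ hy i).const_mul (-1)))).congr
      (ae_of_all _ fun x => ?_) (ae_of_all _ fun x => ?_)
    · simp only; ring
    · simp only [neg_smul, one_smul, Z, Y]; abel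
  have e1 := hS.integral_eq hΩ hy hY hd
  have e2 := hS.integral_eq hΩ hz hZ hd
  have hYL := Jet.memLp_mk (fun i => (hY i).memLp) fun i => (hY i).memLp_grad
  have hZL := Jet.memLp_mk (fun i => (hZ i).memLp) fun i => (hZ i).memLp_grad
  have hdL := Jet.memLp_mk (fun i => (hd i).memLp) fun i => (hd i).memLp_grad
  have e3 : ∫ x in Ω, S.bilin x (Jet.mk (fun i x => z x i - y x i) (fun i x => Z i x - Y i x) x)
      (Jet.mk (fun i x => z x i - y x i) (fun i x => Z i x - Y i x) x) = 0 := by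
    have h := integral_sub (hS.integrable_bilin hZL hdL) (hS.integrable_bilin hYL hdL)
    rw [e1, e2, sub_self] at h
    rw [← h]
    refine integral_congr_ae (ae_of_all _ fun x => ?_)
    simp only
    rw [← sub_apply, ← map_sub]
    rfl
  have h1 := hB _ _ hd
  rw [e3] at h1
  have h2 := hP _ _ hd
  have h3 : ∑ i, ∫ x in Ω, ‖Z i x - Y i x‖ ^ 2 ≤ 0 := by
    by_contra! h
    linarith [mul_pos (half_pos hρ) h]
  have h4 : ∫ x in Ω, ‖Jet.mk (fun i x => z x i - y x i) (fun i x => Z i x - Y i x) x‖ ^ 2 = 0 :=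
    le_antisymm (h2.trans (mul_nonpos_of_nonneg_of_nonpos hP0.le h3))
      (integral_nonneg fun x => sq_nonneg _)
  rw [integral_eq_zero_iff_of_nonneg (fun x => sq_nonneg _) hdL.norm.integrable_sq] at h4
  filter_upwards [h4] with x hx
  have h5 : Jet.mk (fun i x => z x i - y x i) (fun i x => Z i x - Y i x) x = 0 := by
    simpa using hx
  ext i
  have h6 := congrArg (Jet.val i) h5
  simp only [Jet.val_mk, map_zero] at h6
  linarith

end EllipticSystem

/-! ### The energy bound -/

theorem ae_norm_le_of_eLpNorm_top_le {α E : Type*} [MeasurableSpace α] {μ : Measure α}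
    [NormedAddCommGroup E] {f : α → E} {c : ℝ≥0} (h : eLpNorm f ⊤ μ ≤ c) :
    ∀ᵐ x ∂μ, ‖f x‖ ≤ c := by
  rw [eLpNorm_exponent_top] at h
  filter_upwards [enorm_ae_le_eLpNormEssSup f μ] with x hx
  have := hx.trans h
  rwa [enorm_le_coe] at this

namespace EllipticSystem

variable {m n : ℕ} {S : EllipticSystem m n} {Ω : Set (Euc m)} {ρ : ℝ}

theorem abs_bilin_le {x : Euc m} {M : ℝ} (h : ‖S.bilin x‖ ≤ M) (U V : Jet m n) :
    |S.bilin x U V| ≤ M * ‖U‖ * ‖V‖ :=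
  ((S.bilin x).le_opNorm₂ U V).trans (by gcongr)

theorem ae_norm_bilin_le {Λa ΛC ΛD : ℝ≥0}
    (ha : ∀ i j p q, eLpNorm (S.a i j p q) ⊤ (volume.restrict Ω) ≤ Λa)
    (hC : ∀ i j, eLpNorm (S.C i j) ⊤ (volume.restrict Ω) ≤ ΛC)
    (hD : ∀ i, eLpNorm (S.D i) ⊤ (volume.restrict Ω) ≤ ΛD) :
    ∀ᵐ x ∂(volume.restrict Ω), ‖S.bilin x‖
      ≤ n * (n * (m * (m * Λa))) + n * (n * (m * ΛC)) + n * (n * ΛD) := by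
  have ha' : ∀ᵐ x ∂(volume.restrict Ω), ∀ i j p q, |S.a i j p q x| ≤ Λa := by
    simp only [ae_all_iff]
    exact fun i j p q => ae_norm_le_of_eLpNorm_top_le (ha i j p q)
  have hC' : ∀ᵐ x ∂(volume.restrict Ω), ∀ i j, ‖S.C i j x‖ ≤ ΛC := by
    simp only [ae_all_iff]
    exact fun i j => ae_norm_le_of_eLpNorm_top_le (hC i j)
  have hD' : ∀ᵐ x ∂(volume.restrict Ω), ∀ i, ‖S.D i x‖ ≤ ΛD := by
    simp only [ae_all_iff]
    exact fun i => ae_norm_le_of_eLpNorm_top_le (hD i)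
  filter_upwards [ha', hC', hD'] with x h1 h2 h3
  exact norm_bilin_le h1 h2 h3

theorem abs_load_le {x : Euc m} {M : ℝ} (h : ‖S.f x‖ ≤ M) (U : Jet m n) :
    |S.load x U| ≤ n * M * ‖U‖ := by
  rw [load_apply]
  have : ∀ i ∈ Finset.univ, |S.f x i * Jet.val i U| ≤ M * ‖U‖ := fun i _ => by
    rw [abs_mul]
    have h1 := (PiLp.norm_apply_le (S.f x) i).trans h
    have h0 : 0 ≤ M := (norm_nonneg _).trans h
    exact mul_le_mul h1 (Jet.abs_valₗ_le i U) (abs_nonneg _) h0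
  refine (Finset.abs_sum_le_sum_abs _ _).trans ((Finset.sum_le_sum this).trans (le_of_eq ?_))
  simp [mul_assoc]

/-- The `L²` norm of the weak solution is bounded by the data. -/
theorem exists_integral_norm_sq_le (hm : m ≠ 0) (hΩ : IsOpen Ω) (hΩf : volume Ω ≠ ⊤)
    (hρ : 0 < ρ) (Λa ΛC ΛD Λg Λf : ℝ≥0) :
    ∃ K : ℝ, 0 ≤ K ∧ ∀ S : EllipticSystem m n, S.StandingAssumptions Ω ρ →
      (∀ (u : Fin n → Euc m → ℝ) (G : Fin n → Euc m → Euc m),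
        (∀ i, HasH10Grad Ω (u i) (G i)) →
        ρ / 2 * ∑ i, ∫ x in Ω, ‖G i x‖ ^ 2
          ≤ ∫ x in Ω, S.bilin x (Jet.mk u G x) (Jet.mk u G x)) →
      (∀ i j p q, eLpNorm (S.a i j p q) ⊤ (volume.restrict Ω) ≤ Λa) →
      (∀ i j, eLpNorm (S.C i j) ⊤ (volume.restrict Ω) ≤ ΛC) →
      (∀ i, eLpNorm (S.D i) ⊤ (volume.restrict Ω) ≤ ΛD) →
      h1Norm Ω S.g ≤ Λg → eLpNorm S.f ⊤ (volume.restrict Ω) ≤ Λf →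
      ∀ y, S.IsWeakSolution Ω y → ∫ x in Ω, ‖y x‖ ^ 2 ≤ K := by
  have : IsFiniteMeasure (volume.restrict Ω) := ⟨by simpa using hΩf.lt_top⟩
  obtain ⟨P, hP0, hP⟩ := Jet.exists_poincare (n := n) hm hΩ hΩf
  set μ := volume.restrict Ω with hμ
  set Mb : ℝ := n * (n * (m * (m * Λa))) + n * (n * (m * ΛC)) + n * (n * ΛD) with hMb
  set o : ℝ := (eLpNorm (fun _ : Euc m => (1 : ℝ)) 2 μ).toReal with ho
  have ho0 : 0 ≤ o := ENNReal.toReal_nonneg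
  have hMb0 : 0 ≤ Mb := by positivity
  set L : ℝ := n * Λf * o + Mb * Λg with hL
  have hL0 : 0 ≤ L := by positivity
  -- With U the jet of y - g, testing with y - g gives (ρ/2)|∇(y-g)|² ≤ L‖U‖, hence ‖U‖² ≤
  -- P(2/ρ)L‖U‖; one power is divided out and the norm of g added.
  refine ⟨(P * (2 / ρ * L) + Λg) ^ 2, by positivity, ?_⟩
  intro S hS hB ha hC hD hg hf y hy
  have hb := ae_norm_bilin_le ha hC hD
  have hf' := ae_norm_le_of_eLpNorm_top_le hf
  have hY := fun i => (hy.memH1 i).hasH1Grad hΩ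
  have hG := fun i => (hS.g_mem i).hasH1Grad hΩ
  have hd := hS.hasH10Grad_sub hΩ hy
  set Y := Jet.mk (fun i x => y x i) fun i => weakGrad Ω fun x => y x i
  set Γ := Jet.mk (fun i x => S.g x i) fun i => weakGrad Ω fun x => S.g x i with hΓ
  set U := Jet.mk (fun i x => y x i - S.g x i)
    (fun i x => weakGrad Ω (fun z => y z i) x - weakGrad Ω (fun z => S.g z i) x) with hU
  have hYL : MemLp Y 2 μ := Jet.memLp_mk (fun i => (hY i).memLp) fun i => (hY i).memLp_grad
  have hΓL : MemLp Γ 2 μ := Jet.memLp_mk (fun i => (hG i).memLp) fun i => (hG i).memLp_grad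
  have hUL : MemLp U 2 μ := Jet.memLp_mk (fun i => (hd i).memLp) fun i => (hd i).memLp_grad
  have hYU : ∀ x, Y x = U x + Γ x := fun x =>
    Jet.ext (fun i => by simp [Y, U, Γ]) fun i => by simp [Y, U, Γ]
  set NU := (eLpNorm U 2 μ).toReal with hNU
  have hNU0 : 0 ≤ NU := ENNReal.toReal_nonneg
  have hΓn : (eLpNorm Γ 2 μ).toReal ≤ Λg := by
    rw [h1Norm_eq hS.g_mem hΩ]
    have := ENNReal.toReal_mono ENNReal.coe_ne_top hg
    rwa [ENNReal.coe_toReal] at this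
  have e1 : ∫ x, S.bilin x (Y x) (U x) ∂μ = ∫ x, S.load x (U x) ∂μ := by
    refine (hS.integral_eq hΩ hy hY hd).trans (integral_congr_ae (ae_of_all _ fun x => ?_))
    simp only [load_apply]
    rfl
  have e2 : ∫ x, S.bilin x (Y x) (U x) ∂μ
      = ∫ x, S.bilin x (U x) (U x) ∂μ + ∫ x, S.bilin x (Γ x) (U x) ∂μ := by
    rw [← integral_add (hS.integrable_bilin hUL hUL) (hS.integrable_bilin hΓL hUL)]
    refine integral_congr_ae (ae_of_all _ fun x => ?_)
    simp only [hYU, map_add, add_apply]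
  have b1 : |∫ x, S.bilin x (Γ x) (U x) ∂μ| ≤ Mb * (eLpNorm Γ 2 μ).toReal * NU :=
    abs_integral_le_of_abs_le hMb0 hΓL hUL (hb.mono fun x hx => abs_bilin_le hx _ _)
  have b2 : |∫ x, S.load x (U x) ∂μ| ≤ n * Λf * o * NU := by
    refine abs_integral_le_of_abs_le (f := fun _ : Euc m => (1 : ℝ)) (by positivity)
      (memLp_const 1) hUL (hf'.mono fun x hx => ?_)
    simpa using abs_load_le hx (U x)
  have b3 : Mb * (eLpNorm Γ 2 μ).toReal * NU ≤ Mb * Λg * NU := by gcongr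
  have h1 := hB _ _ hd
  have h2 := hP _ _ hd
  change ∫ x, ‖U x‖ ^ 2 ∂μ ≤ _ at h2
  change _ ≤ ∫ x, S.bilin x (U x) (U x) ∂μ at h1
  rw [← hUL.toReal_eLpNorm_two_sq, ← hNU] at h2
  set X := ∑ i, ∫ x in Ω, ‖weakGrad Ω (fun z => y z i) x - weakGrad Ω (fun z => S.g z i) x‖ ^ 2
  have h3 : ρ / 2 * X ≤ L * NU := by
    have := (abs_le.1 b1).1
    have := (abs_le.1 b2).2
    rw [hL]
    linarith
  have h4 : X ≤ 2 / ρ * L * NU := by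
    have : X = 2 / ρ * (ρ / 2 * X) := by field_simp
    rw [this, mul_assoc]
    exact mul_le_mul_of_nonneg_left h3 (by positivity)
  have h5 : NU ≤ P * (2 / ρ * L) := by
    by_contra! hcon
    have h6 : NU ^ 2 ≤ P * (2 / ρ * L) * NU := h2.trans (by
      rw [mul_assoc]; exact mul_le_mul_of_nonneg_left h4 hP0.le)
    have : 0 < NU := lt_of_le_of_lt (by positivity) hcon
    nlinarith
  have h6 : (eLpNorm Y 2 μ).toReal ≤ NU + (eLpNorm Γ 2 μ).toReal := by
    rw [← ENNReal.toReal_add hUL.2.ne hΓL.2.ne]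
    refine ENNReal.toReal_mono (ENNReal.add_ne_top.2 ⟨hUL.2.ne, hΓL.2.ne⟩) ?_
    have : Y = U + Γ := funext hYU
    rw [this]
    exact eLpNorm_add_le hUL.1 hΓL.1 (by norm_num)
  have h7 : ∫ x, ‖y x‖ ^ 2 ∂μ ≤ (eLpNorm Y 2 μ).toReal ^ 2 := by
    rw [hYL.toReal_eLpNorm_two_sq]
    refine integral_mono_of_nonneg (ae_of_all _ fun x => sq_nonneg _) hYL.norm.integrable_sq
      (ae_of_all _ fun x => ?_)
    simp only
    rw [EuclideanSpace.norm_sq_eq, Jet.norm_sq]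
    refine Finset.sum_le_sum fun i _ => ?_
    simp [Y]
  exact h7.trans (pow_le_pow_left₀ ENNReal.toReal_nonneg (h6.trans (add_le_add h5 hΓn)) 2)

end EllipticSystem

/-! ### A smooth truncation -/

theorem hasDerivAt_posPart_sq (x : ℝ) :
    HasDerivAt (fun x : ℝ => max x 0 ^ 2) (2 * max x 0) x := by
  rcases lt_trichotomy x 0 with hx | hx | hx
  · have h : (fun x : ℝ => max x 0 ^ 2) =ᶠ[𝓝 x] fun _ => 0 := by
      filter_upwards [gt_mem_nhds hx] with z hz
      rw [max_eq_right (le_of_lt hz)]; norm_num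
    rw [max_eq_right hx.le, mul_zero]
    exact (hasDerivAt_const x (0 : ℝ)).congr_of_eventuallyEq h
  · subst hx
    rw [max_self, mul_zero, hasDerivAt_iff_isLittleO]
    have h : (fun x' : ℝ => max x' 0 ^ 2 - max 0 0 ^ 2 - (x' - 0) • (0 : ℝ))
        =O[𝓝 0] fun x' : ℝ => x' ^ 2 := by
      refine Asymptotics.IsBigO.of_bound 1 (Eventually.of_forall fun z => ?_)
      simp only [max_self, smul_zero, sub_zero, Real.norm_eq_abs, one_mul]
      norm_num
      rcases le_total z 0 with hz | hz
      · rw [max_eq_right hz]; norm_num; positivity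
      · rw [max_eq_left hz]
    refine h.trans_isLittleO ?_
    have := Asymptotics.isLittleO_pow_id (𝕜 := ℝ) (n := 2) (by norm_num)
    simpa using this
  · have h : (fun x : ℝ => max x 0 ^ 2) =ᶠ[𝓝 x] fun z => z ^ 2 := by
      filter_upwards [lt_mem_nhds hx] with z hz
      rw [max_eq_left (le_of_lt hz)]
    rw [max_eq_left hx.le]
    have h2 := hasDerivAt_pow 2 x
    simp only [Nat.cast_ofNat, Nat.add_one_sub_one, pow_one] at h2
    exact h2.congr_of_eventuallyEq h

/-- A `C¹` cut-off function, vanishing on `(-∞, s]` and increasing to `1` at infinity. -/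
def cutoff (s W : ℝ) : ℝ := max (W - s) 0 ^ 2 / (max (W - s) 0 ^ 2 + s ^ 2)

/-- The derivative of the cut-off function. -/
def cutoffDeriv (s W : ℝ) : ℝ :=
  2 * max (W - s) 0 * s ^ 2 / (max (W - s) 0 ^ 2 + s ^ 2) ^ 2

section Cutoff

variable {s : ℝ}

theorem hasDerivAt_cutoff (hs : 0 < s) (W : ℝ) : HasDerivAt (cutoff s) (cutoffDeriv s W) W := by
  have h1 : HasDerivAt (fun W => max (W - s) 0 ^ 2) (2 * max (W - s) 0) W :=
    (hasDerivAt_posPart_sq (W - s)).comp_sub_const W s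
  have h2 := h1.div (h1.add_const (s ^ 2)) (by positivity)
  refine h2.congr_deriv ?_
  rw [cutoffDeriv]
  congr 1
  ring

theorem continuous_cutoffDeriv (hs : 0 < s) : Continuous (cutoffDeriv s) := by
  unfold cutoffDeriv
  refine Continuous.div (by fun_prop) (by fun_prop) fun W => ?_
  positivity

theorem contDiff_cutoff (hs : 0 < s) : ContDiff ℝ 1 (cutoff s) := by
  refine contDiff_one_iff_deriv.2 ⟨fun W => (hasDerivAt_cutoff hs W).differentiableAt, ?_⟩
  rw [show deriv (cutoff s) = cutoffDeriv s from funext fun W => (hasDerivAt_cutoff hs W).deriv]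
  exact continuous_cutoffDeriv hs

theorem cutoff_nonneg (s W : ℝ) : 0 ≤ cutoff s W := by
  unfold cutoff; positivity

theorem cutoff_le_one (s W : ℝ) : cutoff s W ≤ 1 := by
  unfold cutoff
  exact div_le_one_of_le₀ (by linarith [sq_nonneg s]) (by positivity)

theorem cutoffDeriv_nonneg (s W : ℝ) : 0 ≤ cutoffDeriv s W := by
  unfold cutoffDeriv; positivity

theorem cutoff_eq_zero {W : ℝ} (h : W ≤ s) : cutoff s W = 0 := by
  simp [cutoff, max_eq_right (sub_nonpos.2 h)]

theorem cutoffDeriv_eq_zero {W : ℝ} (h : W ≤ s) : cutoffDeriv s W = 0 := by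
  simp [cutoffDeriv, max_eq_right (sub_nonpos.2 h)]

/-- With W = s + t and t ≥ 0 this is ts²(t+s) ≤ (t²+s²)². Scaling the cut-off by the level s makes
the bound independent of s. It tames the terms ψ' y^k ∇W, whose growth in y would otherwise be too
fast. -/
theorem cutoffDeriv_mul_le (hs : 0 < s) (W : ℝ) : cutoffDeriv s W * W ≤ 2 := by
  rcases le_total W s with h | h
  · rw [cutoffDeriv_eq_zero h]; norm_num
  · unfold cutoffDeriv
    rw [max_eq_left (sub_nonneg.2 h), div_mul_eq_mul_div, div_le_iff₀ (by positivity)]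
    obtain ⟨t, rfl⟩ : ∃ t, W = t + s := ⟨W - s, by ring⟩
    have ht : 0 ≤ t := by linarith
    rw [add_sub_cancel_right]
    nlinarith [sq_nonneg (t - s), sq_nonneg (t ^ 2), mul_nonneg (sq_nonneg s) (sq_nonneg (t - s)),
      sq_nonneg (t * s), sq_nonneg (s ^ 2)]

theorem cutoff_mono (hs : 0 < s) {W W' : ℝ} (h : W ≤ W') : cutoff s W ≤ cutoff s W' := by
  unfold cutoff
  rw [div_le_div_iff₀ (by positivity) (by positivity)]
  have h1 : max (W - s) 0 ^ 2 ≤ max (W' - s) 0 ^ 2 := by gcongr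
  nlinarith [mul_le_mul_of_nonneg_right h1 (sq_nonneg s)]

end Cutoff

/-! ### The algebraic structure of the system -/

/-- The quadratic form `∑ F_{pq} u_p v_q`. -/
def quadForm {m : ℕ} (F : Fin m → Fin m → ℝ) (u v : Euc m) : ℝ := ∑ p, ∑ q, F p q * u p * v q

section Algebra

variable {m n : ℕ}

theorem abs_quadForm_le {F : Fin m → Fin m → ℝ} {M : ℝ} (hF : ∀ p q, |F p q| ≤ M) (u v : Euc m) :
    |quadForm F u v| ≤ m * (m * M) * ‖u‖ * ‖v‖ := by
  have h : ∀ p q, |F p q * u p * v q| ≤ M * ‖u‖ * ‖v‖ := fun p q => by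
    rw [abs_mul, abs_mul]
    have h0 : 0 ≤ M := (abs_nonneg _).trans (hF p q)
    gcongr
    · exact hF p q
    · exact PiLp.norm_apply_le u p
    · exact PiLp.norm_apply_le v q
  refine (Finset.abs_sum_le_sum_abs _ _).trans ((Finset.sum_le_sum fun p _ =>
    (Finset.abs_sum_le_sum_abs _ _).trans (Finset.sum_le_sum fun q _ => h p q)).trans
      (le_of_eq ?_))
  simp
  ring

theorem quadForm_add_right (F : Fin m → Fin m → ℝ) (u v w : Euc m) :
    quadForm F u (v + w) = quadForm F u v + quadForm F u w := by
  simp only [quadForm, PiLp.add_apply, mul_add, Finset.sum_add_distrib]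

theorem quadForm_smul_right (F : Fin m → Fin m → ℝ) (c : ℝ) (u v : Euc m) :
    quadForm F u (c • v) = c * quadForm F u v := by
  simp only [quadForm, PiLp.smul_apply, smul_eq_mul, Finset.mul_sum]
  exact Finset.sum_congr rfl fun p _ => Finset.sum_congr rfl fun q _ => by ring

theorem quadForm_sub_left (F : Fin m → Fin m → ℝ) (u v w : Euc m) :
    quadForm F (u - v) w = quadForm F u w - quadForm F v w := by
  simp only [quadForm, PiLp.sub_apply, mul_sub, sub_mul, Finset.sum_sub_distrib]

theorem quadForm_smul_left (F : Fin m → Fin m → ℝ) (c : ℝ) (u v : Euc m) :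
    quadForm F (c • u) v = c * quadForm F u v := by
  simp only [quadForm, PiLp.smul_apply, smul_eq_mul, Finset.mul_sum]
  exact Finset.sum_congr rfl fun p _ => Finset.sum_congr rfl fun q _ => by ring

theorem quadForm_sum_left {ι : Type*} (t : Finset ι) (F : Fin m → Fin m → ℝ) (u : ι → Euc m)
    (v : Euc m) : quadForm F (∑ i ∈ t, u i) v = ∑ i ∈ t, quadForm F (u i) v := by
  classical
  induction t using Finset.induction_on with
  | empty => simp [quadForm]
  | insert a t ha ih =>
    rw [Finset.sum_insert ha, Finset.sum_insert ha, ← ih]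
    simp only [quadForm, PiLp.add_apply, mul_add, add_mul, Finset.sum_add_distrib]

namespace EllipticSystem

/-- The E^{ik} are built from cofactors, and a matrix times its adjugate is its determinant times
the identity: summing over i leaves h^{jk}f_{pq}. This is the only use of the cofactor structure and
of nonzero determinants, and it turns E into a multiplier diagonalising the coupling up to the
symmetric matrix h. -/
theorem HypothesisH.sum_a_mul_E [NeZero n] {S : EllipticSystem m n} {Ω : Set (Euc m)}
    {ρ₁ ρ₂ ρ₃ : ℝ} {h E : Fin n → Fin n → Euc m → ℝ} {w : Fin m → Fin m → Euc m → ℝ}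
    (hH : S.HypothesisH Ω ρ₁ ρ₂ ρ₃ h w E)
    (hL : ∀ p q, ∀ᵐ x ∂(volume.restrict Ω), S.Lpq p q x ≠ 0) :
    ∀ᵐ x ∂(volume.restrict Ω), ∀ j k p q,
      ∑ i, S.a i j p q x * E i k x = h j k x * S.Fpq E p q x := by
  have hE : ∀ᵐ x ∂(volume.restrict Ω), ∀ i j p q,
      E i j x = w p q x / S.Lpq p q x * ∑ l, h l j x * S.cof l i p q x := by
    simp only [ae_all_iff]; exact hH.E_eq
  have hL' : ∀ᵐ x ∂(volume.restrict Ω), ∀ p q, S.Lpq p q x ≠ 0 := by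
    simp only [ae_all_iff]; exact hL
  filter_upwards [hE, hL', hH.h_one] with x h1 h2 h3 j k p q
  have key : ∀ j k, ∑ i, S.a i j p q x * E i k x = h j k x * w p q x := by
    intro j k
    have hM : S.Mpq p q x * (S.Mpq p q x).adjugate = (S.Lpq p q x) • 1 := Matrix.mul_adjugate _
    have e1 : ∑ i, S.a i j p q x * E i k x
        = w p q x / S.Lpq p q x * ∑ l, h l k x * (S.Mpq p q x * (S.Mpq p q x).adjugate) j l := by
      simp only [Matrix.mul_apply, Finset.mul_sum]
      rw [Finset.sum_comm]
      refine Finset.sum_congr rfl fun i _ => ?_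
      rw [h1 i k p q]
      simp only [Finset.mul_sum]
      refine Finset.sum_congr rfl fun l _ => ?_
      simp only [cof, Mpq, Matrix.of_apply]
      ring
    rw [e1, hM]
    simp only [Matrix.smul_apply, Matrix.one_apply, smul_eq_mul, mul_ite, mul_one, mul_zero,
      Finset.sum_ite_eq, Finset.mem_univ, if_true]
    field_simp [h2 p q]
  -- The first diagonal entry together with the normalisation h^{11} = 1 identifies the unknown
  -- factor.
  have hF : S.Fpq E p q x = w p q x := by
    rw [Fpq, key 0 0, h3, one_mul]
  rw [key, hF]

end EllipticSystem

end Algebra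

/-! ### The truncated solution: pointwise estimates -/

section Truncation

variable {m n : ℕ}

/-- The quadratic form `W = ∑ h^{ij} y^i y^j`. -/
def quadVal (H : Fin n → Fin n → ℝ) (y : Fin n → ℝ) : ℝ := ∑ i, ∑ j, H i j * y i * y j

/-- The gradient of `W`. -/
def quadGrad (H : Fin n → Fin n → ℝ) (dh : Fin n → Fin n → Euc m) (y : Fin n → ℝ)
    (Y : Fin n → Euc m) : Euc m :=
  ∑ i, ∑ j, ((y i * y j) • dh i j + (H i j * y j) • Y i + (H i j * y i) • Y j)

/-- The gradient of the truncation `y^k ψ_s(W)`. -/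
def truncGrad (s : ℝ) (H : Fin n → Fin n → ℝ) (dh : Fin n → Fin n → Euc m) (y : Fin n → ℝ)
    (Y : Fin n → Euc m) (k : Fin n) : Euc m :=
  cutoff s (quadVal H y) • Y k + (cutoffDeriv s (quadVal H y) * y k) • quadGrad H dh y Y

variable {H : Fin n → Fin n → ℝ} {dh : Fin n → Fin n → Euc m} {y : Fin n → ℝ} {Y : Fin n → Euc m}
  {F : Fin m → Fin m → ℝ} {s ρ₁ ρ₂ ρ₃ M Λ : ℝ}

theorem abs_le_sqrt_sum_sq (y : Fin n → ℝ) (i : Fin n) : |y i| ≤ √(∑ j, y j ^ 2) :=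
  Real.abs_le_sqrt (Finset.single_le_sum (f := fun j => y j ^ 2) (fun _ _ => sq_nonneg _)
    (Finset.mem_univ i))

theorem abs_mul_le_sum_sq (y : Fin n → ℝ) (i j : Fin n) : |y i * y j| ≤ ∑ k, y k ^ 2 := by
  rw [abs_mul, ← Real.mul_self_sqrt (show 0 ≤ ∑ k, y k ^ 2 by positivity)]
  exact mul_le_mul (abs_le_sqrt_sum_sq y i) (abs_le_sqrt_sum_sq y j) (abs_nonneg _)
    (Real.sqrt_nonneg _)

theorem abs_quadVal_le (hH : ∀ i j, |H i j| ≤ Λ) (y : Fin n → ℝ) :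
    |quadVal H y| ≤ n * (n * Λ) * ∑ k, y k ^ 2 := by
  have h : ∀ i j, |H i j * y i * y j| ≤ Λ * ∑ k, y k ^ 2 := fun i j => by
    rw [mul_assoc, abs_mul]
    exact mul_le_mul (hH i j) (abs_mul_le_sum_sq y i j) (abs_nonneg _)
      ((abs_nonneg _).trans (hH i j))
  refine (Finset.abs_sum_le_sum_abs _ _).trans ((Finset.sum_le_sum fun i _ =>
    (Finset.abs_sum_le_sum_abs _ _).trans (Finset.sum_le_sum fun j _ => h i j)).trans
      (le_of_eq ?_))
  simp
  ring

theorem norm_sum_smul_le (hd : ∀ i j, ‖dh i j‖ ≤ Λ) (y : Fin n → ℝ) :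
    ‖∑ i, ∑ j, (y i * y j) • dh i j‖ ≤ n * (n * Λ) * ∑ k, y k ^ 2 := by
  have h : ∀ i j, ‖(y i * y j) • dh i j‖ ≤ Λ * ∑ k, y k ^ 2 := fun i j => by
    rw [norm_smul, mul_comm]
    exact mul_le_mul (hd i j) (abs_mul_le_sum_sq y i j) (abs_nonneg _)
      ((norm_nonneg _).trans (hd i j))
  refine (norm_sum_le _ _).trans ((Finset.sum_le_sum fun i _ =>
    (norm_sum_le _ _).trans (Finset.sum_le_sum fun j _ => h i j)).trans
      (le_of_eq ?_))
  simp
  ring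

theorem quadGrad_eq (hsymm : ∀ i j, H i j = H j i) :
    quadGrad H dh y Y
      = ∑ i, ∑ j, (y i * y j) • dh i j + (2 : ℝ) • ∑ i, ∑ j, (H i j * y j) • Y i := by
  have h : ∑ i, ∑ j, (H i j * y i) • Y j = ∑ i, ∑ j, (H i j * y j) • Y i := by
    rw [Finset.sum_comm]
    exact Finset.sum_congr rfl fun i _ => Finset.sum_congr rfl fun j _ => by rw [hsymm]
  simp only [quadGrad, Finset.sum_add_distrib]
  rw [h, two_smul, add_assoc]

/-- By symmetry of h, Σ h^{jk} y^k ∇y^j = (∇W - Z)/2 with Z = Σ y^i y^j ∇h^{ij}. The term in which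
the derivative hits the cut-off thus becomes a quadratic form in ∇W, up to the lower-order Z. -/
theorem sum_mul_quadForm_truncGrad (hsymm : ∀ i j, H i j = H j i) :
    ∑ j, ∑ k, H j k * quadForm F (Y j) (truncGrad s H dh y Y k)
      = cutoff s (quadVal H y) * (∑ j, ∑ k, H j k * quadForm F (Y j) (Y k))
        + cutoffDeriv s (quadVal H y) / 2
          * (quadForm F (quadGrad H dh y Y) (quadGrad H dh y Y)
            - quadForm F (∑ i, ∑ j, (y i * y j) • dh i j) (quadGrad H dh y Y)) := by
  have h : ∑ i, ∑ j, (H i j * y j) • Y i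
      = (1 / 2 : ℝ) • (quadGrad H dh y Y - ∑ i, ∑ j, (y i * y j) • dh i j) := by
    rw [quadGrad_eq hsymm, add_sub_cancel_left, smul_smul]
    norm_num
  rw [← quadForm_sub_left]
  have h2 : quadForm F (quadGrad H dh y Y - ∑ i, ∑ j, (y i * y j) • dh i j) (quadGrad H dh y Y)
      = 2 * quadForm F (∑ i, ∑ j, (H i j * y j) • Y i) (quadGrad H dh y Y) := by
    rw [h, quadForm_smul_left]
    ring
  rw [h2]
  simp only [quadForm_sum_left, quadForm_smul_left, truncGrad, quadForm_add_right,
    quadForm_smul_right, Finset.mul_sum, ← Finset.sum_add_distrib]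
  exact Finset.sum_congr rfl fun j _ => Finset.sum_congr rfl fun k _ => by ring

theorem cutoffDeriv_mul_sum_sq_le (hρ₁ : 0 < ρ₁) (hs : 0 < s)
    (hV : ρ₁ * ∑ i, y i ^ 2 ≤ quadVal H y) :
    cutoffDeriv s (quadVal H y) * ∑ i, y i ^ 2 ≤ 2 / ρ₁ := by
  rw [le_div_iff₀ hρ₁, mul_assoc, mul_comm _ ρ₁]
  exact (mul_le_mul_of_nonneg_left hV (cutoffDeriv_nonneg _ _)).trans (cutoffDeriv_mul_le hs _)

/-- Since ψ² ≤ ψ and ψ'|y|² ≤ 2/ρ₁, the gradient of the truncation is controlled by ψ|∇y|² and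
ψ'|∇W|², the two quantities that the principal part bounds from below. -/
theorem sum_norm_truncGrad_sq_le (hρ₁ : 0 < ρ₁) (hs : 0 < s)
    (hV : ρ₁ * ∑ i, y i ^ 2 ≤ quadVal H y) :
    ∑ k, ‖truncGrad s H dh y Y k‖ ^ 2 ≤ 2 * (cutoff s (quadVal H y) * ∑ k, ‖Y k‖ ^ 2)
      + 4 / ρ₁ * (cutoffDeriv s (quadVal H y) * ‖quadGrad H dh y Y‖ ^ 2) := by
  set ψ := cutoff s (quadVal H y) with hψ
  set ψ' := cutoffDeriv s (quadVal H y) with hψ'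
  set d := ‖quadGrad H dh y Y‖ with hd
  have h0 : 0 ≤ ψ := cutoff_nonneg _ _
  have h1 : ψ ≤ 1 := cutoff_le_one _ _
  have h0' : 0 ≤ ψ' := cutoffDeriv_nonneg _ _
  have h2 : ∀ k, ‖truncGrad s H dh y Y k‖ ^ 2 ≤ 2 * ψ * ‖Y k‖ ^ 2 + 2 * (ψ' ^ 2 * d ^ 2) * y k ^ 2 := by
    intro k
    have h3 : ‖truncGrad s H dh y Y k‖ ≤ ψ * ‖Y k‖ + ψ' * |y k| * d := by
      refine (norm_add_le _ _).trans (le_of_eq ?_)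
      rw [norm_smul, norm_smul, Real.norm_eq_abs, Real.norm_eq_abs, abs_mul, abs_of_nonneg h0,
        abs_of_nonneg h0']
    have h4 : ψ ^ 2 ≤ ψ := by nlinarith
    calc _ ≤ (ψ * ‖Y k‖ + ψ' * |y k| * d) ^ 2 := by gcongr
      _ ≤ 2 * (ψ * ‖Y k‖) ^ 2 + 2 * (ψ' * |y k| * d) ^ 2 := by
        nlinarith [sq_nonneg (ψ * ‖Y k‖ - ψ' * |y k| * d)]
      _ = 2 * ψ ^ 2 * ‖Y k‖ ^ 2 + 2 * (ψ' ^ 2 * d ^ 2) * y k ^ 2 := by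
        rw [mul_pow, mul_pow, mul_pow, sq_abs]; ring
      _ ≤ _ := by gcongr
  refine (Finset.sum_le_sum fun k _ => h2 k).trans ?_
  rw [Finset.sum_add_distrib, ← Finset.mul_sum, ← Finset.mul_sum, mul_assoc]
  refine add_le_add le_rfl ?_
  have h5 := cutoffDeriv_mul_sum_sq_le hρ₁ hs hV
  rw [← hψ'] at h5
  calc _ = 2 * (ψ' * d ^ 2) * (ψ' * ∑ k, y k ^ 2) := by ring
    _ ≤ 2 * (ψ' * d ^ 2) * (2 / ρ₁) := by gcongr
    _ = _ := by ring

/-- The cross term F(Z,∇W) is split by Young's inequality: half of the coercivity of F absorbs ∇W,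
and what remains is of order ψ'|y|⁴, that is |y|², because ψ'|y|² ≤ 2/ρ₁. -/
theorem le_sum_mul_quadForm_truncGrad (hρ₁ : 0 < ρ₁) (hρ₂ : 0 < ρ₂) (hM : 0 ≤ M) (hΛ : 0 ≤ Λ)
    (hs : 0 < s) (hsymm : ∀ i j, H i j = H j i) (hV : ρ₁ * ∑ i, y i ^ 2 ≤ quadVal H y)
    (hF : ∀ u, ρ₂ * ‖u‖ ^ 2 ≤ quadForm F u u) (hFM : ∀ u v, |quadForm F u v| ≤ M * ‖u‖ * ‖v‖)
    (hY : ρ₃ * ∑ j, ‖Y j‖ ^ 2 ≤ ∑ j, ∑ k, H j k * quadForm F (Y j) (Y k))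
    (hd : ∀ i j, ‖dh i j‖ ≤ Λ) :
    ρ₃ * (cutoff s (quadVal H y) * ∑ k, ‖Y k‖ ^ 2)
      + ρ₂ / 4 * (cutoffDeriv s (quadVal H y) * ‖quadGrad H dh y Y‖ ^ 2)
      - (M * (n * (n * Λ))) ^ 2 / (2 * ρ₁ * ρ₂) * ∑ k, y k ^ 2
      ≤ ∑ j, ∑ k, H j k * quadForm F (Y j) (truncGrad s H dh y Y k) := by
  rw [sum_mul_quadForm_truncGrad hsymm]
  have h5 := cutoffDeriv_mul_sum_sq_le hρ₁ hs hV
  have hZ := norm_sum_smul_le hd y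
  set t := ∑ k, y k ^ 2
  set ψ := cutoff s (quadVal H y) with hψ
  set ψ' := cutoffDeriv s (quadVal H y) with hψ'
  set w := quadGrad H dh y Y
  set Z := ∑ i, ∑ j, (y i * y j) • dh i j
  have h0 : 0 ≤ ψ := cutoff_nonneg _ _
  have h0' : 0 ≤ ψ' := cutoffDeriv_nonneg _ _
  have ht : 0 ≤ t := by positivity
  set c := M * (n * (n * Λ)) with hc
  have hc0 : 0 ≤ c := by positivity
  have h1 : ψ * (ρ₃ * ∑ j, ‖Y j‖ ^ 2) ≤ ψ * ∑ j, ∑ k, H j k * quadForm F (Y j) (Y k) :=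
    mul_le_mul_of_nonneg_left hY h0
  have h2 : quadForm F Z w ≤ c * t * ‖w‖ := by
    refine (le_abs_self _).trans ((hFM Z w).trans ?_)
    calc _ ≤ M * (n * (n * Λ) * t) * ‖w‖ := by gcongr
      _ = _ := by rw [hc]; ring
  have h3 : c * t * ‖w‖ ≤ ρ₂ / 2 * ‖w‖ ^ 2 + c ^ 2 * t ^ 2 / (2 * ρ₂) := by
    have : 0 ≤ (ρ₂ * ‖w‖ - c * t) ^ 2 / (2 * ρ₂) := by positivity
    have e : (ρ₂ * ‖w‖ - c * t) ^ 2 / (2 * ρ₂)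
        = ρ₂ / 2 * ‖w‖ ^ 2 + c ^ 2 * t ^ 2 / (2 * ρ₂) - c * t * ‖w‖ := by
      field_simp
      ring
    linarith
  have h4 : ψ' / 2 * (ρ₂ / 2 * ‖w‖ ^ 2 - c ^ 2 * t ^ 2 / (2 * ρ₂))
      ≤ ψ' / 2 * (quadForm F w w - quadForm F Z w) := by
    refine mul_le_mul_of_nonneg_left ?_ (by positivity)
    linarith [hF w]
  have h6 : ψ' / 2 * (c ^ 2 * t ^ 2 / (2 * ρ₂)) ≤ c ^ 2 / (2 * ρ₁ * ρ₂) * t := by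
    calc _ = c ^ 2 * t / (4 * ρ₂) * (ψ' * t) := by ring
      _ ≤ c ^ 2 * t / (4 * ρ₂) * (2 / ρ₁) := by gcongr
      _ = _ := by field_simp; ring
  linarith

end Truncation

/-! ### The lower bound on the bilinear form -/

theorem Jet.norm_le_of_forall {m n : ℕ} {U : Jet m n} {b : ℝ} (hb : 0 ≤ b)
    (h : ∀ i, |Jet.val i U| ≤ b) (h' : ∀ i, ‖Jet.grad i U‖ ≤ b) : ‖U‖ ≤ 2 * n * b := by
  refine le_of_sq_le_sq ?_ (by positivity)
  rw [Jet.norm_sq]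
  have h1 : ∀ i, Jet.val i U ^ 2 + ‖Jet.grad i U‖ ^ 2 ≤ 2 * b ^ 2 := fun i => by
    have := sq_le_sq' (by linarith [(abs_le.1 (h i)).1]) (abs_le.1 (h i)).2
    have := pow_le_pow_left₀ (norm_nonneg _) (h' i) 2
    linarith
  refine (Finset.sum_le_sum fun i _ => h1 i).trans ?_
  rw [Finset.sum_const, Finset.card_univ, Fintype.card_fin, nsmul_eq_mul]
  rcases Nat.eq_zero_or_pos n with rfl | hn
  · simp
  · have : (1 : ℝ) ≤ n := by exact_mod_cast hn
    have h2 : (n : ℝ) ≤ n ^ 2 := by nlinarith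
    calc (n : ℝ) * (2 * b ^ 2) ≤ n ^ 2 * (4 * b ^ 2) := by gcongr; norm_num
      _ = _ := by ring

/-- Only the product r√N needs Young's inequality. The assumption r ≥ 1 lets the contribution of the
right-hand side, linear in r, be counted with r². -/
theorem absorb_lower_order {ρ M b L N r ψ : ℝ} (hρ : 0 < ρ) (hM : 0 ≤ M) (hb : 0 ≤ b)
    (hL : 0 ≤ L) (hN : 0 ≤ N) (hr : 1 ≤ r) (hψ : 0 ≤ ψ) (hψ1 : ψ ≤ 1) :
    M * (r + √N) * (b * (ψ * r)) + L * (b * (ψ * r))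
      ≤ ρ / 2 * (ψ * N) + (M * b + (M * b) ^ 2 / (2 * ρ) + L * b) * r ^ 2 := by
  have h1 : M * b * r * √N ≤ ρ / 2 * N + (M * b) ^ 2 / (2 * ρ) * r ^ 2 := by
    have h2 : 0 ≤ (ρ * √N - M * b * r) ^ 2 / (2 * ρ) := by positivity
    have h3 : (ρ * √N - M * b * r) ^ 2 / (2 * ρ)
        = ρ / 2 * √N ^ 2 + (M * b) ^ 2 / (2 * ρ) * r ^ 2 - M * b * r * √N := by
      field_simp
      ring
    rw [Real.sq_sqrt hN] at h3
    linarith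
  have h4 : L * b * r ≤ L * b * r ^ 2 := by
    have : r ≤ r ^ 2 := by nlinarith
    gcongr
  set K := M * b + (M * b) ^ 2 / (2 * ρ) + L * b with hK
  have hK0 : 0 ≤ K * r ^ 2 := by positivity
  calc _ = ψ * (M * b * r ^ 2 + M * b * r * √N + L * b * r) := by ring
    _ ≤ ψ * (M * b * r ^ 2 + (ρ / 2 * N + (M * b) ^ 2 / (2 * ρ) * r ^ 2) + L * b * r ^ 2) := by
      gcongr
    _ = ρ / 2 * (ψ * N) + ψ * (K * r ^ 2) := by rw [hK]; ring
    _ ≤ _ := by linarith [mul_le_of_le_one_left hK0 hψ1]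

theorem min_mul_le_add {ρ₁ ρ₂ ρ₃ A w X : ℝ} (hρ₁ : 0 < ρ₁) (hρ₂ : 0 < ρ₂) (hρ₃ : 0 < ρ₃)
    (hA : 0 ≤ A) (hw : 0 ≤ w) (hX : X ≤ 2 * A + 4 / ρ₁ * w) :
    min (ρ₃ / 4) (ρ₁ * ρ₂ / 16) * X ≤ ρ₃ / 2 * A + ρ₂ / 4 * w := by
  have h1 : 0 ≤ min (ρ₃ / 4) (ρ₁ * ρ₂ / 16) := by positivity
  calc _ ≤ min (ρ₃ / 4) (ρ₁ * ρ₂ / 16) * (2 * A + 4 / ρ₁ * w) := by gcongr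
    _ = min (ρ₃ / 4) (ρ₁ * ρ₂ / 16) * (2 * A)
        + min (ρ₃ / 4) (ρ₁ * ρ₂ / 16) * (4 / ρ₁ * w) := by ring
    _ ≤ ρ₃ / 4 * (2 * A) + ρ₁ * ρ₂ / 16 * (4 / ρ₁ * w) := by
      gcongr
      · exact min_le_left _ _
      · exact min_le_right _ _
    _ = _ := by field_simp; ring

theorem sum_rotate {ι κ : Type*} [Fintype ι] [Fintype κ] (f : ι → κ → κ → ι → ℝ) :
    ∑ i, ∑ p, ∑ q, ∑ k, f i p q k = ∑ k, ∑ p, ∑ q, ∑ i, f i p q k := by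
  have h : ∀ i, ∑ p, ∑ q, ∑ k, f i p q k = ∑ k, ∑ p, ∑ q, f i p q k := fun i =>
    calc ∑ p, ∑ q, ∑ k, f i p q k = ∑ p, ∑ k, ∑ q, f i p q k :=
          Finset.sum_congr rfl fun p _ => Finset.sum_comm
      _ = _ := Finset.sum_comm
  simp only [h]
  rw [Finset.sum_comm]
  refine Finset.sum_congr rfl fun k _ => ?_
  rw [Finset.sum_comm]
  exact Finset.sum_congr rfl fun p _ => Finset.sum_comm

namespace EllipticSystem

variable {m n : ℕ}

/-- With vanishing values only the principal part survives, and the relation between a, E and h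
replaces the coupled coefficients by h^{jk}F. -/
theorem bilin_jet_zero_val {S : EllipticSystem m n} {x : Euc m} {H E : Fin n → Fin n → ℝ}
    {F : Fin m → Fin m → ℝ} (hE : ∀ j k p q, ∑ i, S.a i j p q x * E i k = H j k * F p q)
    (U : Jet m n) (V : Fin n → Euc m) :
    S.bilin x U (Jet.mk (fun _ _ => 0) (fun i _ => ∑ k, E i k • V k) x)
      = ∑ j, ∑ k, H j k * quadForm F (Jet.grad j U) (V k) := by
  rw [bilin_apply]
  simp only [Jet.val_mk, Jet.grad_mk, mul_zero, Finset.sum_const_zero, add_zero, quadForm,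
    Finset.mul_sum]
  have e : ∀ j k p q, H j k * (F p q * Jet.grad j U p * V k q)
      = ∑ i, S.a i j p q x * E i k * (Jet.grad j U p * V k q) := fun j k p q => by
    rw [← Finset.sum_mul, hE]; ring
  simp only [e, WithLp.ofLp_sum, Finset.sum_apply, PiLp.smul_apply, smul_eq_mul, Finset.mul_sum]
  rw [Finset.sum_comm]
  refine Finset.sum_congr rfl fun j _ => ?_
  exact (sum_rotate fun i p q k => S.a i j p q x * (Jet.grad j U p) * (E i k * V k q)).trans
    (Finset.sum_congr rfl fun k _ => Finset.sum_congr rfl fun p _ => Finset.sum_congr rfl fun q _ =>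
      Finset.sum_congr rfl fun i _ => by ring)

-- The product rule splits the test jet: where the derivative falls on the truncation one gets the
-- coercive principal part, and where it falls on E, or there is none, a jet of size at most bψ|y|,
-- which is absorbed. The lower bound on |y| above the level makes f harmless. The constants depend
-- on neither the system nor s.
set_option maxHeartbeats 1000000 in
theorem exists_bilin_sub_load_ge {ρ₁ ρ₂ ρ₃ Mb Mf MF Λh ΛE : ℝ} (hρ₁ : 0 < ρ₁) (hρ₂ : 0 < ρ₂)
    (hρ₃ : 0 < ρ₃) (hMf : 0 ≤ Mf) (hMb : 0 ≤ Mb) (hMF : 0 ≤ MF) (hΛh : 0 ≤ Λh) (hΛE : 0 ≤ ΛE) :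
    ∃ c₀ : ℝ, 0 < c₀ ∧ ∃ C₀ : ℝ, 0 ≤ C₀ ∧ ∀ (S : EllipticSystem m n) (x : Euc m)
      (H E : Fin n → Fin n → ℝ) (F : Fin m → Fin m → ℝ) (dh dE : Fin n → Fin n → Euc m)
      (U : Jet m n) (s : ℝ), 0 < s →
      (∀ j k p q, ∑ i, S.a i j p q x * E i k = H j k * F p q) →
      (∀ i j, H i j = H j i) → (∀ ξ : Fin n → ℝ, ρ₁ * ∑ i, ξ i ^ 2 ≤ quadVal H ξ) →
      (∀ u, ρ₂ * ‖u‖ ^ 2 ≤ quadForm F u u) → (∀ u v, |quadForm F u v| ≤ MF * ‖u‖ * ‖v‖) →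
      (∀ Y : Fin n → Euc m, ρ₃ * ∑ j, ‖Y j‖ ^ 2 ≤ ∑ j, ∑ k, H j k * quadForm F (Y j) (Y k)) →
      (∀ i j, ‖dh i j‖ ≤ Λh) → (∀ i j, |E i j| ≤ ΛE) → (∀ i j, ‖dE i j‖ ≤ ΛE) →
      ‖S.bilin x‖ ≤ Mb → ‖S.f x‖ ≤ Mf →
      (s < quadVal H (fun i => Jet.val i U) → 1 ≤ ∑ i, Jet.val i U ^ 2) →
      let ψ := cutoff s (quadVal H fun i => Jet.val i U)
      let V := truncGrad s H dh (fun i => Jet.val i U) (fun i => Jet.grad i U)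
      let Φ := Jet.mk (fun i _ => ∑ k, E i k * (Jet.val k U * ψ))
        (fun i _ => ∑ k, (E i k • V k + (Jet.val k U * ψ) • dE i k)) x
      c₀ * ∑ k, ‖V k‖ ^ 2 - C₀ * (if s < quadVal H (fun i => Jet.val i U) then
        ∑ i, Jet.val i U ^ 2 else 0) ≤ S.bilin x U Φ - S.load x Φ := by
  set b : ℝ := 2 * n * (n * ΛE) with hb
  have hb0 : 0 ≤ b := by positivity
  set K₁ : ℝ := (MF * (n * (n * Λh))) ^ 2 / (2 * ρ₁ * ρ₂) with hK₁
  have hK₁0 : 0 ≤ K₁ := by positivity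
  set K₂ : ℝ := Mb * b + (Mb * b) ^ 2 / (2 * ρ₃) + n * Mf * b with hK₂
  have hK₂0 : 0 ≤ K₂ := by positivity
  refine ⟨min (ρ₃ / 4) (ρ₁ * ρ₂ / 16), by positivity, K₁ + K₂, by positivity, ?_⟩
  intro S x H E F dh dE U s hs hE hsymm hV hF hFM hY hdh hEb hdE hbil hf hbig
  set y := fun i => Jet.val i U with hy
  set Y := fun i => Jet.grad i U with hYdef
  intro ψ V Φ
  set ψ' := cutoffDeriv s (quadVal H y) with hψ'
  -- Below the level the cut-off and its derivative both vanish, so the test jet is zero.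
  by_cases hW : s < quadVal H y
  swap
  · have h1 : ψ = 0 := cutoff_eq_zero (not_lt.1 hW)
    have h2 : ψ' = 0 := cutoffDeriv_eq_zero (not_lt.1 hW)
    have hV0 : ∀ k, V k = 0 := fun k => by
      simp only [V, truncGrad]
      change ψ • _ + (ψ' * _) • _ = _
      rw [h1, h2]; simp
    have hΦ : Φ = 0 := Jet.ext (fun i => by simp [Φ, h1]) fun i => by simp [Φ, h1, hV0]
    rw [if_neg hW, hΦ]
    simp [hV0]
  rw [if_pos hW]
  have ht1 := hbig hW
  set t := ∑ i, y i ^ 2 with ht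
  -- Φ₁ carries E times the gradient of the truncation and has no values; Φ₂ collects the rest.
  set Φ₁ := Jet.mk (fun _ _ => 0) (fun i _ => ∑ k, E i k • V k) x with hΦ₁
  set Φ₂ := Jet.mk (fun i _ => ∑ k, E i k * (y k * ψ)) (fun i _ => ∑ k, (y k * ψ) • dE i k) x
    with hΦ₂
  have hsplit : Φ = Φ₁ + Φ₂ := Jet.ext (fun i => by simp [Φ, Φ₁, Φ₂, y]) fun i => by
    simp [Φ, Φ₁, Φ₂, Finset.sum_add_distrib, y]
  have hψ0 : 0 ≤ ψ := cutoff_nonneg _ _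
  set N := ∑ k, ‖Y k‖ ^ 2 with hN
  set r := √t with hr
  have hr2 : r ^ 2 = t := Real.sq_sqrt (by positivity)
  have hr0 : 0 ≤ r := Real.sqrt_nonneg _
  have hr1 : 1 ≤ r := Real.one_le_sqrt.2 ht1
  have hyr : ∀ k, |y k| ≤ r := fun k => abs_le_sqrt_sum_sq y k
  have hΦ₂n : ‖Φ₂‖ ≤ b * (ψ * r) := by
    have : ‖Φ₂‖ ≤ 2 * n * (n * (ΛE * (ψ * r))) := by
      refine Jet.norm_le_of_forall (by positivity) (fun i => ?_) fun i => ?_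
      · simp only [Φ₂, Jet.val_mk]
        refine (Finset.abs_sum_le_sum_abs _ _).trans ((Finset.sum_le_sum (g := fun _ =>
          ΛE * (ψ * r)) fun k _ => ?_).trans (le_of_eq (by simp)))
        rw [abs_mul, abs_mul, abs_of_nonneg hψ0, mul_comm (|y k|)]
        have := hEb i k
        have := hyr k
        gcongr
      · simp only [Φ₂, Jet.grad_mk]
        refine (norm_sum_le _ _).trans ((Finset.sum_le_sum (g := fun _ =>
          ΛE * (ψ * r)) fun k _ => ?_).trans (le_of_eq (by simp)))
        rw [norm_smul, Real.norm_eq_abs, abs_mul, abs_of_nonneg hψ0, mul_comm, mul_comm (|y k|)]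
        have := hdE i k
        have := hyr k
        gcongr
    refine this.trans (le_of_eq ?_)
    rw [hb]; ring
  have hUn : ‖U‖ ≤ r + √N := by
    refine le_of_sq_le_sq ?_ (by positivity)
    have : ‖U‖ ^ 2 = t + N := by
      rw [Jet.norm_sq, Finset.sum_add_distrib]
    rw [this, add_sq, hr2, Real.sq_sqrt (by positivity)]
    linarith [mul_nonneg hr0 (Real.sqrt_nonneg N)]
  have b1 : |S.bilin x U Φ₂| ≤ Mb * (r + √N) * (b * (ψ * r)) := by
    refine (abs_bilin_le hbil U Φ₂).trans ?_
    gcongr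
  have b2 : |S.load x Φ₂| ≤ n * Mf * (b * (ψ * r)) := by
    refine (abs_load_le hf Φ₂).trans ?_
    gcongr
  have hload : S.load x Φ₁ = 0 := by simp [load_apply, Φ₁]
  have hmain := bilin_jet_zero_val hE U V
  have hmain2 := le_sum_mul_quadForm_truncGrad (F := F) (y := y) (Y := Y) hρ₁ hρ₂ hMF hΛh hs hsymm
    (hV y) hF hFM (hY Y) hdh
  have hsq := sum_norm_truncGrad_sq_le (H := H) (dh := dh) (Y := Y) hρ₁ hs (hV y)
  change ∑ k, ‖V k‖ ^ 2 ≤ 2 * (ψ * N) + 4 / ρ₁ * (ψ' * ‖quadGrad H dh y Y‖ ^ 2) at hsq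
  change ρ₃ * (ψ * N) + ρ₂ / 4 * (ψ' * ‖quadGrad H dh y Y‖ ^ 2) - K₁ * t
    ≤ ∑ j, ∑ k, H j k * quadForm F (Y j) (V k) at hmain2
  change S.bilin x U Φ₁ = ∑ j, ∑ k, H j k * quadForm F (Y j) (V k) at hmain
  set w := ψ' * ‖quadGrad H dh y Y‖ ^ 2 with hw
  have hw0 : 0 ≤ w := mul_nonneg (cutoffDeriv_nonneg _ _) (sq_nonneg _)
  have hN0 : 0 ≤ N := by positivity
  have hψ1 : ψ ≤ 1 := cutoff_le_one _ _
  have b3 := absorb_lower_order (N := N) hρ₃ hMb hb0 (by positivity : 0 ≤ n * Mf) hN0 hr1 hψ0 hψ1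
  rw [hr2, ← hK₂] at b3
  have hc := min_mul_le_add hρ₁ hρ₂ hρ₃ (mul_nonneg hψ0 hN0) hw0 hsq
  rw [hsplit, map_add, map_add, hload, hmain]
  have := (abs_le.1 b1).1
  have := (abs_le.1 b2).2
  linarith

end EllipticSystem

/-! ### The truncated solution in `H¹₀` -/

section TruncationSobolev

variable {m n : ℕ} {Ω : Set (Euc m)}

/-- A product does not have linear growth on the plane, but it does along the pair (e,u) because e
is bounded; this is why the chain rule asks for growth only along the given functions. -/
theorem HasH1Grad.bdd_mul (hΩ : IsOpen Ω) (hΩf : volume Ω ≠ ⊤) {e u : Euc m → ℝ}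
    {dE G : Euc m → Euc m} {c : ℝ} (he : HasH1Grad Ω e dE) (hu : HasH1Grad Ω u G)
    (hec : ∀ᵐ x ∂(volume.restrict Ω), |e x| ≤ c)
    (hdE : ∀ᵐ x ∂(volume.restrict Ω), ‖dE x‖ ≤ c) :
    HasH1Grad Ω (fun x => e x * u x) (fun x => e x • G x + u x • dE x) := by
  have hF : ContDiff ℝ 1 (fun z : Bool → ℝ => z true * z false) := by fun_prop
  have hfd : ∀ z v : Bool → ℝ, fderiv ℝ (fun z : Bool → ℝ => z true * z false) z v
      = z true * v false + z false * v true := by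
    intro z v
    have h1 : HasFDerivAt (fun z : Bool → ℝ => z true)
      (ContinuousLinearMap.proj (R := ℝ) (φ := fun _ : Bool => ℝ) true) z :=
      (ContinuousLinearMap.proj (R := ℝ) (φ := fun _ : Bool => ℝ) true).hasFDerivAt
    have h2 : HasFDerivAt (fun z : Bool → ℝ => z false)
      (ContinuousLinearMap.proj (R := ℝ) (φ := fun _ : Bool => ℝ) false) z :=
      (ContinuousLinearMap.proj (R := ℝ) (φ := fun _ : Bool => ℝ) false).hasFDerivAt
    have h3 : HasFDerivAt (fun z : Bool → ℝ => z true * z false) _ z := h1.mul h2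
    rw [h3.fderiv]
    simp
  have hb1 : MemLp (fun x => e x • G x) 2 (volume.restrict Ω) :=
    hu.memLp_grad.smul (p := ⊤) (q := 2) (r := 2) (memLp_top_of_bound he.memLp.1 c hec)
  have hb2 : MemLp (fun x => u x • dE x) 2 (volume.restrict Ω) :=
    MemLp.smul (p := 2) (q := ⊤) (r := 2) (memLp_top_of_bound he.memLp_grad.1 c hdE) hu.memLp
  refine HasH1Grad.comp (U := fun b x => cond b (e x) (u x))
    (G := fun b x => cond b (dE x) (G x)) (F := fun z : Bool → ℝ => z true * z false) (c := c)
    hΩ hΩf (fun b => ?_) hF ?_ (hb1.add hb2) (ae_of_all _ fun x p => ?_)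
  · cases b
    · exact hu
    · exact he
  · filter_upwards [hec] with x hx
    simp only [cond_true, cond_false, abs_mul]
    have h0 : 0 ≤ c := (abs_nonneg _).trans hx
    have h1 : |u x| ≤ ‖fun b => cond b (e x) (u x)‖ :=
      norm_le_pi_norm (fun b => cond b (e x) (u x)) false
    have : |u x| ≤ 1 + ‖fun b => cond b (e x) (u x)‖ := by linarith
    gcongr
  · rw [hfd]
    simp

theorem HasH10Grad.bdd_mul (hΩ : IsOpen Ω) (hΩf : volume Ω ≠ ⊤) {e u : Euc m → ℝ}
    {dE G : Euc m → Euc m} {c : ℝ} (he : HasH1Grad Ω e dE) (hu : HasH10Grad Ω u G)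
    (hec : ∀ᵐ x ∂(volume.restrict Ω), |e x| ≤ c)
    (hdE : ∀ᵐ x ∂(volume.restrict Ω), ‖dE x‖ ≤ c) :
    HasH10Grad Ω (fun x => e x * u x) (fun x => e x • G x + u x • dE x) := by
  refine HasH10Grad.of_abs_le hΩ (he.bdd_mul hΩ hΩf hu.hasH1Grad hec hdE) hu (c := c) ?_
  filter_upwards [hec] with x hx
  rw [abs_mul]
  gcongr

theorem norm_quadGrad_le {H : Fin n → Fin n → ℝ} {dh : Fin n → Fin n → Euc m} {y : Fin n → ℝ}
    {Y : Fin n → Euc m} {Λ : ℝ} (hH : ∀ i j, |H i j| ≤ Λ) (hd : ∀ i j, ‖dh i j‖ ≤ Λ) :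
    ‖quadGrad H dh y Y‖ ≤ n * (n * Λ) * (√(∑ k, y k ^ 2) * (√(∑ k, y k ^ 2)
      + 2 * √(∑ k, ‖Y k‖ ^ 2))) := by
  set r := √(∑ k, y k ^ 2) with hr
  set N := √(∑ k, ‖Y k‖ ^ 2) with hN
  have hy : ∀ k, |y k| ≤ r := abs_le_sqrt_sum_sq y
  have hY : ∀ k, ‖Y k‖ ≤ N := fun k => by
    have := abs_le_sqrt_sum_sq (fun k => ‖Y k‖) k
    rwa [abs_norm] at this
  have hr0 : 0 ≤ r := Real.sqrt_nonneg _
  have h : ∀ i j, ‖(y i * y j) • dh i j + (H i j * y j) • Y i + (H i j * y i) • Y j‖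
      ≤ Λ * (r * (r + 2 * N)) := fun i j => by
    have h0 : 0 ≤ Λ := (abs_nonneg _).trans (hH i j)
    refine (norm_add₃_le).trans ?_
    rw [norm_smul, norm_smul, norm_smul, Real.norm_eq_abs, Real.norm_eq_abs, Real.norm_eq_abs,
      abs_mul, abs_mul, abs_mul]
    calc _ ≤ r * r * Λ + Λ * r * N + Λ * r * N := by
          gcongr
          · exact hy i
          · exact hy j
          · exact hd i j
          · exact hH i j
          · exact hy j
          · exact hY i
          · exact hH i j
          · exact hy i
          · exact hY j
      _ = _ := by ring
  refine (norm_sum_le _ _).trans ((Finset.sum_le_sum fun i _ =>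
    (norm_sum_le _ _).trans (Finset.sum_le_sum fun j _ => h i j)).trans
      (le_of_eq ?_))
  simp
  ring

/-- The growth of the gradient of the truncation is linear. -/
theorem norm_truncGrad_sq_le {H : Fin n → Fin n → ℝ} {dh : Fin n → Fin n → Euc m} {y : Fin n → ℝ}
    {Y : Fin n → Euc m} {Λ ρ₁ s : ℝ} (hρ₁ : 0 < ρ₁) (hs : 0 < s) (hH : ∀ i j, |H i j| ≤ Λ)
    (hd : ∀ i j, ‖dh i j‖ ≤ Λ) (hV : ρ₁ * ∑ i, y i ^ 2 ≤ quadVal H y) (k : Fin n) :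
    ‖truncGrad s H dh y Y k‖ ^ 2 ≤ (2 + 64 / ρ₁ ^ 2 * (n * (n * Λ)) ^ 2)
      * ∑ i, (y i ^ 2 + ‖Y i‖ ^ 2) := by
  have h1 := (Finset.single_le_sum (f := fun k => ‖truncGrad s H dh y Y k‖ ^ 2)
    (fun k _ => sq_nonneg _) (Finset.mem_univ k)).trans
    (sum_norm_truncGrad_sq_le (dh := dh) (Y := Y) hρ₁ hs hV)
  have h2 := cutoffDeriv_mul_sum_sq_le hρ₁ hs hV
  have h3 := norm_quadGrad_le (y := y) (Y := Y) hH hd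
  rw [Finset.sum_add_distrib]
  have ht : 0 ≤ ∑ i, y i ^ 2 := by positivity
  have hN : 0 ≤ ∑ i, ‖Y i‖ ^ 2 := by positivity
  have hr2 := Real.sq_sqrt ht
  have hN2 := Real.sq_sqrt hN
  set t := ∑ i, y i ^ 2
  set N := ∑ i, ‖Y i‖ ^ 2
  set ψ' := cutoffDeriv s (quadVal H y)
  have hψ' : 0 ≤ ψ' := cutoffDeriv_nonneg _ _
  set b := (n : ℝ) * (n * Λ)
  have h4 : ‖quadGrad H dh y Y‖ ^ 2 ≤ b ^ 2 * (t * (8 * (t + N))) := by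
    calc _ ≤ (b * (√t * (√t + 2 * √N))) ^ 2 := by gcongr
      _ = b ^ 2 * (√t ^ 2 * (√t + 2 * √N) ^ 2) := by ring
      _ ≤ b ^ 2 * (t * (8 * (t + N))) := by
        rw [hr2]
        gcongr
        nlinarith [sq_nonneg (2 * √N - √t)]
  -- The surplus factor |y|² in the bound for |∇W|² is consumed by ψ', which leaves linear growth.
  have h5 : ψ' * ‖quadGrad H dh y Y‖ ^ 2 ≤ 2 / ρ₁ * (b ^ 2 * (8 * (t + N))) := by
    calc _ ≤ ψ' * (b ^ 2 * (t * (8 * (t + N)))) := by gcongr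
      _ = ψ' * t * (b ^ 2 * (8 * (t + N))) := by ring
      _ ≤ _ := by gcongr
  have h6 : cutoff s (quadVal H y) * N ≤ N := mul_le_of_le_one_left hN (cutoff_le_one _ _)
  calc _ ≤ _ := h1
    _ ≤ 2 * N + 4 / ρ₁ * (2 / ρ₁ * (b ^ 2 * (8 * (t + N)))) := by gcongr
    _ = 2 * N + 64 / ρ₁ ^ 2 * b ^ 2 * (t + N) := by field_simp; ring
    _ ≤ _ := by nlinarith

/-- The truncation as a function of the coefficients and the solution. -/
def truncFun (s : ℝ) (k : Fin n) (z : (Fin n × Fin n) ⊕ Fin n → ℝ) : ℝ :=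
  z (Sum.inr k) * cutoff s (∑ i, ∑ j, z (Sum.inl (i, j)) * z (Sum.inr i) * z (Sum.inr j))

theorem contDiff_truncFun {s : ℝ} (hs : 0 < s) (k : Fin n) : ContDiff ℝ 1 (truncFun s k) := by
  unfold truncFun
  refine ContDiff.mul (by fun_prop) ((contDiff_cutoff hs).comp ?_)
  fun_prop

theorem fderiv_truncFun {s : ℝ} (hs : 0 < s) (k : Fin n)
    (z v : (Fin n × Fin n) ⊕ Fin n → ℝ) :
    fderiv ℝ (truncFun s k) z v
      = cutoff s (quadVal (fun i j => z (Sum.inl (i, j))) fun i => z (Sum.inr i)) * v (Sum.inr k)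
        + cutoffDeriv s (quadVal (fun i j => z (Sum.inl (i, j))) fun i => z (Sum.inr i))
          * z (Sum.inr k) * ∑ i, ∑ j, (z (Sum.inr i) * z (Sum.inr j) * v (Sum.inl (i, j))
            + z (Sum.inl (i, j)) * z (Sum.inr j) * v (Sum.inr i)
            + z (Sum.inl (i, j)) * z (Sum.inr i) * v (Sum.inr j)) := by
  have hc : ∀ a, HasDerivAt (fun t : ℝ => (z + t • v) a) (v a) 0 := fun a => by
    simpa using ((hasDerivAt_id (0 : ℝ)).mul_const (v a)).const_add (z a)
  have h1 : HasDerivAt (fun t : ℝ => truncFun s k (z + t • v)) (fderiv ℝ (truncFun s k) z v) 0 := by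
    have hd := ((contDiff_truncFun hs k).differentiable one_ne_zero z).hasFDerivAt
    have hl : HasDerivAt (fun t : ℝ => z + t • v) v 0 := by
      simpa using ((hasDerivAt_id (0 : ℝ)).smul_const v).const_add z
    have hz : z + (0 : ℝ) • v = z := by simp
    exact HasFDerivAt.comp_hasDerivAt (f := fun t : ℝ => z + t • v) 0 (by rwa [hz]) hl
  have h2 : HasDerivAt (fun t : ℝ => ∑ i, ∑ j, (z + t • v) (Sum.inl (i, j))
      * (z + t • v) (Sum.inr i) * (z + t • v) (Sum.inr j))
      (∑ i, ∑ j, (z (Sum.inr i) * z (Sum.inr j) * v (Sum.inl (i, j))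
            + z (Sum.inl (i, j)) * z (Sum.inr j) * v (Sum.inr i)
            + z (Sum.inl (i, j)) * z (Sum.inr i) * v (Sum.inr j))) 0 := by
    refine HasDerivAt.fun_sum fun i _ => HasDerivAt.fun_sum fun j _ => ?_
    refine (((hc (Sum.inl (i, j))).mul (hc (Sum.inr i))).mul (hc (Sum.inr j))).congr_deriv ?_
    simp
    ring
  have h3 := (hc (Sum.inr k)).mul (HasDerivAt.comp (0 : ℝ) (hasDerivAt_cutoff hs _) h2)
  refine h1.unique (h3.congr_deriv ?_)
  simp [quadVal]
  ring

theorem aestronglyMeasurable_quadVal {μ : Measure (Euc m)} {h : Fin n → Fin n → Euc m → ℝ}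
    {u : Fin n → Euc m → ℝ} (hh : ∀ i j, AEStronglyMeasurable (h i j) μ)
    (hu : ∀ i, AEStronglyMeasurable (u i) μ) :
    AEStronglyMeasurable (fun x => quadVal (fun i j => h i j x) fun i => u i x) μ := by
  unfold quadVal
  exact Finset.aestronglyMeasurable_fun_sum _ fun i _ => Finset.aestronglyMeasurable_fun_sum _
    fun j _ => ((hh i j).mul (hu i)).mul (hu j)

/-- The coefficients h are treated as additional arguments: the truncation is then a fixed C¹
function of (h,y), and the chain rule produces the terms with ∇h by itself. -/
theorem hasH1Grad_trunc (hΩ : IsOpen Ω) (hΩf : volume Ω ≠ ⊤) {h : Fin n → Fin n → Euc m → ℝ}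
    {dh : Fin n → Fin n → Euc m → Euc m} {u : Fin n → Euc m → ℝ} {G : Fin n → Euc m → Euc m}
    {Λ ρ₁ s : ℝ} (hρ₁ : 0 < ρ₁) (hs : 0 < s) (hh : ∀ i j, HasH1Grad Ω (h i j) (dh i j))
    (hu : ∀ i, HasH1Grad Ω (u i) (G i))
    (hH : ∀ᵐ x ∂(volume.restrict Ω), ∀ i j, |h i j x| ≤ Λ)
    (hd : ∀ᵐ x ∂(volume.restrict Ω), ∀ i j, ‖dh i j x‖ ≤ Λ)
    (hV : ∀ᵐ x ∂(volume.restrict Ω), ∀ ξ : Fin n → ℝ,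
      ρ₁ * ∑ i, ξ i ^ 2 ≤ quadVal (fun i j => h i j x) ξ) (k : Fin n) :
    HasH1Grad Ω (fun x => u k x * cutoff s (quadVal (fun i j => h i j x) fun i => u i x))
      (fun x => truncGrad s (fun i j => h i j x) (fun i j => dh i j x) (fun i => u i x)
        (fun i => G i x) k) := by
  have hW := aestronglyMeasurable_quadVal (fun i j => (hh i j).memLp.1) fun i => (hu i).memLp.1
  have hψ := (contDiff_cutoff hs).continuous.comp_aestronglyMeasurable hW
  have hψ' := (continuous_cutoffDeriv hs).comp_aestronglyMeasurable hW
  have hK : MemLp (fun x => truncGrad s (fun i j => h i j x) (fun i j => dh i j x)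
      (fun i => u i x) (fun i => G i x) k) 2 (volume.restrict Ω) := by
    refine MemLp.of_le_mul (c := √(2 + 64 / ρ₁ ^ 2 * (n * (n * Λ)) ^ 2))
      (Jet.memLp_mk (fun i => (hu i).memLp) fun i => (hu i).memLp_grad) ?_ ?_
    · unfold truncGrad quadGrad
      refine (hψ.smul (hu k).memLp_grad.1).add ((hψ'.mul (hu k).memLp.1).smul ?_)
      refine Finset.aestronglyMeasurable_fun_sum _ fun i _ =>
        Finset.aestronglyMeasurable_fun_sum _ fun j _ => ?_
      exact ((((hu i).memLp.1.mul (hu j).memLp.1).smul (hh i j).memLp_grad.1).add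
        (((hh i j).memLp.1.mul (hu j).memLp.1).smul (hu i).memLp_grad.1)).add
        (((hh i j).memLp.1.mul (hu i).memLp.1).smul (hu j).memLp_grad.1)
    · filter_upwards [hH, hd, hV] with x h1 h2 h3
      refine le_of_sq_le_sq ?_ (by positivity)
      rw [mul_pow, Real.sq_sqrt (by positivity), Jet.norm_sq]
      exact norm_truncGrad_sq_le hρ₁ hs h1 h2 (h3 _) k
  have := HasH1Grad.comp
    (U := fun (a : (Fin n × Fin n) ⊕ Fin n) x => Sum.elim (fun p => h p.1 p.2 x) (fun i => u i x) a)
    (G := fun (a : (Fin n × Fin n) ⊕ Fin n) x =>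
      Sum.elim (fun p => dh p.1 p.2 x) (fun i => G i x) a)
    (F := truncFun s k) (c := 1) hΩ hΩf (fun a => ?_) (contDiff_truncFun hs k) ?_ hK ?_
  · exact this
  · rcases a with p | i
    · exact hh p.1 p.2
    · exact hu i
  · refine ae_of_all _ fun x => ?_
    rw [truncFun, abs_mul, abs_of_nonneg (cutoff_nonneg _ _), one_mul]
    refine (mul_le_of_le_one_right (abs_nonneg _) (cutoff_le_one _ _)).trans ?_
    have := norm_le_pi_norm (fun (a : (Fin n × Fin n) ⊕ Fin n) =>
      Sum.elim (fun p => h p.1 p.2 x) (fun i => u i x) a) (Sum.inr k)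
    rw [Real.norm_eq_abs] at this
    linarith
  · refine ae_of_all _ fun x p => ?_
    rw [fderiv_truncFun hs]
    simp [truncGrad, quadGrad]

end TruncationSobolev

/-! ### The energy of the truncated solution -/

section Energy

variable {m n : ℕ} {Ω : Set (Euc m)}

theorem MemW1.hasH1Grad_of_top (hΩ : IsOpen Ω) (hΩf : volume Ω ≠ ⊤) {u : Euc m → ℝ}
    (hu : MemW1 Ω ⊤ u) : HasH1Grad Ω u (weakGrad Ω u) := by
  have : IsFiniteMeasure (volume.restrict Ω) := ⟨by simpa using hΩf.lt_top⟩
  obtain ⟨G, hG, hu, hG'⟩ := hu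
  exact (hG.hasH1Grad (hu.mono_exponent le_top) (hG'.mono_exponent le_top)).congr
    EventuallyEq.rfl (hG.weakGrad_ae_eq hΩ).symm

theorem ae_le_of_w1InfNorm_le {u : Fin n → Fin n → Euc m → ℝ} {Λ : ℝ≥0}
    (h : ∀ i j, w1InfNorm Ω (u i j) ≤ Λ) :
    (∀ᵐ x ∂(volume.restrict Ω), ∀ i j, |u i j x| ≤ Λ) ∧
      ∀ᵐ x ∂(volume.restrict Ω), ∀ i j, ‖weakGrad Ω (u i j) x‖ ≤ Λ := by
  simp only [ae_all_iff]
  exact ⟨fun i j => ae_norm_le_of_eLpNorm_top_le (le_self_add.trans (h i j)),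
    fun i j => ae_norm_le_of_eLpNorm_top_le (le_add_self.trans (h i j))⟩

/-- The infimum defining the boundary supremum need not be attained, hence the slack of 1. -/
theorem exists_memH10_of_boundaryEssSup_le {y : Euc m → Euc n} {Λ : ℝ≥0}
    (h : boundaryEssSup Ω y ≤ Λ) :
    ∃ k : ℝ≥0, k ≤ Λ + 1 ∧ MemH10 Ω (fun x => max (‖y x‖ - k) 0) := by
  have h1 : boundaryEssSup Ω y < (Λ + 1 : ℝ≥0) :=
    h.trans_lt (by exact_mod_cast lt_add_one Λ)
  rw [boundaryEssSup, iInf_lt_iff] at h1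
  obtain ⟨k, hk⟩ := h1
  rw [iInf_lt_iff] at hk
  obtain ⟨hk1, hk2⟩ := hk
  exact ⟨k, by exact_mod_cast hk2.le, hk1⟩

theorem Euc.norm_sq (v : Euc n) : ‖v‖ ^ 2 = ∑ i, v i ^ 2 := by
  rw [EuclideanSpace.norm_sq_eq]
  simp

/-- Truncation at a level above the boundary values gives functions in `H¹₀`. -/
theorem hasH10Grad_trunc (hΩ : IsOpen Ω) (hΩf : volume Ω ≠ ⊤) {h : Fin n → Fin n → Euc m → ℝ}
    {dh : Fin n → Fin n → Euc m → Euc m} {y : Euc m → Euc n} {G : Fin n → Euc m → Euc m}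
    {Λ ρ₁ s c k₀ : ℝ} (hρ₁ : 0 < ρ₁) (hs : 0 < s) (hh : ∀ i j, HasH1Grad Ω (h i j) (dh i j))
    (hy : ∀ i, HasH1Grad Ω (fun x => y x i) (G i))
    (hH : ∀ᵐ x ∂(volume.restrict Ω), ∀ i j, |h i j x| ≤ Λ)
    (hd : ∀ᵐ x ∂(volume.restrict Ω), ∀ i j, ‖dh i j x‖ ≤ Λ)
    (hV : ∀ᵐ x ∂(volume.restrict Ω), ∀ ξ : Fin n → ℝ,
      ρ₁ * ∑ i, ξ i ^ 2 ≤ quadVal (fun i j => h i j x) ξ)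
    (hbd : MemH10 Ω (fun x => max (‖y x‖ - k₀) 0)) (hc : 0 ≤ c)
    (hW : ∀ᵐ x ∂(volume.restrict Ω),
      quadVal (fun i j => h i j x) (fun i => y x i) ≤ c * ‖y x‖ ^ 2)
    (hsc : 4 * c * k₀ ^ 2 ≤ s) (k : Fin n) :
    HasH10Grad Ω (fun x => y x k * cutoff s (quadVal (fun i j => h i j x) fun i => y x i))
      (fun x => truncGrad s (fun i j => h i j x) (fun i j => dh i j x) (fun i => y x i)
        (fun i => G i x) k) := by
  refine HasH10Grad.of_abs_le hΩ (hasH1Grad_trunc hΩ hΩf hρ₁ hs hh hy hH hd hV k)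
    (hbd.hasH10Grad hΩ) (c := 2) ?_
  filter_upwards [hW] with x hx
  rw [abs_of_nonneg (le_max_right (‖y x‖ - k₀) 0)]
  -- Above the level, 4c k₀² < c|y|² forces |y| ≥ 2k₀, so that |y| ≤ 2(|y| - k₀); below it the
  -- truncation is zero. Either way it is dominated by an H¹₀ function.
  by_cases hWs : s < quadVal (fun i j => h i j x) fun i => y x i
  · have h1 : 4 * c * k₀ ^ 2 < c * ‖y x‖ ^ 2 := hsc.trans_lt (hWs.trans_le hx)
    have h2 : 2 * k₀ ≤ ‖y x‖ := by
      by_contra! hlt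
      have : ‖y x‖ ^ 2 ≤ (2 * k₀) ^ 2 := pow_le_pow_left₀ (norm_nonneg _) hlt.le 2
      nlinarith [mul_le_mul_of_nonneg_left this hc]
    rw [abs_mul, abs_of_nonneg (cutoff_nonneg _ _)]
    calc _ ≤ |y x k| := mul_le_of_le_one_right (abs_nonneg _) (cutoff_le_one _ _)
      _ ≤ ‖y x‖ := PiLp.norm_apply_le (y x) k
      _ ≤ 2 * (‖y x‖ - k₀) := by linarith
      _ ≤ _ := by gcongr; exact le_max_left _ _
  · rw [cutoff_eq_zero (not_lt.1 hWs), mul_zero, abs_zero]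
    positivity

namespace EllipticSystem

theorem HypothesisH.h_symm_ae [NeZero n] {S : EllipticSystem m n} {ρ₁ ρ₂ ρ₃ : ℝ}
    {h E : Fin n → Fin n → Euc m → ℝ} {w : Fin m → Fin m → Euc m → ℝ}
    (hH : S.HypothesisH Ω ρ₁ ρ₂ ρ₃ h w E) :
    ∀ᵐ x ∂(volume.restrict Ω), ∀ i j, h i j x = h j i x := by
  simp only [ae_all_iff]; exact hH.h_symm

theorem sum_norm_sq_eq (Y : Fin n → Euc m) : ∑ i, ‖Y i‖ ^ 2 = ∑ i, ∑ p, Y i p ^ 2 :=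
  Finset.sum_congr rfl fun i _ => Euc.norm_sq (Y i)

theorem sum_quadForm_eq (H : Fin n → Fin n → ℝ) (F : Fin m → Fin m → ℝ) (Y : Fin n → Euc m) :
    ∑ j, ∑ k, H j k * quadForm F (Y j) (Y k)
      = ∑ i, ∑ j, ∑ p, ∑ q, H i j * F p q * Y i p * Y j q := by
  simp only [quadForm, Finset.mul_sum]
  exact Finset.sum_congr rfl fun _ _ => Finset.sum_congr rfl fun _ _ => Finset.sum_congr rfl
    fun _ _ => Finset.sum_congr rfl fun _ _ => by ring

/-- The energy of the truncated solution is controlled by its `L²` norm on the superlevel set. -/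
theorem exists_energy_bound [NeZero n] (hΩ : IsOpen Ω) (hΩf : volume Ω ≠ ⊤) {ρ ρ₁ ρ₂ ρ₃ : ℝ}
    (hρ₁ : 0 < ρ₁) (hρ₂ : 0 < ρ₂) (hρ₃ : 0 < ρ₃) (Λa ΛC ΛD ΛE Λh Λf ΛΓ : ℝ≥0) :
    ∃ C s₀ c : ℝ, 0 ≤ C ∧ 0 < s₀ ∧ 0 < c ∧
      ∀ (S : EllipticSystem m n) (h E : Fin n → Fin n → Euc m → ℝ)
        (w : Fin m → Fin m → Euc m → ℝ), S.StandingAssumptions Ω ρ →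
      (∀ p q, ∀ᵐ x ∂(volume.restrict Ω), S.Lpq p q x ≠ 0) →
      S.HypothesisH Ω ρ₁ ρ₂ ρ₃ h w E →
      (∀ i j p q, eLpNorm (S.a i j p q) ⊤ (volume.restrict Ω) ≤ Λa) →
      (∀ i j, eLpNorm (S.C i j) ⊤ (volume.restrict Ω) ≤ ΛC) →
      (∀ i, eLpNorm (S.D i) ⊤ (volume.restrict Ω) ≤ ΛD) →
      (∀ i j, w1InfNorm Ω (E i j) ≤ ΛE) → (∀ i j, w1InfNorm Ω (h i j) ≤ Λh) →
      eLpNorm S.f ⊤ (volume.restrict Ω) ≤ Λf →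
      ∀ y, S.IsWeakSolution Ω y → boundaryEssSup Ω y ≤ ΛΓ →
      (∀ᵐ x ∂(volume.restrict Ω),
        quadVal (fun i j => h i j x) (fun i => y x i) ≤ c * ‖y x‖ ^ 2) ∧
      (∀ᵐ x ∂(volume.restrict Ω),
        ρ₁ * ‖y x‖ ^ 2 ≤ quadVal (fun i j => h i j x) (fun i => y x i)) ∧
      AEStronglyMeasurable (fun x => quadVal (fun i j => h i j x) (fun i => y x i))
        (volume.restrict Ω) ∧
      ∀ s, s₀ ≤ s → ∃ V : Fin n → Euc m → Euc m,
        (∀ k, HasH10Grad Ω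
          (fun x => y x k * cutoff s (quadVal (fun i j => h i j x) fun i => y x i)) (V k)) ∧
        ∑ k, ∫ x in Ω, ‖V k x‖ ^ 2 ≤ C * ∫ x in Ω,
          {x | s < quadVal (fun i j => h i j x) fun i => y x i}.indicator
            (fun x => ‖y x‖ ^ 2) x := by
  set Mb : ℝ := n * (n * (m * (m * Λa))) + n * (n * (m * ΛC)) + n * (n * ΛD) with hMb
  set MF : ℝ := m * (m * (n * (Λa * ΛE))) with hMF
  obtain ⟨c₀, hc₀, C₀, hC₀, hlow⟩ := exists_bilin_sub_load_ge (m := m) (n := n) (Mf := Λf)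
    (Mb := Mb) (MF := MF) (Λh := Λh) (ΛE := ΛE) hρ₁ hρ₂ hρ₃ (by positivity) (by positivity)
    (by positivity) (by positivity) (by positivity)
  set c : ℝ := n * (n * Λh) + 1 with hc
  have hc0 : 0 < c := by positivity
  -- The term 4(ΛΓ+1)² places the levels above the boundary values; the additional 1 gives s ≥ c,
  -- whence |y| ≥ 1 wherever W > s.
  refine ⟨C₀ / c₀, c * (4 * (ΛΓ + 1) ^ 2 + 1), c, by positivity, by positivity, hc0, ?_⟩
  intro S h E w hS hL hHyp ha hC hD hE hh hf y hy hbd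
  obtain ⟨k₀, hk₀, hk₀m⟩ := exists_memH10_of_boundaryEssSup_le hbd
  obtain ⟨hEb, hdE⟩ := ae_le_of_w1InfNorm_le hE
  obtain ⟨hhb, hdh⟩ := ae_le_of_w1InfNorm_le hh
  have hY := fun i => (hy.memH1 i).hasH1Grad hΩ
  have hhG := fun i j => (hHyp.h_mem i j).hasH1Grad_of_top hΩ hΩf
  have hEG := fun i j => (hHyp.E_mem i j).hasH1Grad_of_top hΩ hΩf
  have hf' := ae_norm_le_of_eLpNorm_top_le hf
  have hb := ae_norm_bilin_le ha hC hD
  have ha' : ∀ᵐ x ∂(volume.restrict Ω), ∀ i j p q, |S.a i j p q x| ≤ Λa := by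
    simp only [ae_all_iff]
    exact fun i j p q => ae_norm_le_of_eLpNorm_top_le (ha i j p q)
  have hW : ∀ᵐ x ∂(volume.restrict Ω),
      quadVal (fun i j => h i j x) (fun i => y x i) ≤ c * ‖y x‖ ^ 2 := by
    filter_upwards [hhb] with x hx
    rw [Euc.norm_sq]
    refine (le_abs_self _).trans ((abs_quadVal_le hx _).trans ?_)
    have : 0 ≤ ∑ k, y x k ^ 2 := by positivity
    rw [hc]
    nlinarith
  have hV : ∀ᵐ x ∂(volume.restrict Ω), ∀ ξ : Fin n → ℝ,
      ρ₁ * ∑ i, ξ i ^ 2 ≤ quadVal (fun i j => h i j x) ξ := hHyp.V_pos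
  have hWm : AEStronglyMeasurable (fun x => quadVal (fun i j => h i j x) (fun i => y x i))
      (volume.restrict Ω) :=
    aestronglyMeasurable_quadVal (fun i j => (hhG i j).memLp.1) fun i => (hY i).memLp.1
  refine ⟨hW, ?_, hWm, fun s hs => ?_⟩
  · filter_upwards [hV] with x hx
    rw [Euc.norm_sq]
    exact hx _
  have hs0 : 0 < s := lt_of_lt_of_le (by positivity) hs
  have hsc : c ≤ s := by
    refine le_trans ?_ hs
    nlinarith [sq_nonneg ((ΛΓ : ℝ) + 1)]
  have hsk : 4 * c * (k₀ : ℝ) ^ 2 ≤ s := by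
    refine le_trans ?_ hs
    have h1 : (k₀ : ℝ) ≤ ΛΓ + 1 := by exact_mod_cast hk₀
    have h2 : (k₀ : ℝ) ^ 2 ≤ (ΛΓ + 1) ^ 2 := pow_le_pow_left₀ k₀.coe_nonneg h1 2
    nlinarith [mul_le_mul_of_nonneg_left h2 hc0.le]
  set V : Fin n → Euc m → Euc m := fun k x => truncGrad s (fun i j => h i j x)
    (fun i j => weakGrad Ω (h i j) x) (fun i => y x i)
    (fun i => weakGrad Ω (fun z => y z i) x) k with hVdef
  have hη := hasH10Grad_trunc hΩ hΩf hρ₁ hs0 hhG hY hhb hdh hV hk₀m hc0.le hW hsk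
  refine ⟨V, hη, ?_⟩
  set ψ : Euc m → ℝ := fun x => cutoff s (quadVal (fun i j => h i j x) fun i => y x i) with hψ
  -- The test function: the transformation E applied to the truncated solution, still in H¹₀ because
  -- E and its gradient are bounded.
  have hφ : ∀ i, HasH10Grad Ω (fun x => ∑ k, E i k x * (y x k * ψ x))
      (fun x => ∑ k, (E i k x • V k x + (y x k * ψ x) • weakGrad Ω (E i k) x)) := fun i =>
    HasH10Grad.sum _ fun k _ => HasH10Grad.bdd_mul hΩ hΩf (hEG i k) (hη k)
      (hEb.mono fun x hx => hx i k) (hdE.mono fun x hx => hx i k)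
  have hYL := Jet.memLp_mk (fun i => (hY i).memLp) fun i => (hY i).memLp_grad
  have hφL := Jet.memLp_mk (fun i => (hφ i).memLp) fun i => (hφ i).memLp_grad
  have heq := hS.integral_eq hΩ hy hY hφ
  set A := {x | s < quadVal (fun i j => h i j x) fun i => y x i} with hA
  have hAm : NullMeasurableSet A (volume.restrict Ω) :=
    nullMeasurableSet_lt aemeasurable_const hWm.aemeasurable
  have hyL : MemLp y 2 (volume.restrict Ω) := memLp_piLp_iff.2 fun i => (hY i).memLp
  have i1 : ∀ k, Integrable (fun x => ‖V k x‖ ^ 2) (volume.restrict Ω) := fun k =>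
    (hη k).memLp_grad.norm.integrable_sq
  have i2 : Integrable (A.indicator fun x => ‖y x‖ ^ 2) (volume.restrict Ω) :=
    hyL.norm.integrable_sq.indicator₀ hAm
  have i3 := hS.integrable_bilin hYL hφL
  have : IsFiniteMeasure (volume.restrict Ω) := ⟨by simpa using hΩf.lt_top⟩
  have i4 : Integrable (fun x => ∑ i, S.f x i * ∑ k, E i k x * (y x k * ψ x))
      (volume.restrict Ω) := integrable_finsetSum _ fun i _ =>
    (memLp_piLp_iff.1 (hS.f_mem.mono_exponent le_top) i).integrable_fun_mul (hφ i).memLp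
  have hmono : ∫ x in Ω, (c₀ * ∑ k, ‖V k x‖ ^ 2 - C₀ * A.indicator (fun x => ‖y x‖ ^ 2) x)
      ≤ ∫ x in Ω, (S.bilin x (Jet.mk (fun i x => y x i) (fun i => weakGrad Ω fun x => y x i) x)
        (Jet.mk (fun i x => ∑ k, E i k x * (y x k * ψ x))
          (fun i x => ∑ k, (E i k x • V k x + (y x k * ψ x) • weakGrad Ω (E i k) x)) x)
        - ∑ i, S.f x i * ∑ k, E i k x * (y x k * ψ x)) := by
    refine integral_mono_ae (((integrable_finsetSum _ fun k _ => i1 k).const_mul c₀).sub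
      (i2.const_mul C₀)) (i3.sub i4) ?_
    filter_upwards [hHyp.sum_a_mul_E hL, hHyp.h_symm_ae, hV, hHyp.F_pos, hHyp.M_pos, hdh, hEb, hdE,
      hb, hf', ha', hW] with x e1 e2 e3 e4 e5 e6 e7 e8 e9 e10 e11 e12
    have hres := hlow S x (fun i j => h i j x) (fun i j => E i j x) (fun p q => S.Fpq E p q x)
      (fun i j => weakGrad Ω (h i j) x) (fun i j => weakGrad Ω (E i j) x)
      (Jet.mk (fun i x => y x i) (fun i => weakGrad Ω fun x => y x i) x) s hs0 e1 e2 e3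
      (fun u => by rw [Euc.norm_sq]; exact e4 fun p => u p)
      (fun u v => by
        refine abs_quadForm_le (M := n * (Λa * ΛE)) (fun p q => ?_) u v
        refine (Finset.abs_sum_le_sum_abs _ _).trans ((Finset.sum_le_sum (g := fun _ =>
          (Λa : ℝ) * ΛE) fun l _ => ?_).trans (le_of_eq (by simp)))
        rw [abs_mul]
        exact mul_le_mul (e11 _ _ _ _) (e7 _ _) (abs_nonneg _) Λa.coe_nonneg)
      (fun Y => by
        rw [sum_norm_sq_eq, sum_quadForm_eq]
        exact e5 fun i p => Y i p) e6 e7 e8 e9 e10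
      (fun hlt => by
        have h1 : s < c * ‖y x‖ ^ 2 := lt_of_lt_of_le hlt e12
        have h2 : 1 ≤ ‖y x‖ ^ 2 := by
          by_contra! h3
          nlinarith
        rw [Euc.norm_sq] at h2
        exact h2)
    refine le_trans (le_of_eq ?_) (hres.trans (le_of_eq ?_))
    · congr 2
      by_cases hx : s < quadVal (fun i j => h i j x) fun i => y x i
      · rw [indicator_of_mem (show x ∈ A from hx), Euc.norm_sq]
        exact (if_pos hx).symm
      · rw [indicator_of_notMem (show x ∉ A from hx)]
        exact (if_neg hx).symm
    · rw [load_apply]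
      rfl
  -- By the weak formulation the right side integrates to zero, so the pointwise lower bound becomes
  -- the energy inequality.
  rw [integral_sub i3 i4, heq, sub_self, integral_sub
    ((integrable_finsetSum _ fun k _ => i1 k).const_mul c₀) (i2.const_mul C₀),
    integral_const_mul, integral_const_mul, integral_finsetSum _ fun k _ => i1 k] at hmono
  rw [div_mul_eq_mul_div, le_div_iff₀ hc₀, mul_comm]
  linarith

end EllipticSystem

end Energy

/-! ### Iteration over the levels -/

/-- With e = 2^{-j} the levels S(2-e) and S(2-e/2) differ by Se/2, so the cut-off is at least
(e/2)²/5: after division by S² its denominator (e/2)² + (2-e)² is at most 5. -/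
theorem le_cutoff_of_levels {S : ℝ} (hS : 0 < S) (j : ℕ) :
    (1 / 4 : ℝ) ^ (j + 1) / 5
      ≤ cutoff (S * (2 - (1 / 2) ^ j)) (S * (2 - (1 / 2) ^ (j + 1))) := by
  set e : ℝ := (1 / 2 : ℝ) ^ j with he
  have he0 : 0 < e := by positivity
  have he1 : e ≤ 1 := pow_le_one₀ (by norm_num) (by norm_num)
  have h4 : (1 / 4 : ℝ) ^ (j + 1) = e ^ 2 / 4 := by
    rw [he, pow_succ, ← pow_mul, mul_comm j 2, pow_mul]
    norm_num
    ring
  have h2 : (1 / 2 : ℝ) ^ (j + 1) = e / 2 := by rw [pow_succ, he]; ring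
  have hd : S * (2 - e / 2) - S * (2 - e) = S * (e / 2) := by ring
  rw [h4, h2, cutoff, hd, max_eq_left (by positivity), le_div_iff₀ (by positivity)]
  have h5 : (S * (e / 2)) ^ 2 + (S * (2 - e)) ^ 2 ≤ 5 * S ^ 2 := by
    have : (e / 2) ^ 2 + (2 - e) ^ 2 ≤ 5 := by nlinarith
    calc _ = S ^ 2 * ((e / 2) ^ 2 + (2 - e) ^ 2) := by ring
      _ ≤ S ^ 2 * 5 := by gcongr
      _ = _ := by ring
  calc _ ≤ e ^ 2 / 4 / 5 * (5 * S ^ 2) := by gcongr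
    _ = _ := by ring

/-- De Giorgi's iteration: by induction J ≤ Kq^j at the level S(2 - 2^{-j}). Squaring the lower
bound for the cut-off costs a factor 400·16^j, the extra power δ of J gains q^{jδ} = 16^{-j}, and
the size of S supplies the further factor q. Letting j → ∞ gives J(2S) = 0 by monotonicity. -/
theorem eq_zero_of_levels {J : ℝ → ℝ} {B δ K S q : ℝ} (hδ : 0 < δ) (hB : 0 ≤ B) (hK : 0 ≤ K)
    (hS : 0 < S) (hq : 0 < q) (hq1 : q < 1) (hqδ : q ^ δ = 1 / 16) (hJ : ∀ s, 0 ≤ J s)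
    (hanti : Antitone J) (hJK : J S ≤ K)
    (hstep : ∀ s s', S ≤ s → s < s' → cutoff s s' ^ 2 * J s' ≤ B * (J s / s) ^ δ * J s)
    (hbig : 400 * B * K ^ δ ≤ q * S ^ δ) : J (2 * S) = 0 := by
  have key : ∀ j : ℕ, J (S * (2 - (1 / 2) ^ j)) ≤ K * q ^ j := by
    intro j
    induction j with
    | zero => norm_num; exact hJK
    | succ j ih =>
      set e : ℝ := (1 / 2 : ℝ) ^ j with he
      have he0 : 0 < e := by positivity
      have he1 : e ≤ 1 := pow_le_one₀ (by norm_num) (by norm_num)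
      have hSs : S ≤ S * (2 - e) := by nlinarith
      have h1 := hstep (S * (2 - e)) (S * (2 - (1 / 2) ^ (j + 1))) hSs (by
        rw [pow_succ, ← he]
        nlinarith)
      have h2 := le_cutoff_of_levels hS j
      rw [← he] at h2
      set J' := J (S * (2 - (1 / 2) ^ (j + 1)))
      have hJ' : 0 ≤ J' := hJ _
      have h3 : (J (S * (2 - e)) / (S * (2 - e))) ^ δ ≤ (K * q ^ j / S) ^ δ := by
        refine Real.rpow_le_rpow (div_nonneg (hJ _) (by linarith)) ?_ hδ.le
        exact div_le_div₀ (by positivity) ih hS hSs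
      -- The choice q^δ = 1/16 makes the gain match exactly what the narrowing levels cost.
      have h4 : (K * q ^ j / S) ^ δ = K ^ δ * (1 / 16) ^ j / S ^ δ := by
        rw [Real.div_rpow (by positivity) hS.le, Real.mul_rpow hK (by positivity),
          ← Real.rpow_natCast, ← Real.rpow_mul hq.le, mul_comm (j : ℝ) δ, Real.rpow_mul hq.le, hqδ,
          Real.rpow_natCast]
      have h5 : ((1 / 4 : ℝ) ^ (j + 1) / 5) ^ 2 * J'
          ≤ B * (K ^ δ * (1 / 16) ^ j / S ^ δ) * (K * q ^ j) := by
        rw [← h4]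
        calc _ ≤ cutoff (S * (2 - e)) (S * (2 - (1 / 2) ^ (j + 1))) ^ 2 * J' := by gcongr
          _ ≤ _ := h1
          _ ≤ _ := by
            have := hJ (S * (2 - e))
            gcongr
      have h6 : ((1 / 4 : ℝ) ^ (j + 1) / 5) ^ 2 = (1 / 16) ^ j / 400 := by
        rw [div_pow, ← pow_mul, mul_comm, pow_mul, pow_succ]
        norm_num
        ring
      have hSδ : 0 < S ^ δ := by positivity
      have h7 : J' ≤ 400 * B * K ^ δ / S ^ δ * (K * q ^ j) := by
        have h16 : (0 : ℝ) < (1 / 16) ^ j := by positivity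
        rw [h6] at h5
        refine le_of_mul_le_mul_left (h5.trans (le_of_eq ?_)) (by positivity : 0 < (1 / 16 : ℝ) ^ j / 400)
        ring
      have h8 : 400 * B * K ^ δ / S ^ δ ≤ q := by rw [div_le_iff₀ hSδ]; exact hbig
      calc J' ≤ _ := h7
        _ ≤ q * (K * q ^ j) := by gcongr
        _ = _ := by rw [pow_succ]; ring
  have h1 : ∀ j : ℕ, J (2 * S) ≤ K * q ^ j := fun j => by
    refine le_trans (hanti ?_) (key j)
    have : (0 : ℝ) < (1 / 2) ^ j := by positivity
    nlinarith
  have h2 : Tendsto (fun j : ℕ => K * q ^ j) atTop (𝓝 (K * 0)) :=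
    (tendsto_pow_atTop_nhds_zero_of_lt_one hq.le hq1).const_mul K
  rw [mul_zero] at h2
  exact le_antisymm (ge_of_tendsto' h2 h1) (hJ _)

/-- The form of the Sobolev inequality used in the iteration. -/
theorem exists_integral_indicator_sq_le {m : ℕ} (hm : m ≠ 0) {Ω : Set (Euc m)} (hΩ : IsOpen Ω)
    (hΩf : volume Ω ≠ ⊤) :
    ∃ P : ℝ, 0 ≤ P ∧ ∀ (u : Euc m → ℝ) (G : Euc m → Euc m) (A : Set (Euc m)), HasH10Grad Ω u G →
      NullMeasurableSet A (volume.restrict Ω) →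
      ∫ x in Ω, A.indicator (fun x => u x ^ 2) x
        ≤ P * ((volume.restrict Ω).real A ^ (2 / ((m : ℝ) + 2)) * ∫ x in Ω, ‖G x‖ ^ 2) := by
  obtain ⟨P, hP⟩ := exists_eLpNorm_restrict_le_measure_rpow hm hΩ hΩf
  have : IsFiniteMeasure (volume.restrict Ω) := ⟨by simpa using hΩf.lt_top⟩
  refine ⟨(P : ℝ) ^ 2, by positivity, fun u G A hu hA => ?_⟩
  have h := ENNReal.toReal_mono (ENNReal.mul_ne_top ENNReal.coe_ne_top (ENNReal.mul_ne_top
    (ENNReal.rpow_ne_top_of_nonneg (by positivity) (measure_ne_top _ _)) hu.memLp_grad.2.ne))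
    (hP u G A hu hA)
  rw [ENNReal.toReal_mul, ENNReal.toReal_mul, ← ENNReal.toReal_rpow, ENNReal.coe_toReal] at h
  have h2 := pow_le_pow_left₀ ENNReal.toReal_nonneg h 2
  have huA : MemLp (A.indicator u) 2 (volume.restrict Ω) :=
    ⟨hu.memLp.1.indicator₀ hA, (eLpNorm_indicator_le u).trans_lt hu.memLp.2⟩
  rw [huA.toReal_eLpNorm_two_sq, mul_pow, mul_pow,
    hu.memLp_grad.toReal_eLpNorm_two_sq, ← Real.rpow_natCast (_ ^ (1 / ((m : ℝ) + 2))),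
    ← Real.rpow_mul ENNReal.toReal_nonneg] at h2
  have e1 : 1 / ((m : ℝ) + 2) * (2 : ℕ) = 2 / ((m : ℝ) + 2) := by push_cast; ring
  rw [e1] at h2
  refine le_trans (le_of_eq ?_) h2
  congr 1
  ext x
  by_cases hx : x ∈ A <;> simp [hx]

/-- Functions whose truncations satisfy the energy bound are bounded. -/
theorem exists_ae_le_of_energy_bound {m n : ℕ} (hm : m ≠ 0) {Ω : Set (Euc m)} (hΩ : IsOpen Ω)
    (hΩf : volume Ω ≠ ⊤) {C s₀ c K : ℝ} (hC : 0 ≤ C) (hs₀ : 0 < s₀) (hc : 0 < c) (hK : 0 ≤ K) :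
    ∃ S : ℝ, 0 ≤ S ∧ ∀ (y : Euc m → Euc n) (W : Euc m → ℝ), MemLp y 2 (volume.restrict Ω) →
      AEStronglyMeasurable W (volume.restrict Ω) →
      (∀ᵐ x ∂(volume.restrict Ω), W x ≤ c * ‖y x‖ ^ 2) → ∫ x in Ω, ‖y x‖ ^ 2 ≤ K →
      (∀ s, s₀ ≤ s → ∃ V : Fin n → Euc m → Euc m,
        (∀ k, HasH10Grad Ω (fun x => y x k * cutoff s (W x)) (V k)) ∧
        ∑ k, ∫ x in Ω, ‖V k x‖ ^ 2
          ≤ C * ∫ x in Ω, {x | s < W x}.indicator (fun x => ‖y x‖ ^ 2) x) →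
      ∀ᵐ x ∂(volume.restrict Ω), W x ≤ S := by
  obtain ⟨P, hP0, hP⟩ := exists_integral_indicator_sq_le hm hΩ hΩf
  have : IsFiniteMeasure (volume.restrict Ω) := ⟨by simpa using hΩf.lt_top⟩
  set δ : ℝ := 2 / ((m : ℝ) + 2) with hδdef
  have hδ : 0 < δ := by positivity
  set B : ℝ := P * C * c ^ δ with hB
  have hB0 : 0 ≤ B := by positivity
  -- The ratio of the geometric decay, determined by the factor 1/16 lost at each step.
  set q : ℝ := (1 / 16 : ℝ) ^ (1 / δ) with hq
  have hq0 : 0 < q := by positivity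
  have hq1 : q < 1 := Real.rpow_lt_one (by norm_num) (by norm_num) (by positivity)
  have hqδ : q ^ δ = 1 / 16 := by
    rw [hq, ← Real.rpow_mul (by norm_num), one_div_mul_cancel hδ.ne', Real.rpow_one]
  -- The first level must lie in the range of the energy bound, and be large enough for the
  -- iteration to start from ∫|y|² ≤ K alone.
  set S : ℝ := max s₀ ((400 * B * K ^ δ / q) ^ (1 / δ)) with hS
  have hS0 : 0 < S := lt_of_lt_of_le hs₀ (le_max_left _ _)
  have hbig : 400 * B * K ^ δ ≤ q * S ^ δ := by
    have h1 : (400 * B * K ^ δ / q) ≤ S ^ δ := by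
      calc 400 * B * K ^ δ / q = ((400 * B * K ^ δ / q) ^ (1 / δ)) ^ δ := by
            rw [← Real.rpow_mul (by positivity), one_div_mul_cancel hδ.ne', Real.rpow_one]
        _ ≤ S ^ δ := Real.rpow_le_rpow (by positivity) (le_max_right _ _) hδ.le
    rw [div_le_iff₀ hq0] at h1
    linarith
  refine ⟨2 * S, by positivity, fun y W hy hWm hW hyK hV => ?_⟩
  set A : ℝ → Set (Euc m) := fun s => {x | s < W x} with hA
  have hAm : ∀ s, NullMeasurableSet (A s) (volume.restrict Ω) := fun s =>
    nullMeasurableSet_lt aemeasurable_const hWm.aemeasurable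
  have hy2 : Integrable (fun x => ‖y x‖ ^ 2) (volume.restrict Ω) := hy.norm.integrable_sq
  have hi : ∀ s, Integrable ((A s).indicator fun x => ‖y x‖ ^ 2) (volume.restrict Ω) := fun s =>
    hy2.indicator₀ (hAm s)
  set J : ℝ → ℝ := fun s => ∫ x in Ω, (A s).indicator (fun x => ‖y x‖ ^ 2) x with hJdef
  have hind0 : ∀ s x, 0 ≤ (A s).indicator (fun x => ‖y x‖ ^ 2) x := fun s x =>
    indicator_nonneg (fun x _ => sq_nonneg _) x
  have hJ0 : ∀ s, 0 ≤ J s := fun s => integral_nonneg fun x => hind0 s x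
  have hanti : Antitone J := fun s s' hss' => by
    refine integral_mono (hi s') (hi s) fun x => ?_
    refine indicator_le_indicator_of_subset (fun x hx => ?_) (fun x => sq_nonneg _) x
    exact lt_of_le_of_lt hss' hx
  have hJK : J S ≤ K := by
    refine le_trans (integral_mono (hi S) hy2 fun x => ?_) hyK
    exact indicator_le_self' (fun x _ => sq_nonneg _) x
  -- Chebyshev's inequality, with W ≤ c|y|²: s times the measure of {W > s} is at most c times the
  -- integral of |y|² over that set.
  have hmeas : ∀ s, 0 < s → (volume.restrict Ω).real (A s) ≤ c * (J s / s) := by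
    intro s hs
    have h1 : s * (volume.restrict Ω).real (A s) ≤ c * J s := by
      have e1 : ∫ x in Ω, (A s).indicator (fun _ => s) x = s * (volume.restrict Ω).real (A s) := by
        rw [integral_indicator₀ (hAm s), setIntegral_const, smul_eq_mul, mul_comm]
      rw [← e1, ← integral_const_mul]
      refine integral_mono_ae ((integrable_const s).indicator₀ (hAm s)) ((hi s).const_mul c) ?_
      filter_upwards [hW] with x hx
      by_cases hxA : x ∈ A s
      · simp only [indicator_of_mem hxA]
        exact (le_of_lt hxA).trans hx
      · simp [indicator_of_notMem hxA]
    rw [mul_div_assoc', le_div_iff₀ hs]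
    linarith
  have hstep : ∀ s s', S ≤ s → s < s' → cutoff s s' ^ 2 * J s' ≤ B * (J s / s) ^ δ * J s := by
    intro s s' hs hss'
    have hs0 : 0 < s := hS0.trans_le hs
    obtain ⟨V, hV1, hV2⟩ := hV s ((le_max_left _ _).trans hs)
    have hsob := fun k => hP _ _ (A s') (hV1 k) (hAm s')
    have i1 : ∀ k, Integrable ((A s').indicator fun x => (y x k * cutoff s (W x)) ^ 2)
        (volume.restrict Ω) := fun k => (hV1 k).memLp.integrable_sq.indicator₀ (hAm s')
    -- On {W > s'} the cut-off at level s is at least its value at s', so the truncation at s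
    -- controls y at the next level.
    have h1 : cutoff s s' ^ 2 * J s'
        ≤ ∑ k, ∫ x in Ω, (A s').indicator (fun x => (y x k * cutoff s (W x)) ^ 2) x := by
      rw [← integral_finsetSum _ fun k _ => i1 k, hJdef, ← integral_const_mul]
      refine integral_mono ((hi s').const_mul _) (integrable_finsetSum _ fun k _ => i1 k)
        fun x => ?_
      by_cases hx : x ∈ A s'
      · simp only [indicator_of_mem hx, mul_pow]
        rw [← Finset.sum_mul, ← Euc.norm_sq, mul_comm]
        have := cutoff_mono hs0 (le_of_lt hx : s' ≤ W x)
        have := cutoff_nonneg s s'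
        gcongr
      · simp [indicator_of_notMem hx]
    have h2 : (volume.restrict Ω).real (A s') ^ δ ≤ (c * (J s / s)) ^ δ := by
      refine Real.rpow_le_rpow measureReal_nonneg ?_ hδ.le
      refine le_trans ?_ (hmeas s hs0)
      exact measureReal_mono (fun x hx => lt_trans hss' hx)
    calc _ ≤ _ := h1
      _ ≤ ∑ k, P * ((volume.restrict Ω).real (A s') ^ δ * ∫ x in Ω, ‖V k x‖ ^ 2) :=
        Finset.sum_le_sum fun k _ => hsob k
      _ = P * ((volume.restrict Ω).real (A s') ^ δ * ∑ k, ∫ x in Ω, ‖V k x‖ ^ 2) := by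
        rw [← Finset.mul_sum, ← Finset.mul_sum]
      _ ≤ P * ((c * (J s / s)) ^ δ * (C * J s)) := by
        have : 0 ≤ ∑ k, ∫ x in Ω, ‖V k x‖ ^ 2 :=
          Finset.sum_nonneg fun k _ => integral_nonneg fun x => sq_nonneg _
        have : 0 ≤ (c * (J s / s)) ^ δ :=
          Real.rpow_nonneg (mul_nonneg hc.le (div_nonneg (hJ0 s) hs0.le)) _
        gcongr
      _ = _ := by
        rw [Real.mul_rpow hc.le (div_nonneg (hJ0 s) hs0.le), hB]
        ring
  have hzero := eq_zero_of_levels hδ hB0 hK hS0 hq0 hq1 hqδ hJ0 hanti hJK hstep hbig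
  have h0 := (integral_eq_zero_iff_of_nonneg (fun x => hind0 (2 * S) x) (hi (2 * S))).1 hzero
  -- Where W > 2S the vanishing integral forces y = 0, and then W ≤ c|y|² = 0 is a contradiction.
  filter_upwards [h0, hW] with x hx hWx
  by_contra! hlt
  rw [indicator_of_mem (show x ∈ A (2 * S) from hlt)] at hx
  have h1 : ‖y x‖ ^ 2 = 0 := hx
  rw [h1, mul_zero] at hWx
  linarith
end

/-! ### Assembly of existence, uniqueness and boundedness -/

theorem theorem2p2 (m n : ℕ) [NeZero m] [NeZero n] :
    ∃ ν₀ : ℝ → ℝ, (∀ θ, 0 < ν₀ θ) ∧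
      ∀ Ω : Set (Euc m), IsBoundedC1Domain Ω →
        -- well-posedness, which makes `ν₀` the constant of the theorem
        (∀ (ρ θ ν : ℝ) (S : EllipticSystem m n), 0 < ρ → (m : ℝ) < θ → 2 ≤ θ → ν₀ θ ≤ ν →
          S.StandingAssumptions Ω ρ → S.ZeroOrderCoercive Ω ρ θ ν →
          ∃ y, S.IsWeakSolution Ω y ∧
            ∀ z, S.IsWeakSolution Ω z → z =ᵐ[volume.restrict Ω] y) ∧
        -- boundedness of the weak solution
        (∀ (ρ ρ₁ ρ₂ ρ₃ : ℝ) (Λa ΛC ΛD ΛE Λh Λg Λf ΛΓ : ℝ≥0),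
          0 < ρ → 0 < ρ₁ → 0 < ρ₂ → 0 < ρ₃ →
          ∃ K : ℝ≥0, ∀ (θ ν : ℝ) (S : EllipticSystem m n)
            (h E : Fin n → Fin n → Euc m → ℝ) (w : Fin m → Fin m → Euc m → ℝ),
            (m : ℝ) < θ → 2 ≤ θ → ν₀ θ ≤ ν →
            S.StandingAssumptions Ω ρ → S.ZeroOrderCoercive Ω ρ θ ν →
            (∀ p q, ∀ᵐ x ∂(volume.restrict Ω), S.Lpq p q x ≠ 0) →
            S.HypothesisH Ω ρ₁ ρ₂ ρ₃ h w E →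
            (∀ i j p q, eLpNorm (S.a i j p q) ∞ (volume.restrict Ω) ≤ Λa) →
            (∀ i j, eLpNorm (S.C i j) ∞ (volume.restrict Ω) ≤ ΛC) →
            (∀ i, eLpNorm (S.D i) ∞ (volume.restrict Ω) ≤ ΛD) →
            (∀ i j, w1InfNorm Ω (E i j) ≤ ΛE) →
            (∀ i j, w1InfNorm Ω (h i j) ≤ Λh) →
            h1Norm Ω S.g ≤ Λg →
            eLpNorm S.f ∞ (volume.restrict Ω) ≤ Λf →
            ∀ y, S.IsWeakSolution Ω y → boundaryEssSup Ω y ≤ ΛΓ →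
              essSup (fun x => ‖y x‖ₑ) (volume.restrict Ω) ≤ K) := by
  classical
  have hm : m ≠ 0 := NeZero.ne m
  have hν : ∀ θ : ℝ, ∃ ν₀ : ℝ, 0 < ν₀ ∧ ((m : ℝ) < θ → 2 ≤ θ →
      ∀ (S : EllipticSystem m n) (Ω : Set (Euc m)) (ρ ν : ℝ), IsOpen Ω →
      volume Ω ≠ ⊤ → 0 < ρ → ν₀ ≤ ν → S.StandingAssumptions Ω ρ → S.ZeroOrderCoercive Ω ρ θ ν →
      ∀ (u : Fin n → Euc m → ℝ) (G : Fin n → Euc m → Euc m), (∀ i, HasH10Grad Ω (u i) (G i)) →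
      ρ / 2 * ∑ i, ∫ x in Ω, ‖G i x‖ ^ 2
        ≤ ∫ x in Ω, S.bilin x (Jet.mk u G x) (Jet.mk u G x)) := by
    intro θ
    by_cases h : (m : ℝ) < θ ∧ 2 ≤ θ
    · obtain ⟨ν₀, h0, h1⟩ := EllipticSystem.exists_coercive (n := n) hm h.1 h.2
      exact ⟨ν₀, h0, fun _ _ => h1⟩
    · exact ⟨1, one_pos, fun h1 h2 => (h ⟨h1, h2⟩).elim⟩
  choose ν₀ hν0 hcoer using hν
  refine ⟨ν₀, hν0, fun Ω hΩ => ?_⟩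
  have hΩf : volume Ω ≠ ⊤ := hΩ.isBounded.measure_lt_top.ne
  refine ⟨fun ρ θ ν S hρ hmθ hθ hν hS hD => ?_, ?_⟩
  · have hB := hcoer θ hmθ hθ S Ω ρ ν hΩ.isOpen hΩf hρ hν hS hD
    obtain ⟨y, hy⟩ := hS.exists_isWeakSolution hm hΩ.isOpen hΩf hρ hB
    exact ⟨y, hy, fun z hz => hS.isWeakSolution_unique hm hΩ.isOpen hΩf hρ hB hy hz⟩
  · intro ρ ρ₁ ρ₂ ρ₃ Λa ΛC ΛD ΛE Λh Λg Λf ΛΓ hρ hρ₁ hρ₂ hρ₃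
    -- The three constants are produced in turn from the domain, the ρ's and the upper bounds,
    -- before θ, ν and the system are introduced.
    obtain ⟨K, hK0, hK⟩ := EllipticSystem.exists_integral_norm_sq_le (n := n) hm hΩ.isOpen hΩf hρ
      Λa ΛC ΛD Λg Λf
    obtain ⟨C, s₀, c, hC, hs₀, hc, hen⟩ := EllipticSystem.exists_energy_bound (n := n) (ρ := ρ)
      hΩ.isOpen hΩf hρ₁ hρ₂ hρ₃ Λa ΛC ΛD ΛE Λh Λf ΛΓ
    obtain ⟨L, hL0, hL⟩ := exists_ae_le_of_energy_bound (n := n) hm hΩ.isOpen hΩf hC hs₀ hc hK0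
    -- The bound on W passes to |y| through ρ₁|y|² ≤ W ≤ L.
    refine ⟨(√(L / ρ₁)).toNNReal, ?_⟩
    intro θ ν S h E w hmθ hθ hν hS hD hLpq hH ha hCb hDb hE hh hg hf y hy hbd
    have hB := hcoer θ hmθ hθ S Ω ρ ν hΩ.isOpen hΩf hρ hν hS hD
    have hyK := hK S hS hB ha hCb hDb hg hf y hy
    obtain ⟨hW, hWρ, hWm, hV⟩ := hen S h E w hS hLpq hH ha hCb hDb hE hh hf y hy hbd
    have hyL : MemLp y 2 (volume.restrict Ω) :=
      memLp_piLp_iff.2 fun i => ((hy.memH1 i).hasH1Grad hΩ.isOpen).memLp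
    have hbound := hL y _ hyL hWm hW hyK hV
    refine essSup_le_of_ae_le _ ?_
    filter_upwards [hbound, hWρ] with x h1 h2
    rw [← ofReal_norm, ENNReal.ofReal, ENNReal.coe_le_coe]
    refine Real.toNNReal_le_toNNReal (Real.le_sqrt_of_sq_le ?_)
    rw [le_div_iff₀ hρ₁]
    linarith
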